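/- Let $N\ge 2$, $q\ge p\ge 2$, $s_1\in(0,1)$, $s_p\in\left(\frac{p-1}{p},1\right)$, and let $\alpha\in\left(0,\frac{s_pp-(p-1)}{q}\right)$. Then there is a constant $C=C(N,p,q,s_1,s_p,\alpha)>0$ such that the following holds for every bounded domain $\Omega\subset\mathbb R^N$. Let $u\in W^{1,q}_{\rm loc}(\Omega)$ be a locally bounded weak solution of $(-\Delta_1)^{s_1}u+(-\Delta_p)^{s_p}u=0$ in $\Omega$, i.e. $u\in L^\infty_{\rm loc}(\Omega)\cap W^{s_1,1}_{\rm loc}(\Omega)\cap W^{s_p,p}_{\rm loc}(\Omega)$, $u\in L^{p-1}_{\rm loc}(\mathbb R^N)$ with $\int_{\mathbb R^N}\frac{|u(x)|^{p-1}}{(1+|x|)^{N+s_pp}}\,dx<\infty$, and there is $Z\in L^\infty(\mathbb R^N\times\mathbb R^N)$ with $Z(x,y)\in\operatorname{sgn}(u(x)-u(y))$ for a.e. $(x,y)$, where $\operatorname{sgn}(0)=[-1,1]$, such that $$\int_{\mathbb R^N}\!\int_{\mathbb R^N}Z(x,y)\frac{\varphi(x)-\varphi(y)}{|x-y|^{N+s_1}}\,dx\,dy+\int_{\mathbb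 R^N}\!\int_{\mathbb R^N}\frac{|u(x)-u(y)|^{p-2}(u(x)-u(y))(\varphi(x)-\varphi(y))}{|x-y|^{N+s_pp}}\,dx\,dy=0$$ for every $\varphi\in W^{s_1,1}(\mathbb R^N)\cap W^{s_p,p}(\mathbb R^N)$ with compact support in $\Omega$. Then $\nabla u\in W^{\alpha,q}_{\rm loc}(\Omega)$, i.e. $u\in W^{1+\alpha,q}_{\rm loc}(\Omega)$. Moreover, for all balls $B_r=B_r(x_0)$, $B_R=B_R(x_0)$ with $0<r<R<1$ and $\overline{B_R}\subset\Omega$, $$[\nabla u]^q_{W^{\alpha,q}(B_r)}=\int_{B_r}\!\int_{B_r}\frac{|\nabla u(x)-\nabla u(y)|^q}{|x-y|^{N+\alpha q}}\,dx\,dy\le\frac{C\left(\mathcal T+\|\nabla u\|_{L^q(B_R)}+1\right)^q}{(R-r)^{N+2q+2}},$$ where $$\mathcal T=\|u\|_{L^\infty(B_R)}+\left(R^{s_pp}\int_{\mathbb R^N\setminus B_R}\frac{|u(x)|^{p-1}}{|x-x_0|^{N+s_pp}}\,dx\right)^{\frac1{p-1}}.$$ -/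

import Mathlib

open MeasureTheory Metric Set
open scoped ENNReal

namespace NonlocalOneP

noncomputable section

/-- The Euclidean space `ℝ^N`. -/
abbrev E (N : ℕ) : Type := EuclideanSpace ℝ (Fin N)

/-- `V ⊂⊂ Ω` for open sets `V`: the closure of `V` is compact and contained in `Ω`. -/
def CompactlyInside {N : ℕ} (V Ω : Set (E N)) : Prop :=
  IsOpen V ∧ IsCompact (closure V) ∧ closure V ⊆ Ω

/-- The `q`-th power `[f]^q_{W^{γ,q}(V)}` of the Gagliardo seminorm, for scalar or
vector valued `f`, as an element of `[0,∞]`. -/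
def gagliardoPow {N : ℕ} {F : Type*} [NormedAddCommGroup F]
    (γ q : ℝ) (V : Set (E N)) (f : E N → F) : ℝ≥0∞ :=
  ∫⁻ x in V, ∫⁻ y in V, ‖f x - f y‖ₑ ^ q / ‖x - y‖ₑ ^ ((N : ℝ) + γ * q)

/-- `f ∈ L^q(V)`. -/
def MemLq {N : ℕ} {F : Type*} [NormedAddCommGroup F]
    (q : ℝ) (V : Set (E N)) (f : E N → F) : Prop :=
  MemLp f (ENNReal.ofReal q) (volume.restrict V)

/-- `f ∈ W^{γ,q}(V)`, for `0 < γ < 1` and `1 ≤ q < ∞`. -/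
def MemFracSobolev {N : ℕ} {F : Type*} [NormedAddCommGroup F]
    (γ q : ℝ) (V : Set (E N)) (f : E N → F) : Prop :=
  MemLq q V f ∧ gagliardoPow γ q V f < ∞

/-- `f ∈ W^{γ,q}_loc(Ω)`, for `0 < γ < 1` and `1 ≤ q < ∞`. -/
def MemFracSobolevLoc {N : ℕ} {F : Type*} [NormedAddCommGroup F]
    (γ q : ℝ) (Ω : Set (E N)) (f : E N → F) : Prop :=
  ∀ V : Set (E N), CompactlyInside V Ω → MemFracSobolev γ q V f

/-- `G` is the weak (distributional) gradient of `u` in the open set `Ω`. -/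
def IsWeakGradient {N : ℕ} (Ω : Set (E N)) (u : E N → ℝ) (G : E N → E N) : Prop :=
  LocallyIntegrableOn u Ω ∧ LocallyIntegrableOn G Ω ∧
  ∀ φ : E N → ℝ, ContDiff ℝ (⊤ : ℕ∞) φ → HasCompactSupport φ → tsupport φ ⊆ Ω →
    ∀ v : E N, ∫ x, u x * fderiv ℝ φ x v = - ∫ x, inner ℝ (G x) v * φ x

/-- `u ∈ W^{1,q}_loc(Ω)`: `u` has a weak gradient in `Ω`, and both are in `L^q_loc(Ω)`. -/
def MemSobolevOneLoc {N : ℕ} (q : ℝ) (Ω : Set (E N)) (u : E N → ℝ) : Prop :=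
  ∃ G : E N → E N, IsWeakGradient Ω u G ∧
    ∀ V : Set (E N), CompactlyInside V Ω → MemLq q V u ∧ MemLq q V G

/-- `u ∈ W^{1+α,q}_loc(Ω)`, `0 < α < 1`: `u ∈ L^q_loc(Ω)` has a weak gradient in `Ω`
that belongs to `W^{α,q}_loc(Ω)`. -/
def MemSobolevOneAddLoc {N : ℕ} (α q : ℝ) (Ω : Set (E N)) (u : E N → ℝ) : Prop :=
  ∃ G : E N → E N, IsWeakGradient Ω u G ∧
    (∀ V : Set (E N), CompactlyInside V Ω → MemLq q V u) ∧ MemFracSobolevLoc α q Ω G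

/-- The tail space `L^q_γ(ℝ^N)`. -/
def MemTailSpace {N : ℕ} (q γ : ℝ) (w : E N → ℝ) : Prop :=
  (∀ K : Set (E N), IsCompact K → MemLq q K w) ∧
  ∫⁻ x, ‖w x‖ₑ ^ q / ENNReal.ofReal ((1 + ‖x‖) ^ ((N : ℝ) + γ)) < ∞

/-- `Tail(u; x₀, R)`, formed with the exponents `s = s_p` and `p`. -/
def tail {N : ℕ} (s p : ℝ) (u : E N → ℝ) (x₀ : E N) (R : ℝ) : ℝ≥0∞ :=
  (ENNReal.ofReal (R ^ (s * p)) *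
    ∫⁻ x in (ball x₀ R)ᶜ, ‖u x‖ₑ ^ (p - 1) / ‖x - x₀‖ₑ ^ ((N : ℝ) + s * p)) ^ (1 / (p - 1))

/-- `T = ‖u‖_{L^∞(B_R(x₀))} + Tail(u; x₀, R)`. -/
def bigT {N : ℕ} (s p : ℝ) (u : E N → ℝ) (x₀ : E N) (R : ℝ) : ℝ≥0∞ :=
  eLpNorm u ∞ (volume.restrict (ball x₀ R)) + tail s p u x₀ R

/-- `u` is locally bounded in `Ω`, i.e. `u ∈ L^∞_loc(Ω)`. -/
def LocallyBounded {N : ℕ} (Ω : Set (E N)) (u : E N → ℝ) : Prop :=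
  ∀ V : Set (E N), CompactlyInside V Ω → eLpNorm u ∞ (volume.restrict V) < ∞

/-- The set-valued sign, with `sgn(0) = [-1,1]`. -/
def sgnSet (t : ℝ) : Set ℝ :=
  {z | (0 < t → z = 1) ∧ (t < 0 → z = -1) ∧ (t = 0 → z ∈ Icc (-1 : ℝ) 1)}

/-- Test functions: functions of `W^{s₁,1}(ℝ^N) ∩ W^{s_p,p}(ℝ^N)` with compact support in `Ω`. -/
def IsTestFunction {N : ℕ} (s₁ sp p : ℝ) (Ω : Set (E N)) (φ : E N → ℝ) : Prop :=
  MemFracSobolev s₁ 1 univ φ ∧ MemFracSobolev sp p univ φ ∧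
    HasCompactSupport φ ∧ tsupport φ ⊆ Ω

/-- Weak solutions of `(-Δ_1)^{s₁} u + (-Δ_p)^{s_p} u = 0` in `Ω`.

The test functions are the elements of `W^{s₁,1}_0(Ω) ∩ W^{s_p,p}_0(Ω)` with compact support
in `Ω`. For these both double integrals converge absolutely for every `u` in the function
spaces required below, which are only local in `Ω`. Testing with fewer functions makes the notion
weaker, so every solution in the sense of a larger test class is a solution here. -/
structure IsWeakSolution {N : ℕ} (s₁ sp p : ℝ) (Ω : Set (E N)) (u : E N → ℝ) : Prop where
  mem_one : MemFracSobolevLoc s₁ 1 Ω u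
  mem_p : MemFracSobolevLoc sp p Ω u
  mem_tail : MemTailSpace (p - 1) (sp * p) u
  weak_eq : ∃ Z : E N × E N → ℝ, MemLp Z ∞ volume ∧
    (∀ᵐ z : E N × E N, Z z ∈ sgnSet (u z.1 - u z.2)) ∧
    ∀ φ : E N → ℝ, IsTestFunction s₁ sp p Ω φ →
      (∫ z : E N × E N, Z z * (φ z.1 - φ z.2) / ‖z.1 - z.2‖ ^ ((N : ℝ) + s₁)) +
      (∫ z : E N × E N, |u z.1 - u z.2| ^ (p - 2) * (u z.1 - u z.2) * (φ z.1 - φ z.2) /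
        ‖z.1 - z.2‖ ^ ((N : ℝ) + sp * p)) = 0

end

end NonlocalOneP

open NonlocalOneP

/-!
Write `n = p - 1`, `m = q - n` and `s = s_p p`, so that `n < s`. Subtract the equation from its
translate by `h` and test the difference with a cutoff times the signed `m`-th power of the
increment `Δ_h u`. The `1`-Laplacian part is monotone, and the product of an increment of the signed
`n`-th power with one of the signed `m`-th power controls a `q`-th power, whence locally
`∫∫ |Δ_h u(x) - Δ_h u(y)|^q |x - y|^{-N-s} ≤ C |h|^m`. The increment of a function by `k` costs at
most `|k|^s` times its Gagliardo seminorm, so the second differences of `u` satisfy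
`‖Δ_h Δ_k u‖_q^q ≤ C |h|^m |k|^s`. Telescoping the dyadic difference quotients, whose limit is
`∇u · h`, yields `‖∇u(· + k) - ∇u‖_q^q ≤ C |k|^{s-n}`, which is integrable against `|k|^{-N-αq}`
near `0` because `αq < s - n`.
-/

namespace NonlocalOneP

open Filter Topology

/-! ### Signed powers -/

/-- The odd power function `t ↦ |t|^{m-1} t`, which for `m > 0` extends `t ↦ t^m` from `t ≥ 0`. -/
noncomputable def signedPow (m t : ℝ) : ℝ := |t| ^ (m - 1) * t

section SignedPow

variable {m n a b M : ℝ}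

lemma signedPow_of_nonneg (hm : 0 < m) (ha : 0 ≤ a) : signedPow m a = a ^ m := by
  rcases ha.eq_or_lt with rfl | ha'
  · simp [signedPow, Real.zero_rpow hm.ne']
  · rw [signedPow, abs_of_pos ha', Real.rpow_sub_one ha'.ne', div_mul_cancel₀ _ ha'.ne']

lemma signedPow_neg (m a : ℝ) : signedPow m (-a) = -signedPow m a := by
  simp [signedPow]

lemma signedPow_of_nonpos (hm : 0 < m) (ha : a ≤ 0) : signedPow m a = -(-a) ^ m := by
  rw [← signedPow_of_nonneg hm (neg_nonneg.2 ha), signedPow_neg, neg_neg]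

lemma abs_signedPow (hm : 0 < m) (a : ℝ) : |signedPow m a| = |a| ^ m := by
  rcases le_total 0 a with ha | ha
  · rw [signedPow_of_nonneg hm ha, abs_of_nonneg ha, abs_of_nonneg (by positivity)]
  · have ha' : 0 ≤ -a := neg_nonneg.2 ha
    rw [signedPow_of_nonpos hm ha, abs_neg, abs_of_nonpos ha, abs_of_nonneg (by positivity)]

lemma measurable_signedPow (m : ℝ) : Measurable (signedPow m) := by
  unfold signedPow
  fun_prop

lemma rpow_add_le_two_rpow_mul (hm : 1 ≤ m) (ha : 0 ≤ a) (hb : 0 ≤ b) :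
    (a + b) ^ m ≤ 2 ^ (m - 1) * (a ^ m + b ^ m) := by
  lift a to NNReal using ha
  lift b to NNReal using hb
  exact_mod_cast NNReal.rpow_add_le_mul_rpow_add_rpow a b hm

lemma abs_sub_rpow_le (hm : 1 ≤ m) : |a - b| ^ m ≤ 2 ^ (m - 1) * (|a| ^ m + |b| ^ m) :=
  (Real.rpow_le_rpow (abs_nonneg _) (abs_sub a b) (by linarith)).trans
    (rpow_add_le_two_rpow_mul hm (abs_nonneg _) (abs_nonneg _))

lemma sub_rpow_le_rpow_sub_rpow (hm : 1 ≤ m) (hb : 0 ≤ b) (hab : b ≤ a) :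
    (a - b) ^ m ≤ a ^ m - b ^ m := by
  have := Real.add_rpow_le_rpow_add (sub_nonneg.2 hab) hb hm
  rw [sub_add_cancel] at this
  linarith

lemma rpow_sub_rpow_le (hm : 1 ≤ m) (hb : 0 ≤ b) (hab : b ≤ a) :
    a ^ m - b ^ m ≤ m * a ^ (m - 1) * (a - b) := by
  rcases (hb.trans hab).eq_or_lt with rfl | ha
  · simp [le_antisymm hab hb]
  have bernoulli : 1 + m * (b / a - 1) ≤ (1 + (b / a - 1)) ^ m :=
    one_add_mul_self_le_rpow_one_add (by linarith [div_nonneg hb ha.le]) hm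
  rw [add_sub_cancel, Real.div_rpow hb ha.le, le_div_iff₀ (by positivity)] at bernoulli
  have : (1 + m * (b / a - 1)) * a ^ m = a ^ m - m * a ^ (m - 1) * (a - b) := by
    rw [Real.rpow_sub_one ha.ne']
    field_simp
    ring
  linarith

lemma two_rpow_mul_sub_rpow_le_signedPow_sub (hm : 1 ≤ m) (hab : b ≤ a) :
    2 ^ (1 - m) * (a - b) ^ m ≤ signedPow m a - signedPow m b := by
  have hm0 : 0 < m := by linarith
  have two_rpow_le_one : (2 : ℝ) ^ (1 - m) ≤ 1 :=
    Real.rpow_le_one_of_one_le_of_nonpos one_le_two (by linarith)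
  have hpow : 0 ≤ (a - b) ^ m := Real.rpow_nonneg (sub_nonneg.2 hab) m
  rcases le_total 0 b with hb | hb
  · rw [signedPow_of_nonneg hm0 hb, signedPow_of_nonneg hm0 (hb.trans hab)]
    exact (mul_le_of_le_one_left hpow two_rpow_le_one).trans (sub_rpow_le_rpow_sub_rpow hm hb hab)
  rcases le_total 0 a with ha | ha
  · rw [signedPow_of_nonneg hm0 ha, signedPow_of_nonpos hm0 hb, sub_neg_eq_add]
    calc 2 ^ (1 - m) * (a - b) ^ m ≤ 2 ^ (1 - m) * (2 ^ (m - 1) * (a ^ m + (-b) ^ m)) := by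
          rw [sub_eq_add_neg a b]
          gcongr
          exact rpow_add_le_two_rpow_mul hm ha (neg_nonneg.2 hb)
      _ = a ^ m + (-b) ^ m := by
          rw [← mul_assoc, ← Real.rpow_add two_pos]
          simp
  · rw [signedPow_of_nonpos hm0 ha, signedPow_of_nonpos hm0 hb]
    have := sub_rpow_le_rpow_sub_rpow hm (neg_nonneg.2 ha) (neg_le_neg hab)
    rw [neg_sub_neg] at this
    linarith [mul_le_of_le_one_left hpow two_rpow_le_one]

lemma signedPow_mono (hm : 1 ≤ m) : Monotone (signedPow m) := fun b a hab => by
  have := two_rpow_mul_sub_rpow_le_signedPow_sub hm hab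
  have : 0 ≤ 2 ^ (1 - m) * (a - b) ^ m :=
    mul_nonneg (by positivity) (Real.rpow_nonneg (sub_nonneg.2 hab) _)
  linarith

/-- Two signed powers applied to pairs of arguments with the same difference: this is how the
operator (power `n`) meets the test function (power `m`). -/
lemma two_rpow_mul_abs_sub_rpow_le_signedPow_sub_mul {A B : ℝ} (hm : 1 ≤ m) (hn : 1 ≤ n)
    (h : a - b = A - B) :
    2 ^ (2 - (m + n)) * |A - B| ^ (m + n) ≤
      (signedPow m a - signedPow m b) * (signedPow n A - signedPow n B) := by
  wlog hAB : B ≤ A generalizing a b A B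
  · rw [abs_sub_comm]
    refine (this (a := b) (b := a) (by linarith) (le_of_not_ge hAB)).trans_eq (by ring)
  have hab := two_rpow_mul_sub_rpow_le_signedPow_sub hm (show b ≤ a by linarith)
  have hAB' := two_rpow_mul_sub_rpow_le_signedPow_sub hn hAB
  have hpos : 0 ≤ A - B := sub_nonneg.2 hAB
  rw [h] at hab
  calc 2 ^ (2 - (m + n)) * |A - B| ^ (m + n)
      = (2 ^ (1 - m) * (A - B) ^ m) * (2 ^ (1 - n) * (A - B) ^ n) := by
        rw [abs_of_nonneg hpos, Real.rpow_add_of_nonneg hpos (by linarith) (by linarith),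
          show 2 - (m + n) = (1 - m) + (1 - n) by ring, Real.rpow_add two_pos]
        ring
    _ ≤ _ := mul_le_mul hab hAB' (by positivity) (le_trans (by positivity) hab)

lemma rpow_le_rpow_sub_one_mul (hm : 1 ≤ m) (ha : 0 ≤ a) (haM : a ≤ M) :
    a ^ m ≤ M ^ (m - 1) * a := by
  calc a ^ m = a ^ (m - 1) * a := by
        rw [← Real.rpow_add_one' ha (by linarith), sub_add_cancel]
    _ ≤ M ^ (m - 1) * a := by gcongr

lemma signedPow_sub_le (hm : 1 ≤ m) (hab : b ≤ a) (ha : |a| ≤ M) (hb : |b| ≤ M) :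
    signedPow m a - signedPow m b ≤ m * M ^ (m - 1) * (a - b) := by
  have hm0 : 0 < m := by linarith
  have hM : 0 ≤ M := (abs_nonneg a).trans ha
  have same_sign : ∀ {x y : ℝ}, 0 ≤ y → y ≤ x → x ≤ M →
      x ^ m - y ^ m ≤ m * M ^ (m - 1) * (x - y) := fun {x y} hy hxy hx => by
    have hx0 : 0 ≤ x := hy.trans hxy
    refine (rpow_sub_rpow_le hm hy hxy).trans ?_
    gcongr
  rw [abs_le] at ha hb
  rcases le_total 0 b with hb0 | hb0
  · rw [signedPow_of_nonneg hm0 hb0, signedPow_of_nonneg hm0 (hb0.trans hab)]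
    exact same_sign hb0 hab ha.2
  rcases le_total 0 a with ha0 | ha0
  · rw [signedPow_of_nonneg hm0 ha0, signedPow_of_nonpos hm0 hb0, sub_neg_eq_add]
    calc a ^ m + (-b) ^ m ≤ M ^ (m - 1) * a + M ^ (m - 1) * -b :=
          add_le_add (rpow_le_rpow_sub_one_mul hm ha0 ha.2)
            (rpow_le_rpow_sub_one_mul hm (neg_nonneg.2 hb0) (by linarith))
      _ = 1 * M ^ (m - 1) * (a - b) := by ring
      _ ≤ m * M ^ (m - 1) * (a - b) := by
          gcongr
  · rw [signedPow_of_nonpos hm0 ha0, signedPow_of_nonpos hm0 hb0]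
    have := same_sign (neg_nonneg.2 ha0) (neg_le_neg hab) (by linarith)
    rw [neg_sub_neg b a] at this
    linarith

lemma abs_signedPow_sub_le (hm : 1 ≤ m) (ha : |a| ≤ M) (hb : |b| ≤ M) :
    |signedPow m a - signedPow m b| ≤ m * M ^ (m - 1) * |a - b| := by
  wlog hab : b ≤ a generalizing a b
  · rw [abs_sub_comm, abs_sub_comm a]
    exact this hb ha (le_of_not_ge hab)
  rw [abs_of_nonneg (sub_nonneg.2 (signedPow_mono hm hab)), abs_of_nonneg (sub_nonneg.2 hab)]
  exact signedPow_sub_le hm hab ha hb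

lemma ennreal_rpow_mul_rpow_le_add (x y : ℝ≥0∞) {m n : ℝ} (hm : 0 ≤ m) (hn : 0 ≤ n) :
    x ^ m * y ^ n ≤ x ^ (m + n) + y ^ (m + n) := by
  simp only [ENNReal.rpow_add_of_nonneg m n hm hn]
  rcases le_total x y with h | h
  · exact (by gcongr : x ^ m * y ^ n ≤ y ^ m * y ^ n).trans le_add_self
  · exact (by gcongr : x ^ m * y ^ n ≤ x ^ m * x ^ n).trans le_self_add

lemma rpow_mul_rpow_le_add (ha : 0 ≤ a) (hb : 0 ≤ b) (hm : 0 ≤ m) (hn : 0 ≤ n) :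
    a ^ m * b ^ n ≤ a ^ (m + n) + b ^ (m + n) := by
  have ha' : 0 ≤ a ^ (m + n) := by positivity
  have hb' : 0 ≤ b ^ (m + n) := by positivity
  rcases le_total a b with h | h
  · calc a ^ m * b ^ n ≤ b ^ m * b ^ n := by gcongr
      _ = b ^ (m + n) := (Real.rpow_add_of_nonneg hb hm hn).symm
      _ ≤ _ := by linarith
  · calc a ^ m * b ^ n ≤ a ^ m * a ^ n := by gcongr
      _ = a ^ (m + n) := (Real.rpow_add_of_nonneg ha hm hn).symm
      _ ≤ _ := by linarith

end SignedPow

/-! ### The kernels `|z|^{-N-s}` -/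

section Kernel

variable {N : ℕ} {s κ δ : ℝ}

/-- The kernel `|z|^{-N-s}`. At the origin its value is `0`, unless `s = -N`, when it is `1`. -/
noncomputable def kern (s : ℝ) (z : E N) : ℝ := ‖z‖ ^ (-((N : ℝ) + s))

lemma kern_nonneg (s : ℝ) (z : E N) : 0 ≤ kern s z := by unfold kern; positivity

lemma kern_neg (s : ℝ) (z : E N) : kern s (-z) = kern s z := by rw [kern, kern, norm_neg]

lemma kern_sub_comm (s : ℝ) (x y : E N) : kern s (x - y) = kern s (y - x) := by
  rw [← kern_neg, neg_sub]

@[fun_prop]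
lemma measurable_kern (s : ℝ) : Measurable (kern (N := N) s) := by
  unfold kern
  fun_prop

lemma rpow_norm_mul_kern (s κ : ℝ) {z : E N} (hz : z ≠ 0) :
    ‖z‖ ^ κ * kern s z = kern (s - κ) z := by
  rw [kern, kern, ← Real.rpow_add (norm_pos_iff.2 hz)]
  ring_nf

lemma rpow_norm_mul_kern_le (s κ : ℝ) (z : E N) : ‖z‖ ^ κ * kern s z ≤ kern (s - κ) z := by
  rcases eq_or_ne z 0 with rfl | hz
  · by_cases h : -((N : ℝ) + s) = 0
    · have hκ : -((N : ℝ) + (s - κ)) = κ := by linarith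
      simp [kern, h, hκ]
    · rw [kern, norm_zero, Real.zero_rpow h, mul_zero]
      exact kern_nonneg _ _
  · exact (rpow_norm_mul_kern s κ hz).le

/-- The integral of the locally integrable kernel `|z|^{κ-N}`, `κ > 0`, over the ball of radius
`2`, which contains all differences of points of a unit ball. -/
noncomputable def nearConst (N : ℕ) (κ : ℝ) : ℝ≥0∞ :=
  ∫⁻ z in ball (0 : E N) 2, ENNReal.ofReal (kern (-κ) z)

lemma nearConst_ne_top (hN : 1 ≤ N) (hκ : 0 < κ) : nearConst N κ ≠ ∞ := by
  have : Nonempty (Fin N) := ⟨⟨0, hN⟩⟩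
  have radial : IntegrableOn (fun t : ℝ => t ^ (κ - 1)) (Ioo 0 2) :=
    (intervalIntegrable_iff_integrableOn_Ioo_of_le zero_le_two).1
      (intervalIntegral.intervalIntegrable_rpow' (by linarith))
  suffices IntegrableOn (fun z : E N => ‖z‖ ^ (-((N : ℝ) + -κ))) (ball 0 2) from
    this.lintegral_lt_top.ne
  rw [integrableOn_fun_norm_addHaar (μ := (volume : Measure (E N)))
    (f := fun t : ℝ => t ^ (-((N : ℝ) + -κ)))]
  refine radial.congr_fun (fun t ht => ?_) measurableSet_Ioo
  simp only [finrank_euclideanSpace, Fintype.card_fin, smul_eq_mul]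
  rw [← Real.rpow_natCast, ← Real.rpow_add ht.1]
  congr 1
  push_cast [Nat.cast_sub hN]
  ring

/-- The integral of `(1+|z|)^{-N-s}`, which up to a power of `δ` dominates the integral of
`|z|^{-N-s}` over `|z| ≥ δ`. -/
noncomputable def farConst (N : ℕ) (s : ℝ) : ℝ≥0∞ :=
  ∫⁻ z : E N, ENNReal.ofReal ((1 + ‖z‖) ^ (-((N : ℝ) + s)))

lemma farConst_ne_top (hs : 0 < s) : farConst N s ≠ ∞ :=
  (finite_integral_one_add_norm (E := E N) (μ := volume) (r := (N : ℝ) + s)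
    (by simpa only [finrank_euclideanSpace, Fintype.card_fin, lt_add_iff_pos_right] using hs)).ne

lemma setLIntegral_kern_far_le (hs : 0 < s) (hδ : 0 < δ) (hδ1 : δ ≤ 1) :
    ∫⁻ z in {z : E N | δ ≤ ‖z‖}, ENNReal.ofReal (kern s z) ≤
      ENNReal.ofReal ((δ / 2) ^ (-((N : ℝ) + s))) * farConst N s := by
  rw [farConst, ← lintegral_const_mul' _ _ ENNReal.ofReal_ne_top]
  refine (setLIntegral_mono' (measurableSet_le measurable_const measurable_norm)
    fun z (hz : δ ≤ ‖z‖) => ?_).trans (setLIntegral_le_lintegral _ _)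
  rw [← ENNReal.ofReal_mul (by positivity), ← Real.mul_rpow (by positivity) (by positivity)]
  refine ENNReal.ofReal_le_ofReal (Real.rpow_le_rpow_of_nonpos (by positivity) ?_ ?_)
  · nlinarith [norm_nonneg z]
  · have : (0 : ℝ) ≤ N := Nat.cast_nonneg N
    linarith

end Kernel

/-! ### Mollification and weak gradients -/

lemma rpow_lintegral_le_lintegral_rpow {X : Type*} [MeasurableSpace X] {ν : Measure X}
    [IsProbabilityMeasure ν] {f : X → ℝ≥0∞} (hf : AEMeasurable f ν) {q : ℝ} (hq : 1 ≤ q) :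
    (∫⁻ x, f x ∂ν) ^ q ≤ ∫⁻ x, f x ^ q ∂ν := by
  have h := ENNReal.rpow_le_rpow
    (eLpNorm'_le_eLpNorm'_of_exponent_le one_pos hq ν hf.aestronglyMeasurable)
    (show 0 ≤ q by linarith)
  simpa [eLpNorm', ← ENNReal.rpow_mul, inv_mul_cancel₀ (show q ≠ 0 by linarith)] using h

lemma lintegral_enorm_rpow_le_of_tendsto {X F : Type*} [MeasurableSpace X] {μ : Measure X}
    [NormedAddCommGroup F] {f : ℕ → X → F} {g : X → F} {q : ℝ} {C : ℝ≥0∞}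
    (hf : ∀ n, AEStronglyMeasurable (f n) μ)
    (hlim : ∀ᵐ x ∂μ, Tendsto (fun n => f n x) atTop (𝓝 (g x)))
    (hC : ∀ n, ∫⁻ x, ‖f n x‖ₑ ^ q ∂μ ≤ C) : ∫⁻ x, ‖g x‖ₑ ^ q ∂μ ≤ C :=
  calc ∫⁻ x, ‖g x‖ₑ ^ q ∂μ ≤ ∫⁻ x, liminf (fun n => ‖f n x‖ₑ ^ q) atTop ∂μ := by
        refine lintegral_mono_ae ?_
        filter_upwards [hlim] with x hx
        exact (hx.enorm.ennrpow_const q).liminf_eq.ge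
    _ ≤ liminf (fun n => ∫⁻ x, ‖f n x‖ₑ ^ q ∂μ) atTop :=
        lintegral_liminf_le' fun n => (hf n).enorm.pow_const q
    _ ≤ C := (liminf_le_liminf (Eventually.of_forall hC)).trans_eq (liminf_const C)

lemma setLIntegral_comp_add_right_le {V : Type*} [AddGroup V] [MeasurableSpace V]
    [MeasurableAdd V] {μ : Measure V} [μ.IsAddRightInvariant] {S S' : Set V}
    (hS : MeasurableSet S) (hS' : MeasurableSet S') {k : V} (h : ∀ x ∈ S, x + k ∈ S')
    (f : V → ℝ≥0∞) : ∫⁻ x in S, f (x + k) ∂μ ≤ ∫⁻ x in S', f x ∂μ := by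
  rw [← lintegral_indicator hS, ← lintegral_indicator hS',
    ← lintegral_add_right_eq_self (S'.indicator f) k]
  refine lintegral_mono fun x => ?_
  by_cases hx : x ∈ S
  · simp only [indicator_of_mem hx, indicator_of_mem (h x hx), le_rfl]
  · simp only [indicator_of_notMem hx, zero_le]

lemma enorm_sub_rpow_le_lintegral_segment {V : Type*} [NormedAddCommGroup V]
    [InnerProductSpace ℝ V] {U : V → ℝ} {H : V → V} (hH : Continuous H) {x k : V}
    (hU : ∀ t ∈ Icc (0 : ℝ) 1, HasFDerivAt U (innerSL ℝ (H (x + t • k))) (x + t • k))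
    {q : ℝ} (hq : 1 ≤ q) :
    ‖U (x + k) - U x‖ₑ ^ q ≤ ‖k‖ₑ ^ q * ∫⁻ t in Ioc (0 : ℝ) 1, ‖H (x + t • k)‖ₑ ^ q := by
  have : IsProbabilityMeasure (volume.restrict (Ioc (0 : ℝ) 1)) := ⟨by simp⟩
  have hderiv : ∀ t ∈ uIcc (0 : ℝ) 1, HasDerivAt (fun t : ℝ => U (x + t • k))
      (inner ℝ (H (x + t • k)) k) t := fun t ht => by
    rw [uIcc_of_le zero_le_one] at ht
    have hline : HasDerivAt (fun t : ℝ => x + t • k) k t := by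
      simpa using ((hasDerivAt_id t).smul_const k).const_add x
    exact (hU t ht).comp_hasDerivAt t hline
  have hHline : Continuous fun t : ℝ => H (x + t • k) := by fun_prop
  have ftc : ∫ t in Ioc (0 : ℝ) 1, inner ℝ (H (x + t • k)) k = U (x + k) - U x := by
    rw [← intervalIntegral.integral_of_le zero_le_one,
      intervalIntegral.integral_eq_sub_of_hasDerivAt hderiv
        ((hHline.inner continuous_const).intervalIntegrable _ _)]
    simp only [one_smul, zero_smul, add_zero]
  calc ‖U (x + k) - U x‖ₑ ^ q
      ≤ (∫⁻ t in Ioc (0 : ℝ) 1, ‖k‖ₑ * ‖H (x + t • k)‖ₑ) ^ q := by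
        rw [← ftc]
        gcongr
        refine (enorm_integral_le_lintegral_enorm _).trans (lintegral_mono fun t => ?_)
        rw [mul_comm]
        simp only [← ofReal_norm, ← ENNReal.ofReal_mul (norm_nonneg _)]
        exact ENNReal.ofReal_le_ofReal (abs_real_inner_le_norm (H (x + t • k)) k)
    _ = ‖k‖ₑ ^ q * (∫⁻ t in Ioc (0 : ℝ) 1, ‖H (x + t • k)‖ₑ) ^ q := by
        rw [lintegral_const_mul' _ _ enorm_ne_top, ENNReal.mul_rpow_of_nonneg _ _ (by linarith)]
    _ ≤ _ := by
        gcongr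
        exact rpow_lintegral_le_lintegral_rpow hHline.enorm.measurable.aemeasurable hq

/-- Bump functions shrinking to the origin inside the ball of radius `ε`; the ratio `2` of their
radii stays bounded, as the Lebesgue differentiation theorem requires. -/
noncomputable def bumpSeq (V : Type*) [NormedAddCommGroup V] {ε : ℝ} (hε : 0 < ε) (n : ℕ) :
    ContDiffBump (0 : V) where
  rIn := ε / (2 * (n + 1))
  rOut := ε / (n + 1)
  rIn_pos := by positivity
  rIn_lt_rOut := by
    apply div_lt_div_of_pos_left hε (by positivity)
    linarith [Nat.cast_nonneg (α := ℝ) n]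

lemma bumpSeq_rOut_le {V : Type*} [NormedAddCommGroup V] {ε : ℝ} (hε : 0 < ε) (n : ℕ) :
    (bumpSeq V hε n).rOut ≤ ε :=
  div_le_self hε.le (by linarith [Nat.cast_nonneg (α := ℝ) n])

section Moll

variable {V : Type*} [NormedAddCommGroup V] [InnerProductSpace ℝ V] [FiniteDimensional ℝ V]
  [MeasurableSpace V] [BorelSpace V] {F : Type*} [NormedAddCommGroup F] [NormedSpace ℝ F]

/-- The mollification of `f` by the normalization of the smooth bump function `φ`. -/
noncomputable def moll (φ : ContDiffBump (0 : V)) (f : V → F) (x : V) : F :=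
  ∫ t, φ.normed volume t • f (x - t)

lemma lintegral_ofReal_normed (φ : ContDiffBump (0 : V)) :
    ∫⁻ t, ENNReal.ofReal (φ.normed volume t) = 1 := by
  rw [← ofReal_integral_eq_lintegral_ofReal φ.integrable_normed
    (Eventually.of_forall fun _ => φ.nonneg_normed _), φ.integral_normed, ENNReal.ofReal_one]

lemma measurable_ofReal_normed (φ : ContDiffBump (0 : V)) :
    Measurable fun t => ENNReal.ofReal (φ.normed volume t) :=
  φ.continuous_normed.measurable.ennreal_ofReal

lemma enorm_moll_rpow_le (φ : ContDiffBump (0 : V)) {f : V → F}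
    (hf : AEStronglyMeasurable f) {q : ℝ} (hq : 1 ≤ q) (x : V) :
    ‖moll φ f x‖ₑ ^ q ≤ ∫⁻ t, ENNReal.ofReal (φ.normed volume t) * ‖f (x - t)‖ₑ ^ q := by
  set ν : Measure V := volume.withDensity fun t => ENNReal.ofReal (φ.normed volume t) with hν
  have : IsProbabilityMeasure ν := ⟨by
    rw [hν, withDensity_apply _ MeasurableSet.univ, Measure.restrict_univ,
      lintegral_ofReal_normed]⟩
  have lintegral_ν : ∀ g : V → ℝ≥0∞,
      ∫⁻ t, g t ∂ν = ∫⁻ t, ENNReal.ofReal (φ.normed volume t) * g t := fun g =>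
    lintegral_withDensity_eq_lintegral_mul_non_measurable _ (measurable_ofReal_normed φ)
      (Eventually.of_forall fun _ => ENNReal.ofReal_lt_top) g
  have hf' : AEStronglyMeasurable fun t => f (x - t) :=
    hf.comp_quasiMeasurePreserving (quasiMeasurePreserving_sub_left volume x)
  calc ‖moll φ f x‖ₑ ^ q ≤ (∫⁻ t, ‖φ.normed volume t • f (x - t)‖ₑ) ^ q := by
        gcongr; exact enorm_integral_le_lintegral_enorm _
    _ = (∫⁻ t, ‖f (x - t)‖ₑ ∂ν) ^ q := by
        simp only [lintegral_ν, enorm_smul, Real.enorm_of_nonneg (φ.nonneg_normed _)]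
    _ ≤ ∫⁻ t, ‖f (x - t)‖ₑ ^ q ∂ν := rpow_lintegral_le_lintegral_rpow
        (hf'.enorm.mono_ac (withDensity_absolutelyContinuous _ _)) hq
    _ = _ := lintegral_ν _

lemma lintegral_moll_rpow_le (φ : ContDiffBump (0 : V)) {f : V → F}
    (hf : AEStronglyMeasurable f) {q : ℝ} (hq : 1 ≤ q) {S S' : Set V}
    (hS : MeasurableSet S) (hS' : MeasurableSet S')
    (h : ∀ x ∈ S, ∀ t, ‖t‖ < φ.rOut → x - t ∈ S') :
    ∫⁻ x in S, ‖moll φ f x‖ₑ ^ q ≤ ∫⁻ x in S', ‖f x‖ₑ ^ q := by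
  have hφ := measurable_ofReal_normed φ
  have hf2 : AEStronglyMeasurable (fun z : V × V => f (z.1 - z.2))
      ((volume.restrict S).prod volume) :=
    (hf.comp_quasiMeasurePreserving (quasiMeasurePreserving_sub volume volume)).mono_ac
      (Measure.restrict_le_self.absolutelyContinuous.prod Measure.AbsolutelyContinuous.rfl)
  calc ∫⁻ x in S, ‖moll φ f x‖ₑ ^ q
      ≤ ∫⁻ x in S, ∫⁻ t, ENNReal.ofReal (φ.normed volume t) * ‖f (x - t)‖ₑ ^ q :=
        lintegral_mono fun x => enorm_moll_rpow_le φ hf hq x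
    _ = ∫⁻ t, ∫⁻ x in S, ENNReal.ofReal (φ.normed volume t) * ‖f (x - t)‖ₑ ^ q :=
        lintegral_lintegral_swap
          ((hφ.comp measurable_snd).aemeasurable.mul (hf2.enorm.pow_const q))
    _ ≤ ∫⁻ t, ENNReal.ofReal (φ.normed volume t) * ∫⁻ x in S', ‖f x‖ₑ ^ q := by
        refine lintegral_mono fun t => ?_
        rw [lintegral_const_mul' _ _ ENNReal.ofReal_ne_top]
        rcases lt_or_ge ‖t‖ φ.rOut with ht | ht
        · gcongr ENNReal.ofReal _ * ?_
          simp_rw [sub_eq_add_neg]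
          exact setLIntegral_comp_add_right_le hS hS'
            (fun x hx => sub_eq_add_neg x t ▸ h x hx t ht) (fun x => ‖f x‖ₑ ^ q)
        · have : φ.normed volume t = 0 := by
            rw [← Function.notMem_support, φ.support_normed_eq, mem_ball_zero_iff, not_lt]
            exact ht
          simp only [this, ENNReal.ofReal_zero, zero_mul, le_rfl]
    _ = _ := by rw [lintegral_mul_const _ hφ, lintegral_ofReal_normed, one_mul]

lemma integrable_normed_smul (φ : ContDiffBump (0 : V)) {f : V → F}
    (hf : LocallyIntegrable f) (x : V) :
    Integrable fun t => φ.normed volume t • f (x - t) :=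
  φ.hasCompactSupport_normed.convolutionExists_left (ContinuousLinearMap.lsmul ℝ ℝ)
    φ.continuous_normed hf x

lemma continuous_moll (φ : ContDiffBump (0 : V)) {f : V → F}
    (hf : LocallyIntegrable f) : Continuous (moll φ f) :=
  φ.hasCompactSupport_normed.continuous_convolution_left (ContinuousLinearMap.lsmul ℝ ℝ)
    φ.continuous_normed hf

lemma tendsto_moll_bumpSeq [CompleteSpace F] {ε : ℝ} (hε : 0 < ε) {f : V → F}
    (hf : LocallyIntegrable f) :
    ∀ᵐ x, Tendsto (fun n => moll (bumpSeq V hε n) f x) atTop (𝓝 (f x)) := by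
  refine ContDiffBump.ae_convolution_tendsto_right_of_locallyIntegrable (K := 2) ?_
    (Eventually.of_forall fun n => ?_) hf
  · have := tendsto_one_div_add_atTop_nhds_zero_nat.const_mul ε
    rw [mul_zero] at this
    exact this.congr fun n => mul_one_div ε _
  · simp only [bumpSeq]
    exact le_of_eq (by field_simp)

/-- The kernel of the mollification at `x`, as a function of the integration variable. It is the
test function through which the weak gradient enters the gradient of a mollification. -/
noncomputable def mollKernel (φ : ContDiffBump (0 : V)) (x y : V) : ℝ := φ.normed volume (x - y)

lemma mollKernel_eq_zero (φ : ContDiffBump (0 : V)) {x y : V} (hy : y ∉ closedBall x φ.rOut) :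
    mollKernel φ x y = 0 := by
  rw [mollKernel, ← Function.notMem_support, φ.support_normed_eq, mem_ball_zero_iff,
    ← dist_eq_norm, dist_comm]
  exact fun h => hy (mem_closedBall.2 h.le)

lemma tsupport_mollKernel_subset (φ : ContDiffBump (0 : V)) (x : V) :
    tsupport (mollKernel φ x) ⊆ closedBall x φ.rOut :=
  closure_minimal (fun _ hy => by_contra fun h => hy (mollKernel_eq_zero φ h)) isClosed_closedBall

lemma contDiff_mollKernel (φ : ContDiffBump (0 : V)) (x : V) :
    ContDiff ℝ (⊤ : ℕ∞) (mollKernel φ x) :=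
  φ.contDiff_normed.comp (contDiff_const.sub contDiff_id)

lemma fderiv_mollKernel (φ : ContDiffBump (0 : V)) (x y : V) :
    fderiv ℝ (mollKernel φ x) y = -fderiv ℝ (φ.normed volume) (x - y) := by
  have h : HasFDerivAt (φ.normed volume) (fderiv ℝ (φ.normed volume) (x - y)) (x - y) :=
    ((φ.contDiff_normed (n := 1)).differentiable (by simp) _).hasFDerivAt
  rw [(show HasFDerivAt (mollKernel φ x) _ y from
    h.comp y ((hasFDerivAt_id y).const_sub x)).fderiv, ContinuousLinearMap.comp_neg,
    ContinuousLinearMap.comp_id]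

lemma moll_eq_integral_mollKernel (φ : ContDiffBump (0 : V)) (f : V → F) (x : V) :
    moll φ f x = ∫ y, mollKernel φ x y • f y := by
  rw [moll, ← integral_sub_left_eq_self _ volume x]
  simp only [mollKernel, sub_sub_cancel]

lemma integrable_mollKernel_smul (φ : ContDiffBump (0 : V)) {f : V → F}
    (hf : LocallyIntegrable f) (x : V) : Integrable fun y => mollKernel φ x y • f y := by
  simpa only [mollKernel, sub_sub_cancel] using (integrable_normed_smul φ hf x).comp_sub_left x

lemma mollKernel_smul_indicator (φ : ContDiffBump (0 : V)) (f : V → F) {K : Set V} {x : V}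
    (hx : closedBall x φ.rOut ⊆ K) (y : V) :
    mollKernel φ x y • K.indicator f y = mollKernel φ x y • f y := by
  by_cases hy : y ∈ K
  · rw [indicator_of_mem hy]
  · rw [mollKernel_eq_zero φ fun h => hy (hx h), zero_smul, zero_smul]

lemma exists_hasFDerivAt_moll (φ : ContDiffBump (0 : V)) {u : V → ℝ}
    (hu : LocallyIntegrable u) (x : V) :
    ∃ L : V →L[ℝ] ℝ, HasFDerivAt (moll φ u) L x ∧
      ∀ v, L v = -∫ y, u y * fderiv ℝ (mollKernel φ x) y v := by
  have hρ : ContDiff ℝ 1 (φ.normed volume) := φ.contDiff_normed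
  have hconv : ConvolutionExistsAt (fderiv ℝ (φ.normed volume)) u x
      ((ContinuousLinearMap.lsmul ℝ ℝ).precompL V) volume :=
    (φ.hasCompactSupport_normed.fderiv ℝ).convolutionExists_left _
      (hρ.continuous_fderiv (by simp)) hu x
  refine ⟨_, φ.hasCompactSupport_normed.hasFDerivAt_convolution_left
    (ContinuousLinearMap.lsmul ℝ ℝ) hρ hu x, fun v => ?_⟩
  rw [convolution_def, ContinuousLinearMap.integral_apply hconv,
    ← integral_sub_left_eq_self _ volume x, ← integral_neg]
  congr 1 with y
  simp [fderiv_mollKernel, ContinuousLinearMap.precompL_apply, mul_comm]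

lemma lintegral_translate_le_of_hasFDerivAt {U : V → ℝ} {H : V → V} (hH : Continuous H)
    {B : Set V} (hB : MeasurableSet B) (hconv : Convex ℝ B)
    (hU : ∀ x ∈ B, HasFDerivAt U (innerSL ℝ (H x)) x) {q : ℝ} (hq : 1 ≤ q) (k : V) :
    ∫⁻ x in B ∩ {x | x + k ∈ B}, ‖U (x + k) - U x‖ₑ ^ q ≤
      ‖k‖ₑ ^ q * ∫⁻ x in B, ‖H x‖ₑ ^ q := by
  have hS : MeasurableSet (B ∩ {x | x + k ∈ B}) := hB.inter (measurable_add_const k hB)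
  have segment_mem : ∀ x ∈ B ∩ {x | x + k ∈ B}, ∀ t ∈ Icc (0 : ℝ) 1, x + t • k ∈ B :=
    fun x hx t ht => by simpa only [add_sub_cancel_left] using hconv.add_smul_sub_mem hx.1 hx.2 ht
  have hHseg : Continuous fun z : V × ℝ => H (z.1 + z.2 • k) := by fun_prop
  calc ∫⁻ x in B ∩ {x | x + k ∈ B}, ‖U (x + k) - U x‖ₑ ^ q
      ≤ ∫⁻ x in B ∩ {x | x + k ∈ B}, ‖k‖ₑ ^ q *
          ∫⁻ t in Ioc (0 : ℝ) 1, ‖H (x + t • k)‖ₑ ^ q :=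
        setLIntegral_mono' hS fun x hx => enorm_sub_rpow_le_lintegral_segment hH
          (fun t ht => hU _ (segment_mem x hx t ht)) hq
    _ = ‖k‖ₑ ^ q * ∫⁻ t in Ioc (0 : ℝ) 1, ∫⁻ x in B ∩ {x | x + k ∈ B},
          ‖H (x + t • k)‖ₑ ^ q := by
        rw [lintegral_const_mul' _ _ (ENNReal.rpow_ne_top_of_nonneg (by linarith) enorm_ne_top),
          lintegral_lintegral_swap (hHseg.enorm.measurable.pow_const q).aemeasurable]
    _ ≤ ‖k‖ₑ ^ q * ∫⁻ _t in Ioc (0 : ℝ) 1, ∫⁻ x in B, ‖H x‖ₑ ^ q := by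
        gcongr ‖k‖ₑ ^ q * ?_
        exact setLIntegral_mono' measurableSet_Ioc fun t ht =>
          setLIntegral_comp_add_right_le hS hB
            (fun x hx => segment_mem x hx t ⟨ht.1.le, ht.2⟩) (fun x => ‖H x‖ₑ ^ q)
    _ = _ := by
        rw [setLIntegral_const, Real.volume_Ioc, sub_zero, ENNReal.ofReal_one, mul_one]

end Moll

section Gradient

variable {N : ℕ} {Ω : Set (E N)} {u : E N → ℝ} {G : E N → E N}

lemma integrable_indicator_of_isCompact (hG : LocallyIntegrableOn G Ω) {K : Set (E N)}
    (hK : IsCompact K) (hKΩ : K ⊆ Ω) : Integrable (K.indicator G) :=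
  (hG.integrableOn_compact_subset hKΩ hK).integrable_indicator hK.measurableSet

lemma hasFDerivAt_moll_of_isWeakGradient (hu : LocallyIntegrable u) (hG : IsWeakGradient Ω u G)
    {K : Set (E N)} (hK : IsCompact K) (hKΩ : K ⊆ Ω) (φ : ContDiffBump (0 : E N)) {x : E N}
    (hx : closedBall x φ.rOut ⊆ K) :
    HasFDerivAt (moll φ u) (innerSL ℝ (moll φ (K.indicator G) x)) x := by
  have hGK := integrable_indicator_of_isCompact hG.2.1 hK hKΩ
  have hint := integrable_mollKernel_smul φ hGK.locallyIntegrable x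
  simp only [mollKernel_smul_indicator φ G hx] at hint
  have hsupp := tsupport_mollKernel_subset φ x
  obtain ⟨L, hL, hLv⟩ := exists_hasFDerivAt_moll φ hu x
  refine hL.congr_fderiv (ContinuousLinearMap.ext fun v => ?_)
  rw [hLv, hG.2.2 _ (contDiff_mollKernel φ x)
    ((isCompact_closedBall x φ.rOut).of_isClosed_subset (isClosed_tsupport _) hsupp)
    (hsupp.trans (hx.trans hKΩ)) v, neg_neg, innerSL_apply_apply, moll_eq_integral_mollKernel,
    ← real_inner_comm]
  simp only [mollKernel_smul_indicator φ G hx]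
  rw [← integral_inner hint]
  congr 1 with y
  rw [real_inner_smul_right, real_inner_comm, mul_comm]

lemma lintegral_translate_moll_le (hu : LocallyIntegrable u) (hG : IsWeakGradient Ω u G)
    {x₀ : E N} {ρ R : ℝ} (hR : closedBall x₀ R ⊆ Ω) {φ : ContDiffBump (0 : E N)}
    (hφ : φ.rOut ≤ R - ρ) {q : ℝ} (hq : 1 ≤ q) (k : E N) :
    ∫⁻ x in ball x₀ ρ ∩ {x | x + k ∈ ball x₀ ρ}, ‖moll φ u (x + k) - moll φ u x‖ₑ ^ q ≤
      ‖k‖ₑ ^ q * ∫⁻ x in ball x₀ R, ‖G x‖ₑ ^ q := by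
  have hK : IsCompact (closedBall x₀ R) := isCompact_closedBall x₀ R
  have hGK := (integrable_indicator_of_isCompact hG.2.1 hK hR).locallyIntegrable
  refine (lintegral_translate_le_of_hasFDerivAt (continuous_moll φ hGK) measurableSet_ball
    (convex_ball x₀ ρ) (fun x hx => hasFDerivAt_moll_of_isWeakGradient hu hG hK hR φ
      (closedBall_subset_closedBall' (by linarith [mem_ball.1 hx]))) hq k).trans ?_
  gcongr ‖k‖ₑ ^ q * ?_
  refine (lintegral_moll_rpow_le φ hGK.aestronglyMeasurable hq measurableSet_ball
    (measurableSet_ball (x := x₀) (ε := R)) fun x hx t ht => ?_).trans_eq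
    (setLIntegral_congr_fun measurableSet_ball fun x hx => by
      rw [indicator_of_mem (ball_subset_closedBall hx)])
  rw [mem_ball, dist_eq_norm] at hx ⊢
  rw [sub_right_comm]
  linarith [norm_sub_le (x - x₀) t]

lemma lintegral_translate_le_of_isWeakGradient (hu : LocallyIntegrable u)
    (hG : IsWeakGradient Ω u G) {x₀ : E N} {ρ R : ℝ} (hρ : ρ < R) (hR : closedBall x₀ R ⊆ Ω)
    {q : ℝ} (hq : 1 ≤ q) (k : E N) :
    ∫⁻ x in ball x₀ ρ ∩ {x | x + k ∈ ball x₀ ρ}, ‖u (x + k) - u x‖ₑ ^ q ≤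
      ‖k‖ₑ ^ q * ∫⁻ x in ball x₀ R, ‖G x‖ₑ ^ q := by
  have hε : 0 < R - ρ := sub_pos.2 hρ
  have hlim := tendsto_moll_bumpSeq hε hu
  have hlimk : ∀ᵐ x, Tendsto (fun n => moll (bumpSeq (E N) hε n) u (x + k)) atTop
      (𝓝 (u (x + k))) :=
    (measurePreserving_add_right volume k).quasiMeasurePreserving.ae hlim
  refine lintegral_enorm_rpow_le_of_tendsto
    (f := fun n x => moll (bumpSeq (E N) hε n) u (x + k) - moll (bumpSeq (E N) hε n) u x)
    (fun n => ?_) ?_ fun n => lintegral_translate_moll_le hu hG hR (bumpSeq_rOut_le hε n) hq k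
  · have := continuous_moll (bumpSeq (E N) hε n) hu
    exact (show Continuous _ by fun_prop).aestronglyMeasurable
  · filter_upwards [ae_restrict_of_ae hlim, ae_restrict_of_ae hlimk] with x hx hxk
    exact hxk.sub hx

end Gradient

/-! ### Double integrals -/

section Double

variable {N : ℕ}

lemma lintegral_mul_comp_sub_le (f : E N → ℝ≥0∞) {c : E N → ℝ≥0∞} (hc : Measurable c)
    (hc' : ∫⁻ z, c z ≠ ∞) :
    ∫⁻ z : E N × E N, f z.1 * c (z.1 - z.2) ≤ (∫⁻ x, f x) * ∫⁻ z, c z := by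
  rw [Measure.volume_eq_prod]
  refine (lintegral_prod_le _).trans ?_
  rw [← lintegral_mul_const' _ _ hc']
  refine lintegral_mono fun x => ?_
  simp only
  rw [lintegral_const_mul _ (by fun_prop), lintegral_sub_left_eq_self c x]

lemma setLIntegral_prod_mul_kern_near_le (hN : 1 ≤ N) {κ : ℝ} (hκ : 0 < κ) {x₀ : E N} {ρ : ℝ}
    (hρ : ρ ≤ 1) (f : E N → ℝ≥0∞) :
    ∫⁻ z in ball x₀ ρ ×ˢ ball x₀ ρ, f z.1 * ENNReal.ofReal (kern (-κ) (z.1 - z.2)) ≤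
      nearConst N κ * ∫⁻ x in ball x₀ ρ, f x := by
  have hB : MeasurableSet (ball x₀ ρ) := measurableSet_ball
  have hB2 : MeasurableSet (ball (0 : E N) 2) := measurableSet_ball
  have hc : ∫⁻ z, (ball (0 : E N) 2).indicator (fun z => ENNReal.ofReal (kern (-κ) z)) z =
      nearConst N κ := lintegral_indicator hB2 _
  rw [← lintegral_indicator (hB.prod hB), mul_comm, ← lintegral_indicator hB, ← hc]
  refine (lintegral_mono fun z => ?_).trans (lintegral_mul_comp_sub_le
    ((ball x₀ ρ).indicator f)
    ((measurable_kern (-κ)).ennreal_ofReal.indicator hB2)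
    (hc ▸ nearConst_ne_top hN hκ))
  by_cases hz : z ∈ ball x₀ ρ ×ˢ ball x₀ ρ
  · have h2 : z.1 - z.2 ∈ ball (0 : E N) 2 := by
      rw [mem_ball_zero_iff, ← dist_eq_norm]
      have := dist_triangle_right z.1 z.2 x₀
      linarith [mem_ball.1 hz.1, mem_ball.1 hz.2]
    rw [indicator_of_mem hz, indicator_of_mem hz.1, indicator_of_mem h2]
  · rw [indicator_of_notMem hz]; exact zero_le

lemma measurableSet_far (δ : ℝ) : MeasurableSet {z : E N × E N | δ ≤ ‖z.1 - z.2‖} :=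
  measurableSet_le measurable_const (by fun_prop)

lemma setLIntegral_mul_kern_far_le {s δ : ℝ} (hs : 0 < s) (hδ : 0 < δ) (hδ1 : δ ≤ 1)
    (f : E N → ℝ≥0∞) :
    ∫⁻ z in {z : E N × E N | δ ≤ ‖z.1 - z.2‖},
        f z.1 * ENNReal.ofReal (kern s (z.1 - z.2)) ≤
      ENNReal.ofReal ((δ / 2) ^ (-((N : ℝ) + s))) * farConst N s * ∫⁻ x, f x := by
  have hm : MeasurableSet {z : E N | δ ≤ ‖z‖} := measurableSet_le measurable_const measurable_norm
  have hc := setLIntegral_kern_far_le (N := N) hs hδ hδ1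
  rw [← lintegral_indicator hm] at hc
  have hc' := hc.trans_lt (ENNReal.mul_lt_top ENNReal.ofReal_lt_top
    (farConst_ne_top (N := N) hs).lt_top)
  rw [← lintegral_indicator (measurableSet_far δ), mul_comm]
  refine (lintegral_mono fun z => ?_).trans ((lintegral_mul_comp_sub_le f
    ((measurable_kern s).ennreal_ofReal.indicator hm) hc'.ne).trans (by gcongr))
  by_cases hz : δ ≤ ‖z.1 - z.2‖
  · rw [indicator_of_mem (by exact hz), indicator_of_mem (by exact hz)]
  · rw [indicator_of_notMem (by exact hz)]; exact zero_le

lemma lintegral_prod_eq_lintegral_translate {f : E N × E N → ℝ≥0∞} (hf : AEMeasurable f) :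
    ∫⁻ z, f z = ∫⁻ k, ∫⁻ x, f (x, x + k) := by
  have hmp : MeasurePreserving (fun z : E N × E N => (z.1, z.1 + z.2)) volume volume :=
    measurePreserving_prod_add volume volume
  have hemb : MeasurableEmbedding (fun z : E N × E N => (z.1, z.1 + z.2)) :=
    (MeasurableEquiv.shearAddRight (E N)).measurableEmbedding
  rw [← hmp.lintegral_comp_emb hemb, Measure.volume_eq_prod]
  exact lintegral_prod_symm _ (hf.comp_quasiMeasurePreserving hmp.quasiMeasurePreserving)

lemma setLIntegral_prod_eq_lintegral_translate {B : Set (E N)} (hB : MeasurableSet B)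
    {f : E N × E N → ℝ≥0∞} (hf : AEMeasurable f (volume.restrict (B ×ˢ B))) :
    ∫⁻ z in B ×ˢ B, f z = ∫⁻ k, ∫⁻ x in B ∩ {x | x + k ∈ B}, f (x, x + k) := by
  rw [← lintegral_indicator (hB.prod hB), lintegral_prod_eq_lintegral_translate
    ((aemeasurable_indicator_iff (hB.prod hB)).2 hf)]
  refine lintegral_congr fun k => ?_
  have hm : MeasurableSet (B ∩ {x | x + k ∈ B}) := hB.inter (measurable_add_const k hB)
  rw [← lintegral_indicator hm]
  rfl

lemma setLIntegral_prod_le_nearConst_mul {κ : ℝ} {x₀ : E N} {ρ : ℝ}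
    (hρ : ρ ≤ 1) {f : E N × E N → ℝ≥0∞}
    (hf : AEMeasurable f (volume.restrict (ball x₀ ρ ×ˢ ball x₀ ρ))) {D : ℝ≥0∞}
    (h : ∀ k, ‖k‖ < 2 → ∫⁻ x in ball x₀ ρ ∩ {x | x + k ∈ ball x₀ ρ}, f (x, x + k) ≤
      ENNReal.ofReal (kern (-κ) k) * D) :
    ∫⁻ z in ball x₀ ρ ×ˢ ball x₀ ρ, f z ≤ nearConst N κ * D := by
  rw [setLIntegral_prod_eq_lintegral_translate measurableSet_ball hf, nearConst,
    ← lintegral_mul_const _ (measurable_kern _).ennreal_ofReal,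
    ← lintegral_indicator measurableSet_ball]
  refine lintegral_mono fun k => ?_
  by_cases hk : ‖k‖ < 2
  · rw [indicator_of_mem (by simpa using hk)]
    exact h k hk
  · have : ball x₀ ρ ∩ {x | x + k ∈ ball x₀ ρ} = ∅ := by
      rw [eq_empty_iff_forall_notMem]
      rintro x ⟨h1, h2⟩
      apply hk
      have h3 := dist_triangle_right (x + k) x x₀
      rw [dist_eq_norm, add_sub_cancel_left] at h3
      have h2' : dist (x + k) x₀ < ρ := h2
      linarith [mem_ball.1 h1]
    simp only [this, Measure.restrict_empty, lintegral_zero_measure]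
    exact zero_le

lemma setLIntegral_prod_swap {B : Set (E N)} (f : E N × E N → ℝ≥0∞) :
    ∫⁻ z in B ×ˢ B, f (Prod.swap z) = ∫⁻ z in B ×ˢ B, f z := by
  have h := (Measure.measurePreserving_swap (μ := (volume : Measure (E N)))
    (ν := (volume : Measure (E N)))).setLIntegral_comp_preimage_emb
    MeasurableEquiv.prodComm.measurableEmbedding f (B ×ˢ B)
  rw [preimage_swap_prod] at h
  exact h

lemma lintegral_swap (f : E N × E N → ℝ≥0∞) : ∫⁻ z : E N × E N, f z.swap = ∫⁻ z, f z := by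
  simpa using setLIntegral_prod_swap (B := univ) f

lemma measurePreserving_prod_translate (h : E N) :
    MeasurePreserving (fun z : E N × E N => (z.1 + h, z.2 + h)) volume volume :=
  (measurePreserving_add_right volume h).prod (measurePreserving_add_right volume h)

lemma setLIntegral_prod_translate_le {B B' : Set (E N)} (hB : MeasurableSet B)
    (hB' : MeasurableSet B') {h : E N} (hBB : ∀ x ∈ B, x + h ∈ B') (f : E N × E N → ℝ≥0∞) :
    ∫⁻ z in B ×ˢ B, f (z.1 + h, z.2 + h) ≤ ∫⁻ z in B' ×ˢ B', f z := by
  have : (volume : Measure (E N × E N)).IsAddRightInvariant :=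
    inferInstanceAs (volume.prod volume).IsAddRightInvariant
  exact setLIntegral_comp_add_right_le (hB.prod hB) (hB'.prod hB') (k := (h, h))
    (fun z hz => ⟨hBB z.1 hz.1, hBB z.2 hz.2⟩) f

lemma aestronglyMeasurable_fst {F : Type*} [TopologicalSpace F] {f : E N → F}
    (hf : AEStronglyMeasurable f) : AEStronglyMeasurable (fun z : E N × E N => f z.1) :=
  hf.comp_quasiMeasurePreserving Measure.quasiMeasurePreserving_fst

lemma aestronglyMeasurable_snd {F : Type*} [TopologicalSpace F] {f : E N → F}
    (hf : AEStronglyMeasurable f) : AEStronglyMeasurable (fun z : E N × E N => f z.2) :=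
  hf.comp_quasiMeasurePreserving Measure.quasiMeasurePreserving_snd

lemma aestronglyMeasurable_diff {F : Type*} [NormedAddCommGroup F] {f : E N → F}
    (hf : AEStronglyMeasurable f) :
    AEStronglyMeasurable (fun z : E N × E N => f z.1 - f z.2) :=
  (aestronglyMeasurable_fst hf).sub (aestronglyMeasurable_snd hf)

variable {F : Type*} [NormedAddCommGroup F] {f : E N → F}

/-- The integrand of the Gagliardo seminorm of order `s / q` and exponent `q`, as a function of the
pair of points. -/
noncomputable def gagliardoDensity (q s : ℝ) (f : E N → F) (x y : E N) : ℝ≥0∞ :=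
  ENNReal.ofReal (‖f x - f y‖ ^ q * kern s (x - y))

lemma aemeasurable_gagliardoDensity (hf : AEStronglyMeasurable f) (q s : ℝ) :
    AEMeasurable fun z : E N × E N => gagliardoDensity q s f z.1 z.2 :=
  (((aestronglyMeasurable_diff hf).norm.aemeasurable.pow_const q).mul
    (by fun_prop)).ennreal_ofReal

lemma gagliardoDensity_comm (q s : ℝ) (f : E N → F) (x y : E N) :
    gagliardoDensity q s f x y = gagliardoDensity q s f y x := by
  rw [gagliardoDensity, gagliardoDensity, norm_sub_rev, kern_sub_comm]

lemma enorm_rpow_div_eq_gagliardoDensity {q a : ℝ} (hq : 0 < q) (ha : 0 < (N : ℝ) + a)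
    (f : E N → F) (x y : E N) :
    ‖f x - f y‖ₑ ^ q / ‖x - y‖ₑ ^ ((N : ℝ) + a) = gagliardoDensity q a f x y := by
  rcases eq_or_ne x y with rfl | hxy
  · simp [gagliardoDensity, hq, Real.zero_rpow hq.ne']
  · have h0 : 0 < ‖x - y‖ := norm_pos_iff.2 (sub_ne_zero.2 hxy)
    rw [gagliardoDensity, kern, Real.rpow_neg h0.le, ← div_eq_mul_inv,
      ENNReal.ofReal_div_of_pos (by positivity),
      ← ENNReal.ofReal_rpow_of_nonneg (norm_nonneg _) hq.le,
      ← ENNReal.ofReal_rpow_of_nonneg (norm_nonneg _) ha.le, ofReal_norm, ofReal_norm]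

lemma gagliardoPow_eq_setLIntegral {γ q : ℝ} (hq : 0 < q) (hγ : 0 < γ) {V : Set (E N)}
    (hf : AEStronglyMeasurable f) :
    gagliardoPow γ q V f = ∫⁻ z in V ×ˢ V, gagliardoDensity q (γ * q) f z.1 z.2 := by
  have density_meas : AEMeasurable (fun z : E N × E N => gagliardoDensity q (γ * q) f z.1 z.2)
      ((volume.restrict V).prod (volume.restrict V)) := by
    rw [Measure.prod_restrict]
    exact (aemeasurable_gagliardoDensity hf q (γ * q)).restrict
  simp_rw [gagliardoPow,
    enorm_rpow_div_eq_gagliardoDensity hq (show 0 < (N : ℝ) + γ * q by positivity)]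
  rw [Measure.volume_eq_prod, ← Measure.prod_restrict, lintegral_prod _ density_meas]

end Double

/-! ### The nonlocal tail -/

section Tail

variable {N : ℕ} {s n δ M ρ R : ℝ} {u : E N → ℝ} {x₀ x y : E N}

/-- `∫_{ℝ^N ∖ B_R(x₀)} |u|^n / |x - x₀|^{N+s} dx`, the integral from which the tail is formed. -/
noncomputable def tailInt (s n : ℝ) (u : E N → ℝ) (x₀ : E N) (R : ℝ) : ℝ≥0∞ :=
  ∫⁻ x in (ball x₀ R)ᶜ, ‖u x‖ₑ ^ n / ‖x - x₀‖ₑ ^ ((N : ℝ) + s)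

lemma one_add_norm_le_mul_norm_sub (hR : 0 < R) (hx : R ≤ ‖x - x₀‖) :
    1 + ‖x‖ ≤ (1 + (1 + ‖x₀‖) / R) * ‖x - x₀‖ := by
  have : 1 + ‖x₀‖ ≤ (1 + ‖x₀‖) / R * ‖x - x₀‖ := by
    rw [div_mul_eq_mul_div, le_div_iff₀ hR]
    gcongr
  linarith [norm_le_norm_sub_add x x₀]

lemma tailInt_ne_top (hs : 0 < s) (hR : 0 < R)
    (hu : ∫⁻ x, ‖u x‖ₑ ^ n / ENNReal.ofReal ((1 + ‖x‖) ^ ((N : ℝ) + s)) < ∞) :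
    tailInt s n u x₀ R ≠ ∞ := by
  have ha : 0 < (N : ℝ) + s := by positivity
  set c := 1 + (1 + ‖x₀‖) / R
  have weight_le : ∀ x ∈ (ball x₀ R)ᶜ, ENNReal.ofReal ((1 + ‖x‖) ^ ((N : ℝ) + s)) ≤
      ENNReal.ofReal (c ^ ((N : ℝ) + s)) * ‖x - x₀‖ₑ ^ ((N : ℝ) + s) := fun x hx => by
    rw [mem_compl_iff, mem_ball, dist_eq_norm, not_lt] at hx
    rw [← ofReal_norm, ENNReal.ofReal_rpow_of_nonneg (norm_nonneg _) ha.le,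
      ← ENNReal.ofReal_mul (by positivity), ← Real.mul_rpow (by positivity) (norm_nonneg _)]
    gcongr
    exact one_add_norm_le_mul_norm_sub hR hx
  refine ne_top_of_le_ne_top (ENNReal.mul_ne_top (ENNReal.ofReal_ne_top (r := c ^ ((N : ℝ) + s)))
    hu.ne) ?_
  rw [← lintegral_const_mul' _ _ ENNReal.ofReal_ne_top]
  refine (setLIntegral_mono' measurableSet_ball.compl fun x hx => ENNReal.div_le_of_le_mul ?_).trans
    (setLIntegral_le_lintegral _ _)
  have hpos : ENNReal.ofReal ((1 + ‖x‖) ^ ((N : ℝ) + s)) ≠ 0 :=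
    (ENNReal.ofReal_pos.2 (by positivity)).ne'
  calc ‖u x‖ₑ ^ n = ENNReal.ofReal ((1 + ‖x‖) ^ ((N : ℝ) + s)) *
        (‖u x‖ₑ ^ n / ENNReal.ofReal ((1 + ‖x‖) ^ ((N : ℝ) + s))) :=
        (ENNReal.mul_div_cancel hpos ENNReal.ofReal_ne_top).symm
    _ ≤ _ := by
        rw [mul_right_comm]
        gcongr
        exact weight_le x hx

/-- The constant of `tailBound`. -/
noncomputable def tailConst (N : ℕ) (s n : ℝ) : ℝ≥0∞ :=
  ENNReal.ofReal (2 ^ n) * (ENNReal.ofReal (2 ^ ((N : ℝ) + s)) * farConst N s + 1)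

lemma tailConst_ne_top (n : ℝ) (hs : 0 < s) : tailConst N s n ≠ ∞ := by
  have := farConst_ne_top (N := N) hs
  unfold tailConst
  finiteness

/-- The bound for `∫_{|x-y| ≥ δ} |w - u(y)|^n |x-y|^{-N-s} dy` at points `x` at distance `δ` from
the complement of `B_R(x₀)`, when `|w| ≤ M` and `|u| ≤ M` in `B_R(x₀)`. -/
noncomputable def tailBound (s n δ M : ℝ) (u : E N → ℝ) (x₀ : E N) (R : ℝ) : ℝ≥0∞ :=
  ENNReal.ofReal (δ ^ (-((N : ℝ) + s))) * tailConst N s n *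
    (ENNReal.ofReal (M ^ n) + tailInt s n u x₀ R)

lemma tailBound_ne_top (hs : 0 < s) (htail : tailInt s n u x₀ R ≠ ∞) :
    tailBound s n δ M u x₀ R ≠ ∞ := by
  have := tailConst_ne_top (N := N) n hs
  unfold tailBound
  finiteness

lemma kern_sub_le_mul_norm_rpow (hs : 0 < s) (hδ : 0 < δ) (hρ : 0 ≤ ρ) (hρR : ρ + δ ≤ R)
    (hR : R ≤ 1) (hx : x ∈ ball x₀ ρ) (hy : y ∉ ball x₀ R) :
    kern s (x - y) ≤ δ ^ (-((N : ℝ) + s)) * ‖y - x₀‖ ^ (-((N : ℝ) + s)) := by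
  rw [mem_ball, dist_eq_norm] at hx hy
  rw [not_lt] at hy
  have hy0 : 0 < ‖y - x₀‖ := by linarith
  have hdist : δ * ‖y - x₀‖ ≤ ‖x - y‖ := by
    have htri : ‖y - x₀‖ ≤ ‖x - y‖ + ‖x - x₀‖ := by
      rw [norm_sub_rev x y]
      exact norm_sub_le_norm_sub_add_norm_sub y x x₀
    have : ‖x - x₀‖ ≤ (1 - δ) * ‖y - x₀‖ := by nlinarith
    linarith
  rw [kern, ← Real.mul_rpow hδ.le hy0.le]
  exact Real.rpow_le_rpow_of_nonpos (by positivity) hdist (neg_nonpos.2 (by positivity))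

lemma abs_sub_rpow_mul_kern_le_of_notMem_ball (hs : 0 < s) (hn : 1 ≤ n) (hδ : 0 < δ) (hρ : 0 ≤ ρ)
    (hρR : ρ + δ ≤ R) (hR : R ≤ 1) (hx : x ∈ ball x₀ ρ) (hy : y ∉ ball x₀ R) {w v : ℝ}
    (hw : |w| ≤ M) :
    |w - v| ^ n * kern s (x - y) ≤ 2 ^ n * M ^ n * kern s (x - y) +
      2 ^ n * δ ^ (-((N : ℝ) + s)) * (|v| ^ n * ‖y - x₀‖ ^ (-((N : ℝ) + s))) := by
  have hk := kern_nonneg s (x - y)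
  have : 0 ≤ M := (abs_nonneg w).trans hw
  have two_rpow_le : (2 : ℝ) ^ (n - 1) ≤ 2 ^ n :=
    Real.rpow_le_rpow_of_exponent_le one_le_two (by linarith)
  calc |w - v| ^ n * kern s (x - y)
      ≤ (2 ^ (n - 1) * (|w| ^ n + |v| ^ n)) * kern s (x - y) := by
        gcongr
        exact abs_sub_rpow_le hn
    _ ≤ (2 ^ n * (M ^ n + |v| ^ n)) * kern s (x - y) := by gcongr
    _ = 2 ^ n * M ^ n * kern s (x - y) + 2 ^ n * |v| ^ n * kern s (x - y) := by ring
    _ ≤ 2 ^ n * M ^ n * kern s (x - y) +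
          2 ^ n * |v| ^ n * (δ ^ (-((N : ℝ) + s)) * ‖y - x₀‖ ^ (-((N : ℝ) + s))) := by
        gcongr
        exact kern_sub_le_mul_norm_rpow hs hδ hρ hρR hR hx hy
    _ = _ := by ring

lemma abs_sub_rpow_le_of_abs_le (hn : 1 ≤ n) {v w : ℝ} (hw : |w| ≤ M) (hv : |v| ≤ M) :
    |w - v| ^ n ≤ 2 ^ n * M ^ n := by
  rw [← Real.mul_rpow zero_le_two ((abs_nonneg w).trans hw)]
  exact Real.rpow_le_rpow (abs_nonneg _) ((abs_sub w v).trans (by linarith)) (by linarith)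

lemma ofReal_abs_sub_rpow_mul_kern_le (hs : 0 < s) (hn : 1 ≤ n) (hδ : 0 < δ) (hρ : 0 ≤ ρ)
    (hρR : ρ + δ ≤ R) (hR : R ≤ 1) (hu : y ∈ ball x₀ R → |u y| ≤ M) (hx : x ∈ ball x₀ ρ) {w : ℝ}
    (hw : |w| ≤ M) :
    ENNReal.ofReal (|w - u y| ^ n * kern s (x - y)) ≤
      ENNReal.ofReal (2 ^ n * M ^ n) * ENNReal.ofReal (kern s (x - y)) +
      ENNReal.ofReal (2 ^ n * δ ^ (-((N : ℝ) + s))) *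
        (ball x₀ R)ᶜ.indicator (fun y => ‖u y‖ₑ ^ n / ‖y - x₀‖ₑ ^ ((N : ℝ) + s)) y := by
  have hk := kern_nonneg s (x - y)
  have hM : 0 ≤ M := (abs_nonneg w).trans hw
  by_cases hy : y ∈ ball x₀ R
  · refine le_trans ?_ le_self_add
    rw [← ENNReal.ofReal_mul (by positivity)]
    gcongr
    exact abs_sub_rpow_le_of_abs_le hn hw (hu hy)
  · have hy0 : 0 < ‖y - x₀‖ := by
      rw [mem_ball, dist_eq_norm] at hy
      linarith
    have weight_eq : ‖u y‖ₑ ^ n / ‖y - x₀‖ₑ ^ ((N : ℝ) + s) =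
        ENNReal.ofReal (|u y| ^ n * ‖y - x₀‖ ^ (-((N : ℝ) + s))) := by
      rw [Real.rpow_neg hy0.le, ← div_eq_mul_inv, ENNReal.ofReal_div_of_pos (by positivity),
        ← ENNReal.ofReal_rpow_of_nonneg (abs_nonneg _) (by linarith),
        ← ENNReal.ofReal_rpow_of_nonneg (norm_nonneg _) (by positivity), ofReal_norm,
        ← Real.norm_eq_abs, ofReal_norm]
    rw [indicator_of_mem hy, weight_eq, ← ENNReal.ofReal_mul (by positivity),
      ← ENNReal.ofReal_mul (by positivity), ← ENNReal.ofReal_add (by positivity) (by positivity)]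
    exact ENNReal.ofReal_le_ofReal
      (abs_sub_rpow_mul_kern_le_of_notMem_ball hs hn hδ hρ hρR hR hx hy hw)

lemma setLIntegral_kern_sub_far_le (hs : 0 < s) (hδ : 0 < δ) (hδ1 : δ ≤ 1) (x : E N) :
    ∫⁻ y in {y | δ ≤ ‖x - y‖}, ENNReal.ofReal (kern s (x - y)) ≤
      ENNReal.ofReal (δ ^ (-((N : ℝ) + s))) *
        (ENNReal.ofReal (2 ^ ((N : ℝ) + s)) * farConst N s) := by
  refine ((Measure.measurePreserving_sub_left volume x).setLIntegral_comp_preimage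
    (measurableSet_le measurable_const measurable_norm)
    (measurable_kern s).ennreal_ofReal).trans_le ((setLIntegral_kern_far_le hs hδ hδ1).trans_eq ?_)
  rw [← mul_assoc, ← ENNReal.ofReal_mul (by positivity), Real.div_rpow hδ.le zero_le_two,
    Real.rpow_neg zero_le_two, div_inv_eq_mul]

lemma setLIntegral_far_le_tailBound (hs : 0 < s) (hn : 1 ≤ n) (hδ : 0 < δ) (hρ : 0 ≤ ρ)
    (hρR : ρ + δ ≤ R) (hR : R ≤ 1) (hu : ∀ᵐ y, y ∈ ball x₀ R → |u y| ≤ M) (hx : x ∈ ball x₀ ρ)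
    {w : ℝ} (hw : |w| ≤ M) :
    ∫⁻ y in {y | δ ≤ ‖x - y‖}, ENNReal.ofReal (|w - u y| ^ n * kern s (x - y)) ≤
      tailBound s n δ M u x₀ R := by
  have hkern : Measurable fun y => ENNReal.ofReal (kern s (x - y)) := by fun_prop
  set f := (ball x₀ R)ᶜ.indicator fun y => ‖u y‖ₑ ^ n / ‖y - x₀‖ₑ ^ ((N : ℝ) + s)
  have f_le : ∫⁻ y in {y | δ ≤ ‖x - y‖}, f y ≤ tailInt s n u x₀ R :=
    (setLIntegral_le_lintegral _ _).trans_eq (lintegral_indicator measurableSet_ball.compl _)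
  calc ∫⁻ y in {y | δ ≤ ‖x - y‖}, ENNReal.ofReal (|w - u y| ^ n * kern s (x - y))
      ≤ ∫⁻ y in {y | δ ≤ ‖x - y‖}, (ENNReal.ofReal (2 ^ n * M ^ n) *
          ENNReal.ofReal (kern s (x - y)) +
          ENNReal.ofReal (2 ^ n * δ ^ (-((N : ℝ) + s))) * f y) :=
        lintegral_mono_ae <| ae_restrict_of_ae <| hu.mono fun y hy =>
          ofReal_abs_sub_rpow_mul_kern_le hs hn hδ hρ hρR hR hy hx hw
    _ ≤ ENNReal.ofReal (2 ^ n * M ^ n) * (ENNReal.ofReal (δ ^ (-((N : ℝ) + s))) *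
          (ENNReal.ofReal (2 ^ ((N : ℝ) + s)) * farConst N s)) +
        ENNReal.ofReal (2 ^ n * δ ^ (-((N : ℝ) + s))) * tailInt s n u x₀ R := by
        rw [lintegral_add_left (hkern.const_mul _),
          lintegral_const_mul' _ _ ENNReal.ofReal_ne_top,
          lintegral_const_mul' _ _ ENNReal.ofReal_ne_top]
        gcongr
        exact setLIntegral_kern_sub_far_le hs hδ (by linarith) x
    _ = ENNReal.ofReal (2 ^ n) * ENNReal.ofReal (δ ^ (-((N : ℝ) + s))) *
          (ENNReal.ofReal (2 ^ ((N : ℝ) + s)) * farConst N s * ENNReal.ofReal (M ^ n) +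
            tailInt s n u x₀ R) := by
        rw [ENNReal.ofReal_mul (by positivity), ENNReal.ofReal_mul (by positivity)]
        ring
    _ ≤ ENNReal.ofReal (2 ^ n) * ENNReal.ofReal (δ ^ (-((N : ℝ) + s))) *
          ((ENNReal.ofReal (2 ^ ((N : ℝ) + s)) * farConst N s + 1) *
            (ENNReal.ofReal (M ^ n) + tailInt s n u x₀ R)) := by
        gcongr ENNReal.ofReal (2 ^ n) * ENNReal.ofReal (δ ^ (-((N : ℝ) + s))) * ?_
        rw [add_mul, mul_add, one_mul]
        exact add_le_add le_self_add le_add_self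
    _ = tailBound s n δ M u x₀ R := by
        rw [tailBound, tailConst]
        ring

end Tail

/-! ### Test functions -/

section Splitting

variable {N : ℕ}

lemma lintegral_le_two_mul_of_le_add_swap {F P : E N × E N → ℝ≥0∞} (hP : AEMeasurable P)
    (h : ∀ᵐ z, F z ≤ P z + P z.swap) : ∫⁻ z, F z ≤ 2 * ∫⁻ z, P z := by
  refine (lintegral_mono_ae h).trans ?_
  rw [lintegral_add_left' hP, lintegral_swap, two_mul]

lemma lintegral_le_setLIntegral_add_two_mul {A B : Set (E N)} (hA : MeasurableSet A)
    (hB : MeasurableSet B) (hAB : A ⊆ B) {F : E N × E N → ℝ≥0∞} (hF : AEMeasurable F)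
    (hswap : ∀ z, F z.swap = F z) (hzero : ∀ z, z.1 ∉ A → z.2 ∉ A → F z = 0) :
    ∫⁻ z, F z ≤ (∫⁻ z in B ×ˢ B, F z) + 2 * ∫⁻ z in A ×ˢ Bᶜ, F z := by
  have near : AEMeasurable ((B ×ˢ B).indicator F) := hF.indicator (hB.prod hB)
  have far : AEMeasurable ((A ×ˢ Bᶜ).indicator F) := hF.indicator (hA.prod hB.compl)
  have F_le : ∀ z, F z ≤ (B ×ˢ B).indicator F z +
      ((A ×ˢ Bᶜ).indicator F z + (A ×ˢ Bᶜ).indicator F z.swap) := by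
    rintro ⟨x, y⟩
    by_cases hx : x ∈ B <;> by_cases hy : y ∈ B
    · rw [indicator_of_mem (mk_mem_prod hx hy)]
      exact le_self_add
    · by_cases hxA : x ∈ A
      · rw [indicator_of_mem (s := A ×ˢ Bᶜ) (mk_mem_prod hxA hy)]
        exact le_self_add.trans le_add_self
      · simp [hzero (x, y) hxA fun h => hy (hAB h)]
    · by_cases hyA : y ∈ A
      · rw [indicator_of_mem (s := A ×ˢ Bᶜ) (a := (x, y).swap) (mk_mem_prod hyA hx), hswap]
        exact le_add_self.trans le_add_self
      · simp [hzero (x, y) (fun h => hx (hAB h)) hyA]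
    · simp [hzero (x, y) (fun h => hx (hAB h)) fun h => hy (hAB h)]
  refine (lintegral_mono F_le).trans_eq ?_
  rw [lintegral_add_left' near, lintegral_add_left' far,
    lintegral_swap ((A ×ˢ Bᶜ).indicator F), lintegral_indicator (hB.prod hB),
    lintegral_indicator (hA.prod hB.compl), two_mul]

lemma ball_prod_compl_ball_subset {X : Type*} [SeminormedAddCommGroup X] {x₀ : X} {ρ δ R : ℝ}
    (hρR : ρ + δ ≤ R) : ball x₀ ρ ×ˢ (ball x₀ R)ᶜ ⊆ {z : X × X | δ ≤ ‖z.1 - z.2‖} := by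
  rintro ⟨x, y⟩ ⟨hx, hy⟩
  have hx' : dist x x₀ < ρ := hx
  have hy' : R ≤ dist y x₀ := not_lt.1 hy
  have := dist_triangle_left y x₀ x
  rw [mem_ofPred_eq, ← dist_eq_norm]
  linarith

lemma add_mem_ball_of_norm_le {X : Type*} [SeminormedAddCommGroup X] {x₀ x h : X} {ρ δ R : ℝ}
    (hx : x ∈ ball x₀ ρ) (hh : ‖h‖ ≤ δ) (hR : ρ + δ ≤ R) : x + h ∈ ball x₀ R := by
  rw [mem_ball, dist_eq_norm] at hx ⊢
  calc ‖x + h - x₀‖ = ‖(x - x₀) + h‖ := by rw [add_sub_right_comm]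
    _ ≤ ‖x - x₀‖ + ‖h‖ := norm_add_le _ _
    _ < R := by linarith

end Splitting

section FarInteraction

variable {N : ℕ} {s n δ M ρ R : ℝ} {u : E N → ℝ} {x₀ x h : E N}

lemma setLIntegral_far_translate_le_tailBound (hs : 0 < s) (hn : 1 ≤ n) (hδ : 0 < δ) (hρ : 0 ≤ ρ)
    (hρR : ρ + δ ≤ R) (hR : R ≤ 1) (hu : ∀ᵐ y, y ∈ ball x₀ R → |u y| ≤ M)
    (hx : x + h ∈ ball x₀ ρ) (hux : |u (x + h)| ≤ M) :
    ∫⁻ y in {y | δ ≤ ‖x - y‖}, ENNReal.ofReal (|u (x + h) - u (y + h)| ^ n * kern s (x - y)) ≤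
      tailBound s n δ M u x₀ R := by
  refine le_of_eq_of_le ?_ (setLIntegral_far_le_tailBound hs hn hδ hρ hρR hR hu hx hux)
  simpa only [preimage_ofPred_eq, add_sub_add_right_eq_sub] using
    (measurePreserving_add_right volume h).setLIntegral_comp_preimage_emb
      (measurableEmbedding_addRight h)
      (fun y => ENNReal.ofReal (|u (x + h) - u y| ^ n * kern s (x + h - y))) {y | δ ≤ ‖x + h - y‖}

lemma setLIntegral_mul_far_translate_le (hs : 0 < s) (hn : 1 ≤ n) (hδ : 0 < δ) (hρ : 0 ≤ ρ)
    (hρR : ρ + δ ≤ R) (hR : R ≤ 1) (hum : AEStronglyMeasurable u)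
    (hu : ∀ᵐ y, y ∈ ball x₀ R → |u y| ≤ M) {f : E N → ℝ≥0∞} (hf : AEMeasurable f)
    (hfρ : ∀ x, f x ≠ 0 → x + h ∈ ball x₀ ρ) :
    ∫⁻ z in {z : E N × E N | δ ≤ ‖z.1 - z.2‖}, f z.1 *
      ENNReal.ofReal (|u (z.1 + h) - u (z.2 + h)| ^ n * kern s (z.1 - z.2)) ≤
      tailBound s n δ M u x₀ R * ∫⁻ x, f x := by
  have hum_h : AEMeasurable fun y => u (y + h) :=
    hum.aemeasurable.comp_quasiMeasurePreserving
      (measurePreserving_add_right volume h).quasiMeasurePreserving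
  have hu_h : ∀ᵐ x, x + h ∈ ball x₀ R → |u (x + h)| ≤ M :=
    (measurePreserving_add_right volume h).quasiMeasurePreserving.ae hu
  rw [← lintegral_indicator (measurableSet_far δ), Measure.volume_eq_prod, mul_comm,
    ← lintegral_mul_const'' _ hf]
  refine (lintegral_prod_le _).trans (lintegral_mono_ae ?_)
  filter_upwards [hu_h] with x hux
  have far : MeasurableSet {y | δ ≤ ‖x - y‖} := measurableSet_le measurable_const (by fun_prop)
  have slice : AEMeasurable fun y =>
      ENNReal.ofReal (|u (x + h) - u (y + h)| ^ n * kern s (x - y)) :=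
    (((measurable_norm.comp_aemeasurable (aemeasurable_const.sub hum_h)).pow_const n).mul
      (by fun_prop)).ennreal_ofReal
  calc ∫⁻ y, {z : E N × E N | δ ≤ ‖z.1 - z.2‖}.indicator (fun z => f z.1 *
        ENNReal.ofReal (|u (z.1 + h) - u (z.2 + h)| ^ n * kern s (z.1 - z.2))) (x, y)
      = ∫⁻ y in {y | δ ≤ ‖x - y‖},
          f x * ENNReal.ofReal (|u (x + h) - u (y + h)| ^ n * kern s (x - y)) :=
        lintegral_indicator far _
    _ = f x * ∫⁻ y in {y | δ ≤ ‖x - y‖},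
          ENNReal.ofReal (|u (x + h) - u (y + h)| ^ n * kern s (x - y)) :=
        lintegral_const_mul'' _ slice.restrict
    _ ≤ f x * tailBound s n δ M u x₀ R := by
        rcases eq_or_ne (f x) 0 with hfx | hfx
        · simp [hfx]
        · gcongr
          exact setLIntegral_far_translate_le_tailBound hs hn hδ hρ hρR hR hu (hfρ x hfx)
            (hux (ball_subset_ball (by linarith) (hfρ x hfx)))

end FarInteraction

section Cutoff

variable {N : ℕ}

/-- A Lipschitz cutoff function, equal to `1` in `B_{ρ-δ}` and to `0` outside of `B_ρ`. -/
noncomputable def cutoff (x₀ : E N) (ρ δ : ℝ) (x : E N) : ℝ :=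
  max 0 (min 1 ((ρ - dist x x₀) / δ))

lemma cutoff_nonneg (x₀ : E N) (ρ δ : ℝ) (x : E N) : 0 ≤ cutoff x₀ ρ δ x := le_max_left _ _

lemma cutoff_le_one (x₀ : E N) (ρ δ : ℝ) (x : E N) : cutoff x₀ ρ δ x ≤ 1 :=
  max_le zero_le_one (min_le_left _ _)

lemma cutoff_eq_one {x₀ : E N} {ρ δ : ℝ} (hδ : 0 < δ) {x : E N} (hx : x ∈ ball x₀ (ρ - δ)) :
    cutoff x₀ ρ δ x = 1 := by
  have : 1 ≤ (ρ - dist x x₀) / δ := by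
    rw [le_div_iff₀ hδ]
    linarith [mem_ball.1 hx]
  simp [cutoff, min_eq_left this]

lemma cutoff_eq_zero {x₀ : E N} {ρ δ : ℝ} (hδ : 0 < δ) {x : E N} (hx : x ∉ ball x₀ ρ) :
    cutoff x₀ ρ δ x = 0 := by
  have h1 : (ρ - dist x x₀) / δ ≤ 0 := by
    apply div_nonpos_of_nonpos_of_nonneg _ hδ.le
    have : ρ ≤ dist x x₀ := by simpa using hx
    linarith
  exact max_eq_left ((min_le_right _ _).trans h1)

lemma abs_cutoff_sub_le {x₀ : E N} {ρ δ : ℝ} (hδ : 0 < δ) (x y : E N) :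
    |cutoff x₀ ρ δ x - cutoff x₀ ρ δ y| ≤ ‖x - y‖ / δ := by
  unfold cutoff
  refine (abs_max_sub_max_le_max _ _ _ _).trans ?_
  rw [sub_self, abs_zero]
  refine max_le (by positivity) ((abs_min_sub_min_le_max _ _ _ _).trans ?_)
  rw [sub_self, abs_zero]
  refine max_le (by positivity) ?_
  rw [div_sub_div_same, abs_div, abs_of_pos hδ, sub_sub_sub_cancel_left, ← dist_eq_norm]
  gcongr
  rw [dist_comm x y]
  exact abs_dist_sub_le y x x₀

@[fun_prop]
lemma measurable_cutoff (x₀ : E N) (ρ δ : ℝ) : Measurable (cutoff x₀ ρ δ) := by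
  unfold cutoff
  fun_prop

end Cutoff

section Gagliardo

variable {N : ℕ} {γ t : ℝ} {F : Type*} [NormedAddCommGroup F]

lemma gagliardoPow_translate (f : E N → F) (h : E N) :
    gagliardoPow γ t univ (fun x => f (x + h)) = gagliardoPow γ t univ f := by
  simp only [gagliardoPow, Measure.restrict_univ]
  rw [← lintegral_add_right_eq_self
    (fun x => ∫⁻ y, ‖f x - f y‖ₑ ^ t / ‖x - y‖ₑ ^ ((N : ℝ) + γ * t)) h]
  refine lintegral_congr fun x => ?_
  rw [← lintegral_add_right_eq_self
    (fun y => ‖f (x + h) - f y‖ₑ ^ t / ‖x + h - y‖ₑ ^ ((N : ℝ) + γ * t)) h]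
  simp only [add_sub_add_right_eq_sub]

lemma gagliardoPow_translate_le (ht : 0 < t) (hγ : 0 < γ) {f : E N → F}
    (hf : AEStronglyMeasurable f) {x₀ h : E N} {ρ δ R : ℝ} (hh : ‖h‖ ≤ δ) (hρR : ρ + δ ≤ R) :
    gagliardoPow γ t (ball x₀ ρ) (fun x => f (x + h)) ≤ gagliardoPow γ t (ball x₀ R) f := by
  have hf_h : AEStronglyMeasurable fun x => f (x + h) :=
    hf.comp_measurePreserving (measurePreserving_add_right volume h)
  rw [gagliardoPow_eq_setLIntegral ht hγ hf, gagliardoPow_eq_setLIntegral ht hγ hf_h]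
  simpa only [gagliardoDensity, add_sub_add_right_eq_sub] using
    setLIntegral_prod_translate_le measurableSet_ball measurableSet_ball
      (fun x hx => add_mem_ball_of_norm_le hx hh hρR)
      fun z => gagliardoDensity t (γ * t) f z.1 z.2

lemma gagliardoPow_le_of_norm_sub_le {F' : Type*} [NormedAddCommGroup F'] (ht : 0 ≤ t) {L : ℝ}
    {V : Set (E N)} {f : E N → F} {g : E N → F'} (h : ∀ x y, ‖g x - g y‖ ≤ L * ‖f x - f y‖) :
    gagliardoPow γ t V g ≤ ENNReal.ofReal L ^ t * gagliardoPow γ t V f := by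
  have hL : ENNReal.ofReal L ^ t ≠ ∞ := ENNReal.rpow_ne_top_of_nonneg ht ENNReal.ofReal_ne_top
  simp only [gagliardoPow, ← lintegral_const_mul' _ _ hL]
  gcongr with x y
  have enorm_le : ‖g x - g y‖ₑ ≤ ENNReal.ofReal L * ‖f x - f y‖ₑ := by
    rw [← ofReal_norm, ← ofReal_norm, ← ENNReal.ofReal_mul' (norm_nonneg _)]
    exact ENNReal.ofReal_le_ofReal (h x y)
  rw [← mul_div_assoc, ← ENNReal.mul_rpow_of_nonneg _ _ ht]
  gcongr

lemma gagliardoDensity_sub_le (ht : 1 ≤ t) (s : ℝ) (f g : E N → F) (x y : E N) :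
    gagliardoDensity t s (fun x => f x - g x) x y ≤
      ENNReal.ofReal (2 ^ (t - 1)) * (gagliardoDensity t s f x y + gagliardoDensity t s g x y) := by
  have hk := kern_nonneg s (x - y)
  unfold gagliardoDensity
  rw [← ENNReal.ofReal_add (by positivity) (by positivity), ← ENNReal.ofReal_mul (by positivity),
    ← add_mul, ← mul_assoc, sub_sub_sub_comm]
  gcongr
  exact (Real.rpow_le_rpow (norm_nonneg _) (norm_sub_le _ _) (by linarith)).trans
    (rpow_add_le_two_rpow_mul ht (norm_nonneg _) (norm_nonneg _))

lemma gagliardoPow_sub_lt_top (ht : 1 ≤ t) (hγ : 0 < γ) {V : Set (E N)} {f g : E N → F}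
    (hf : AEStronglyMeasurable f) (hg : AEStronglyMeasurable g)
    (hf' : gagliardoPow γ t V f < ∞) (hg' : gagliardoPow γ t V g < ∞) :
    gagliardoPow γ t V (fun x => f x - g x) < ∞ := by
  have ht0 : 0 < t := by linarith
  have hfg : AEStronglyMeasurable fun x => f x - g x := hf.sub hg
  rw [gagliardoPow_eq_setLIntegral ht0 hγ hf] at hf'
  rw [gagliardoPow_eq_setLIntegral ht0 hγ hg] at hg'
  rw [gagliardoPow_eq_setLIntegral ht0 hγ hfg]
  calc ∫⁻ z in V ×ˢ V, gagliardoDensity t (γ * t) (fun x => f x - g x) z.1 z.2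
      ≤ ∫⁻ z in V ×ˢ V, ENNReal.ofReal (2 ^ (t - 1)) *
          (gagliardoDensity t (γ * t) f z.1 z.2 + gagliardoDensity t (γ * t) g z.1 z.2) :=
        lintegral_mono fun z => gagliardoDensity_sub_le ht _ f g z.1 z.2
    _ = ENNReal.ofReal (2 ^ (t - 1)) *
          ((∫⁻ z in V ×ˢ V, gagliardoDensity t (γ * t) f z.1 z.2) +
            ∫⁻ z in V ×ˢ V, gagliardoDensity t (γ * t) g z.1 z.2) := by
        rw [lintegral_const_mul' _ _ ENNReal.ofReal_ne_top,
          lintegral_add_left' (aemeasurable_gagliardoDensity hf t (γ * t)).restrict]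
    _ < ∞ := ENNReal.mul_lt_top ENNReal.ofReal_lt_top (ENNReal.add_lt_top.2 ⟨hf', hg'⟩)

lemma gagliardoPow_increment_lt_top (ht : 1 ≤ t) (hγ : 0 < γ) {f : E N → F}
    (hf : AEStronglyMeasurable f) {x₀ h : E N} {ρ δ R : ℝ} (hh : ‖h‖ ≤ δ) (hρR : ρ + δ ≤ R)
    (hf' : gagliardoPow γ t (ball x₀ R) f < ∞) :
    gagliardoPow γ t (ball x₀ ρ) (fun x => f (x + h) - f x) < ∞ := by
  have ht0 : 0 < t := by linarith
  have translate : ∀ k : E N, ‖k‖ ≤ δ → gagliardoPow γ t (ball x₀ ρ) (fun x => f (x + k)) < ∞ :=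
    fun k hk => (gagliardoPow_translate_le ht0 hγ hf hk hρR).trans_lt hf'
  refine gagliardoPow_sub_lt_top ht hγ
    (hf.comp_measurePreserving (measurePreserving_add_right volume h)) hf (translate h hh) ?_
  simpa only [add_zero] using translate 0 (by simpa using (norm_nonneg h).trans hh)

lemma gagliardoPow_univ_lt_top (ht : 0 < t) (hγ : 0 < γ) {f : E N → F}
    (hf : AEStronglyMeasurable f) {A : ℝ} (hA : ∀ x, ‖f x‖ ≤ A) {x₀ : E N} {ρ δ R : ℝ}
    (hδ : 0 < δ) (hδ1 : δ ≤ 1) (hρR : ρ + δ ≤ R) (hout : ∀ x ∉ ball x₀ ρ, f x = 0)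
    (hf' : gagliardoPow γ t (ball x₀ R) f < ∞) : gagliardoPow γ t univ f < ∞ := by
  have hs : 0 < γ * t := by positivity
  rw [gagliardoPow_eq_setLIntegral ht hγ hf] at hf' ⊢
  rw [univ_prod_univ, Measure.restrict_univ]
  set I := fun z : E N × E N => gagliardoDensity t (γ * t) f z.1 z.2
  have far_lt_top : ∫⁻ z in ball x₀ ρ ×ˢ (ball x₀ R)ᶜ, I z < ∞ := by
    set c := (ball x₀ ρ).indicator fun _ => ENNReal.ofReal (A ^ t)
    calc ∫⁻ z in ball x₀ ρ ×ˢ (ball x₀ R)ᶜ, I z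
        ≤ ∫⁻ z in ball x₀ ρ ×ˢ (ball x₀ R)ᶜ,
            c z.1 * ENNReal.ofReal (kern (γ * t) (z.1 - z.2)) := by
          refine setLIntegral_mono' (measurableSet_ball.prod measurableSet_ball.compl)
            fun z hz => ?_
          have hk := kern_nonneg (γ * t) (z.1 - z.2)
          rw [show c z.1 = ENNReal.ofReal (A ^ t) from indicator_of_mem hz.1 _,
            ← ENNReal.ofReal_mul' hk]
          refine ENNReal.ofReal_le_ofReal (mul_le_mul_of_nonneg_right ?_ hk)
          rw [hout z.2 fun h => hz.2 (ball_subset_ball (by linarith) h), sub_zero]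
          exact Real.rpow_le_rpow (norm_nonneg _) (hA _) ht.le
      _ ≤ ∫⁻ z in {z : E N × E N | δ ≤ ‖z.1 - z.2‖},
            c z.1 * ENNReal.ofReal (kern (γ * t) (z.1 - z.2)) :=
          lintegral_mono_set (ball_prod_compl_ball_subset hρR)
      _ ≤ ENNReal.ofReal ((δ / 2) ^ (-((N : ℝ) + γ * t))) * farConst N (γ * t) * ∫⁻ x, c x :=
          setLIntegral_mul_kern_far_le hs hδ hδ1 c
      _ < ∞ := by
          rw [lintegral_indicator measurableSet_ball, setLIntegral_const]
          have := farConst_ne_top (N := N) hs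
          have : volume (ball x₀ ρ) ≠ ∞ := measure_ball_lt_top.ne
          exact lt_top_iff_ne_top.2 (by finiteness)
  refine (lintegral_le_setLIntegral_add_two_mul measurableSet_ball measurableSet_ball
    (ball_subset_ball (by linarith : ρ ≤ R)) (aemeasurable_gagliardoDensity hf t (γ * t))
    (fun z => gagliardoDensity_comm t _ f z.2 z.1) fun z hz₁ hz₂ => ?_).trans_lt
    (ENNReal.add_lt_top.2 ⟨hf', ENNReal.mul_lt_top ENNReal.ofNat_lt_top far_lt_top⟩)
  simp [gagliardoDensity, hout z.1 hz₁, hout z.2 hz₂, Real.zero_rpow ht.ne']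

lemma norm_cutoff_smul_sub_le [NormedSpace ℝ F] {f : E N → F} {A : ℝ} (hA : ∀ x, ‖f x‖ ≤ A)
    (x₀ : E N) (ρ : ℝ) {δ : ℝ} (hδ : 0 < δ) (x y : E N) :
    ‖cutoff x₀ ρ δ x • f x - cutoff x₀ ρ δ y • f y‖ ≤ ‖f x - f y‖ + A / δ * ‖x - y‖ := by
  have split : cutoff x₀ ρ δ x • f x - cutoff x₀ ρ δ y • f y =
      cutoff x₀ ρ δ x • (f x - f y) + (cutoff x₀ ρ δ x - cutoff x₀ ρ δ y) • f y := by
    rw [smul_sub, sub_smul]; abel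
  rw [split]
  refine (norm_add_le _ _).trans ?_
  rw [norm_smul, norm_smul, Real.norm_of_nonneg (cutoff_nonneg _ _ _ _), Real.norm_eq_abs,
    show A / δ * ‖x - y‖ = ‖x - y‖ / δ * A by ring]
  exact add_le_add (mul_le_of_le_one_left (norm_nonneg _) (cutoff_le_one _ _ _ _))
    (mul_le_mul (abs_cutoff_sub_le hδ x y) (hA y) (norm_nonneg _) (by positivity))

lemma gagliardoDensity_cutoff_smul_le [NormedSpace ℝ F] (ht : 1 ≤ t) (s : ℝ)
    {f : E N → F} {A : ℝ} (hA : ∀ x, ‖f x‖ ≤ A) (x₀ : E N) (ρ : ℝ) {δ : ℝ} (hδ : 0 < δ)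
    (x y : E N) :
    gagliardoDensity t s (fun x => cutoff x₀ ρ δ x • f x) x y ≤
      ENNReal.ofReal (2 ^ (t - 1)) * (gagliardoDensity t s f x y +
        ENNReal.ofReal ((A / δ) ^ t) * ENNReal.ofReal (kern (-(t - s)) (x - y))) := by
  have hA0 : 0 ≤ A := (norm_nonneg _).trans (hA 0)
  have hk := kern_nonneg s (x - y)
  have hk' := kern_nonneg (-(t - s)) (x - y)
  unfold gagliardoDensity
  rw [← ENNReal.ofReal_mul (by positivity), ← ENNReal.ofReal_add (by positivity) (by positivity),
    ← ENNReal.ofReal_mul (by positivity)]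
  apply ENNReal.ofReal_le_ofReal
  calc _ ≤ (‖f x - f y‖ + A / δ * ‖x - y‖) ^ t * kern s (x - y) := by
        gcongr
        exact norm_cutoff_smul_sub_le hA x₀ ρ hδ x y
    _ ≤ 2 ^ (t - 1) * (‖f x - f y‖ ^ t + (A / δ * ‖x - y‖) ^ t) * kern s (x - y) := by
        gcongr
        exact rpow_add_le_two_rpow_mul ht (norm_nonneg _) (by positivity)
    _ = 2 ^ (t - 1) * (‖f x - f y‖ ^ t * kern s (x - y) +
          (A / δ) ^ t * (‖x - y‖ ^ t * kern s (x - y))) := by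
        rw [Real.mul_rpow (by positivity) (norm_nonneg _)]; ring
    _ ≤ _ := by
        gcongr
        exact (rpow_norm_mul_kern_le s t _).trans_eq (by rw [neg_sub])

lemma gagliardoPow_ball_cutoff_smul_lt_top [NormedSpace ℝ F] (hN : 1 ≤ N) (ht : 1 ≤ t)
    (hγ : 0 < γ) (hγ1 : γ < 1) {f : E N → F} (hf : AEStronglyMeasurable f) {A : ℝ}
    (hA : ∀ x, ‖f x‖ ≤ A) {x₀ : E N} {ρ δ R : ℝ} (hδ : 0 < δ) (hR : R ≤ 1)
    (hf' : gagliardoPow γ t (ball x₀ R) f < ∞) :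
    gagliardoPow γ t (ball x₀ R) (fun x => cutoff x₀ ρ δ x • f x) < ∞ := by
  have ht0 : 0 < t := by linarith
  have hκ : 0 < t - γ * t := by nlinarith
  have hf_cut : AEStronglyMeasurable fun x => cutoff x₀ ρ δ x • f x :=
    (measurable_cutoff x₀ ρ δ).aestronglyMeasurable.smul hf
  rw [gagliardoPow_eq_setLIntegral ht0 hγ hf] at hf'
  rw [gagliardoPow_eq_setLIntegral ht0 hγ hf_cut]
  have integrand_le (z : E N × E N) :=
    gagliardoDensity_cutoff_smul_le ht (γ * t) hA x₀ ρ hδ z.1 z.2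
  refine (lintegral_mono integrand_le).trans_lt ?_
  rw [lintegral_const_mul' _ _ ENNReal.ofReal_ne_top, lintegral_add_right _ (by fun_prop)]
  refine ENNReal.mul_lt_top ENNReal.ofReal_lt_top (ENNReal.add_lt_top.2 ⟨hf', ?_⟩)
  refine (setLIntegral_prod_mul_kern_near_le hN hκ hR
    fun _ => ENNReal.ofReal ((A / δ) ^ t)).trans_lt ?_
  rw [setLIntegral_const]
  exact ENNReal.mul_lt_top (nearConst_ne_top hN hκ).lt_top
    (ENNReal.mul_lt_top ENNReal.ofReal_lt_top measure_ball_lt_top)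

lemma gagliardoPow_cutoff_smul_lt_top [NormedSpace ℝ F] (hN : 1 ≤ N) (ht : 1 ≤ t)
    (hγ : 0 < γ) (hγ1 : γ < 1) {f : E N → F} (hf : AEStronglyMeasurable f) {A : ℝ}
    (hA : ∀ x, ‖f x‖ ≤ A) {x₀ : E N} {ρ δ R : ℝ} (hδ : 0 < δ) (hρ : 0 ≤ ρ) (hρR : ρ + δ ≤ R)
    (hR : R ≤ 1) (hf' : gagliardoPow γ t (ball x₀ R) f < ∞) :
    gagliardoPow γ t univ (fun x => cutoff x₀ ρ δ x • f x) < ∞ := by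
  refine gagliardoPow_univ_lt_top (by linarith) hγ
    ((measurable_cutoff x₀ ρ δ).aestronglyMeasurable.smul hf) (A := A) (fun x => ?_) hδ
    (by linarith) hρR (fun x hx => by rw [cutoff_eq_zero hδ hx, zero_smul])
    (gagliardoPow_ball_cutoff_smul_lt_top hN ht hγ hγ1 hf hA hδ hR hf')
  rw [norm_smul, Real.norm_of_nonneg (cutoff_nonneg _ _ _ _)]
  exact (mul_le_of_le_one_left (norm_nonneg _) (cutoff_le_one _ _ _ _)).trans (hA x)

end Gagliardo

section TestFunctions

variable {N : ℕ} {s₁ sp n ρ : ℝ} {x₀ : E N} {φ : E N → ℝ}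

/-- Bounded functions of `W^{s₁,1}(ℝ^N) ∩ W^{s_p,p}(ℝ^N)`, `p = n + 1`, that vanish outside the
ball `B_ρ(x₀)`: the test functions that the proof inserts into the equation. -/
structure IsBoundedBump (s₁ sp n : ℝ) (x₀ : E N) (ρ : ℝ) (φ : E N → ℝ) : Prop where
  aestronglyMeasurable : AEStronglyMeasurable φ
  exists_abs_le : ∃ A, ∀ x, |φ x| ≤ A
  eq_zero : ∀ x ∉ ball x₀ ρ, φ x = 0
  gagliardoPow_one : gagliardoPow s₁ 1 univ φ < ∞
  gagliardoPow_p : gagliardoPow sp (n + 1) univ φ < ∞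

namespace IsBoundedBump

lemma comp_add_right {h : E N} {δ : ℝ} (hφ : IsBoundedBump s₁ sp n x₀ ρ φ) (hh : ‖h‖ ≤ δ) :
    IsBoundedBump s₁ sp n x₀ (ρ + δ) fun x => φ (x + h) where
  aestronglyMeasurable := hφ.aestronglyMeasurable.comp_measurePreserving
    (measurePreserving_add_right volume h)
  exists_abs_le := hφ.exists_abs_le.imp fun _ hA x => hA (x + h)
  eq_zero x hx := hφ.eq_zero _ fun hxh => hx <| by
    simpa using add_mem_ball_of_norm_le (h := -h) hxh (by rwa [norm_neg]) le_rfl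
  gagliardoPow_one := by rw [gagliardoPow_translate]; exact hφ.gagliardoPow_one
  gagliardoPow_p := by rw [gagliardoPow_translate]; exact hφ.gagliardoPow_p

lemma memLq (hφ : IsBoundedBump s₁ sp n x₀ ρ φ) (t : ℝ) : MemLq t univ φ := by
  obtain ⟨A, hA⟩ := hφ.exists_abs_le
  have indicator_eq : (ball x₀ ρ).indicator φ = φ :=
    indicator_eq_self.2 fun x hx => by_contra fun hxρ => hx (hφ.eq_zero x hxρ)
  have : IsFiniteMeasure (volume.restrict (ball x₀ ρ)) :=
    isFiniteMeasure_restrict.2 measure_ball_lt_top.ne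
  rw [MemLq, Measure.restrict_univ, ← indicator_eq,
    memLp_indicator_iff_restrict measurableSet_ball]
  exact MemLp.of_bound hφ.aestronglyMeasurable.restrict A (Eventually.of_forall hA)

lemma isTestFunction {Ω : Set (E N)} (hφ : IsBoundedBump s₁ sp n x₀ ρ φ)
    (hΩ : closedBall x₀ ρ ⊆ Ω) : IsTestFunction s₁ sp (n + 1) Ω φ := by
  have tsupport_subset : tsupport φ ⊆ closedBall x₀ ρ :=
    closure_minimal (fun x hx => by_contra fun hxρ =>
      hx (hφ.eq_zero x fun h => hxρ (ball_subset_closedBall h))) isClosed_closedBall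
  exact ⟨⟨hφ.memLq 1, hφ.gagliardoPow_one⟩, ⟨hφ.memLq (n + 1), hφ.gagliardoPow_p⟩,
    (isCompact_closedBall x₀ ρ).of_isClosed_subset (isClosed_tsupport _) tsupport_subset,
    tsupport_subset.trans hΩ⟩

lemma integrable_sign_term (hs₁ : 0 < s₁) (hφ : IsBoundedBump s₁ sp n x₀ ρ φ)
    {Z : E N × E N → ℝ} (hZ : AEStronglyMeasurable Z) (hZ1 : ∀ᵐ z, |Z z| ≤ 1) :
    Integrable fun z : E N × E N => Z z * (φ z.1 - φ z.2) * kern s₁ (z.1 - z.2) := by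
  have hφm := hφ.aestronglyMeasurable
  have finite := hφ.gagliardoPow_one
  rw [gagliardoPow_eq_setLIntegral one_pos hs₁ hφm, univ_prod_univ, Measure.restrict_univ] at finite
  refine ⟨(hZ.mul (aestronglyMeasurable_diff hφm)).mul
    (Measurable.aestronglyMeasurable (by fun_prop)), (lintegral_mono_ae ?_).trans_lt finite⟩
  filter_upwards [hZ1] with z hz
  have hk := kern_nonneg s₁ (z.1 - z.2)
  rw [gagliardoDensity, ← ofReal_norm, norm_mul, norm_mul, Real.rpow_one,
    Real.norm_of_nonneg hk, mul_one]
  gcongr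
  exact mul_le_of_le_one_left (norm_nonneg _) hz

variable {δ M R : ℝ} {u : E N → ℝ}

lemma setLIntegral_power_term_near_lt_top (hsp : 0 < sp) (hn : 0 < n)
    (hum : AEStronglyMeasurable u) (hug : gagliardoPow sp (n + 1) (ball x₀ R) u < ∞)
    (hφ : IsBoundedBump s₁ sp n x₀ ρ φ) :
    ∫⁻ z in ball x₀ R ×ˢ ball x₀ R, ‖signedPow n (u z.1 - u z.2) * (φ z.1 - φ z.2) *
      kern (sp * (n + 1)) (z.1 - z.2)‖ₑ < ∞ := by
  have hφm := hφ.aestronglyMeasurable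
  have hφg := hφ.gagliardoPow_p
  rw [gagliardoPow_eq_setLIntegral (by linarith) hsp hφm, univ_prod_univ,
    Measure.restrict_univ] at hφg
  rw [gagliardoPow_eq_setLIntegral (by linarith) hsp hum] at hug
  have density_meas := aemeasurable_gagliardoDensity hum (n + 1) (sp * (n + 1))
  refine lt_of_le_of_lt (lintegral_mono fun z => ?_)
    ((lintegral_add_left' density_meas.restrict _).trans_lt
      (ENNReal.add_lt_top.2 ⟨hug, (setLIntegral_le_lintegral _ _).trans_lt hφg⟩))
  have hk := kern_nonneg (sp * (n + 1)) (z.1 - z.2)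
  rw [gagliardoDensity, gagliardoDensity, ← ofReal_norm,
    ← ENNReal.ofReal_add (by positivity) (by positivity), norm_mul, norm_mul, Real.norm_eq_abs,
    abs_signedPow hn, Real.norm_of_nonneg hk, ← add_mul]
  gcongr
  simpa using rpow_mul_rpow_le_add (abs_nonneg (u z.1 - u z.2)) (norm_nonneg (φ z.1 - φ z.2)) hn.le
    zero_le_one

lemma setLIntegral_power_term_far_lt_top (hsp : 0 < sp) (hn : 1 ≤ n) (hδ : 0 < δ) (hρ : 0 ≤ ρ)
    (hρR : ρ + δ ≤ R) (hR : R ≤ 1) (hum : AEStronglyMeasurable u)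
    (hu : ∀ᵐ y, y ∈ ball x₀ R → |u y| ≤ M) (htail : tailInt (sp * (n + 1)) n u x₀ R ≠ ∞)
    (hφ : IsBoundedBump s₁ sp n x₀ ρ φ) :
    ∫⁻ z in ball x₀ ρ ×ˢ (ball x₀ R)ᶜ, ‖signedPow n (u z.1 - u z.2) * (φ z.1 - φ z.2) *
      kern (sp * (n + 1)) (z.1 - z.2)‖ₑ < ∞ := by
  have hn0 : 0 < n := by linarith
  have hs : 0 < sp * (n + 1) := by positivity
  obtain ⟨A, hA⟩ := hφ.exists_abs_le
  set c := (ball x₀ ρ).indicator fun _ => ENNReal.ofReal A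
  calc _ ≤ ∫⁻ z in ball x₀ ρ ×ˢ (ball x₀ R)ᶜ, c z.1 * ENNReal.ofReal
        (|u (z.1 + 0) - u (z.2 + 0)| ^ n * kern (sp * (n + 1)) (z.1 - z.2)) := by
        refine setLIntegral_mono' (measurableSet_ball.prod measurableSet_ball.compl) fun z hz => ?_
        have hk := kern_nonneg (sp * (n + 1)) (z.1 - z.2)
        rw [show c z.1 = ENNReal.ofReal A from indicator_of_mem hz.1 _,
          hφ.eq_zero z.2 fun h => hz.2 (ball_subset_ball (by linarith) h), sub_zero, add_zero,
          add_zero, ← ENNReal.ofReal_mul' (by positivity), ← ofReal_norm, norm_mul, norm_mul,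
          Real.norm_eq_abs, abs_signedPow hn0, Real.norm_of_nonneg hk, mul_comm (_ ^ _), mul_assoc]
        gcongr
        exact hA z.1
    _ ≤ ∫⁻ z in {z : E N × E N | δ ≤ ‖z.1 - z.2‖}, c z.1 * ENNReal.ofReal
        (|u (z.1 + 0) - u (z.2 + 0)| ^ n * kern (sp * (n + 1)) (z.1 - z.2)) :=
        lintegral_mono_set (ball_prod_compl_ball_subset hρR)
    _ ≤ tailBound (sp * (n + 1)) n δ M u x₀ R * ∫⁻ x, c x := by
        refine setLIntegral_mul_far_translate_le hs hn hδ hρ hρR hR hum hu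
          (measurable_const.indicator measurableSet_ball).aemeasurable fun x hx => ?_
        rw [add_zero]
        exact mem_of_indicator_ne_zero hx
    _ < ∞ := by
        rw [lintegral_indicator measurableSet_ball, setLIntegral_const]
        exact ENNReal.mul_lt_top (tailBound_ne_top hs htail).lt_top
          (ENNReal.mul_lt_top ENNReal.ofReal_lt_top measure_ball_lt_top)

lemma integrable_power_term (hsp : 0 < sp) (hn : 1 ≤ n) (hδ : 0 < δ) (hρ : 0 ≤ ρ)
    (hρR : ρ + δ ≤ R) (hR : R ≤ 1) (hum : AEStronglyMeasurable u)
    (hu : ∀ᵐ y, y ∈ ball x₀ R → |u y| ≤ M) (hug : gagliardoPow sp (n + 1) (ball x₀ R) u < ∞)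
    (htail : tailInt (sp * (n + 1)) n u x₀ R ≠ ∞) (hφ : IsBoundedBump s₁ sp n x₀ ρ φ) :
    Integrable fun z : E N × E N => signedPow n (u z.1 - u z.2) * (φ z.1 - φ z.2) *
      kern (sp * (n + 1)) (z.1 - z.2) := by
  have measurable : AEStronglyMeasurable fun z : E N × E N => signedPow n (u z.1 - u z.2) *
      (φ z.1 - φ z.2) * kern (sp * (n + 1)) (z.1 - z.2) :=
    (((measurable_signedPow n).comp_aemeasurable
      (aestronglyMeasurable_diff hum).aemeasurable).aestronglyMeasurable.mul
      (aestronglyMeasurable_diff hφ.aestronglyMeasurable)).mul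
      (Measurable.aestronglyMeasurable (by fun_prop))
  refine ⟨measurable, (lintegral_le_setLIntegral_add_two_mul measurableSet_ball measurableSet_ball
    (ball_subset_ball (by linarith : ρ ≤ R)) measurable.enorm (fun z => ?_)
    fun z hz₁ hz₂ => ?_).trans_lt (ENNReal.add_lt_top.2
      ⟨hφ.setLIntegral_power_term_near_lt_top hsp (by linarith) hum hug,
        ENNReal.mul_lt_top ENNReal.ofNat_lt_top
          (hφ.setLIntegral_power_term_far_lt_top hsp hn hδ hρ hρR hR hum hu htail)⟩)⟩
  · rw [Prod.fst_swap, Prod.snd_swap, ← neg_sub (u z.1), signedPow_neg, ← neg_sub (φ z.1),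
      kern_sub_comm, neg_mul_neg]
  · simp [hφ.eq_zero z.1 hz₁, hφ.eq_zero z.2 hz₂]

end IsBoundedBump

end TestFunctions

/-! ### Testing the equation with powers of increments -/

section Equation

variable {N : ℕ} {s₁ s sp n : ℝ} {u : E N → ℝ} {h : E N}

lemma abs_le_one_of_mem_sgnSet {t z : ℝ} (h : z ∈ sgnSet t) : |z| ≤ 1 := by
  obtain ⟨h1, h2, h3⟩ := h
  rcases lt_trichotomy t 0 with ht | ht | ht
  · simp [h2 ht]
  · exact abs_le.2 ⟨(h3 ht).1, (h3 ht).2⟩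
  · simp [h1 ht]

lemma sgnSet_mono {b a z z' : ℝ} (h : b < a) (hz : z ∈ sgnSet b) (hz' : z' ∈ sgnSet a) :
    z ≤ z' := by
  have h1 := abs_le.1 (abs_le_one_of_mem_sgnSet hz)
  have h2 := abs_le.1 (abs_le_one_of_mem_sgnSet hz')
  rcases le_or_gt b 0 with hb | hb
  · rcases hb.lt_or_eq with hb | rfl
    · rw [hz.2.1 hb]; exact h2.1
    · rw [hz'.1 h]; exact h1.2
  · rw [hz'.1 (hb.trans h)]; exact h1.2

/-- The integrand of the weak formulation, without the factor `φ x - φ y`; here `s = s_p p` and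
`n = p - 1`. -/
noncomputable def operatorDensity (s₁ s n : ℝ) (Z : E N × E N → ℝ) (u : E N → ℝ)
    (z : E N × E N) : ℝ :=
  Z z * kern s₁ (z.1 - z.2) + signedPow n (u z.1 - u z.2) * kern s (z.1 - z.2)

/-- The increment of `operatorDensity` under the translation of both points by `h`. -/
noncomputable def operatorIncrement (s₁ s n : ℝ) (Z : E N × E N → ℝ) (u : E N → ℝ) (h : E N)
    (z : E N × E N) : ℝ :=
  operatorDensity s₁ s n Z u (z.1 + h, z.2 + h) - operatorDensity s₁ s n Z u z

lemma operatorIncrement_eq (Z : E N × E N → ℝ) (z : E N × E N) :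
    operatorIncrement s₁ s n Z u h z = (Z (z.1 + h, z.2 + h) - Z z) * kern s₁ (z.1 - z.2) +
      (signedPow n (u (z.1 + h) - u (z.2 + h)) - signedPow n (u z.1 - u z.2)) *
        kern s (z.1 - z.2) := by
  simp only [operatorIncrement, operatorDensity, add_sub_add_right_eq_sub]
  ring

lemma compactlyInside_ball {Ω : Set (E N)} {x₀ : E N} {R : ℝ} (hΩ : closedBall x₀ R ⊆ Ω) :
    CompactlyInside (ball x₀ R) Ω :=
  ⟨isOpen_ball, (isCompact_closedBall x₀ R).of_isClosed_subset isClosed_closure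
    closure_ball_subset_closedBall, closure_ball_subset_closedBall.trans hΩ⟩

lemma IsWeakSolution.exists_operatorDensity {Ω : Set (E N)}
    (hsol : IsWeakSolution s₁ sp (n + 1) Ω u) (hs₁ : 0 < s₁) (hsp : 0 < sp) (hn : 1 ≤ n)
    (hum : AEStronglyMeasurable u) {x₀ : E N} {R M : ℝ} (hR0 : 0 < R) (hR : R ≤ 1)
    (hΩ : closedBall x₀ R ⊆ Ω) (hu : ∀ᵐ y, y ∈ ball x₀ R → |u y| ≤ M) :
    ∃ Z : E N × E N → ℝ, (∀ᵐ z, Z z ∈ sgnSet (u z.1 - u z.2)) ∧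
      ∀ {ρ δ φ}, 0 < δ → 0 ≤ ρ → ρ + δ ≤ R → IsBoundedBump s₁ sp n x₀ ρ φ →
        Integrable (fun z => operatorDensity s₁ (sp * (n + 1)) n Z u z * (φ z.1 - φ z.2)) ∧
          ∫ z, operatorDensity s₁ (sp * (n + 1)) n Z u z * (φ z.1 - φ z.2) = 0 := by
  obtain ⟨Z, hZm, hZ, weak_eq⟩ := hsol.weak_eq
  refine ⟨Z, hZ, fun {ρ δ φ} hδ hρ hρR hφ => ?_⟩
  have tail_ne_top : tailInt (sp * (n + 1)) n u x₀ R ≠ ∞ :=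
    tailInt_ne_top (by positivity) hR0 (by simpa only [add_sub_cancel_right] using hsol.mem_tail.2)
  have gagliardo_lt_top : gagliardoPow sp (n + 1) (ball x₀ R) u < ∞ :=
    (hsol.mem_p _ (compactlyInside_ball hΩ)).2
  have sign_integrable := hφ.integrable_sign_term hs₁ hZm.aestronglyMeasurable
    (hZ.mono fun _ => abs_le_one_of_mem_sgnSet)
  have power_integrable :=
    hφ.integrable_power_term hsp hn hδ hρ hρR hR hum hu gagliardo_lt_top tail_ne_top
  have split : (fun z => operatorDensity s₁ (sp * (n + 1)) n Z u z * (φ z.1 - φ z.2)) = fun z =>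
      Z z * (φ z.1 - φ z.2) * kern s₁ (z.1 - z.2) +
        signedPow n (u z.1 - u z.2) * (φ z.1 - φ z.2) * kern (sp * (n + 1)) (z.1 - z.2) := by
    ext z
    rw [operatorDensity]
    ring
  rw [split]
  refine ⟨sign_integrable.add power_integrable, ?_⟩
  rw [integral_add sign_integrable power_integrable]
  simpa only [kern, signedPow, Real.rpow_neg (norm_nonneg _), div_eq_mul_inv,
    show n + 1 - 2 = n - 1 by ring] using
    weak_eq φ (hφ.isTestFunction ((closedBall_subset_closedBall (by linarith)).trans hΩ))

lemma integral_increment_mul_sub_eq_zero {k : E N × E N → ℝ} {φ : E N → ℝ}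
    (hφ : Integrable fun z => k z * (φ z.1 - φ z.2)) (hφ0 : ∫ z, k z * (φ z.1 - φ z.2) = 0)
    (hφ_h : Integrable fun z => k z * (φ (z.1 + -h) - φ (z.2 + -h)))
    (hφ_h0 : ∫ z, k z * (φ (z.1 + -h) - φ (z.2 + -h)) = 0) :
    Integrable (fun z => (k (z.1 + h, z.2 + h) - k z) * (φ z.1 - φ z.2)) ∧
      ∫ z, (k (z.1 + h, z.2 + h) - k z) * (φ z.1 - φ z.2) = 0 := by
  have emb : MeasurableEmbedding fun z : E N × E N => (z.1 + h, z.2 + h) :=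
    (MeasurableEquiv.addRight ((h, h) : E N × E N)).measurableEmbedding
  have shift := measurePreserving_prod_translate h
  have hshift : Integrable fun z : E N × E N => k (z.1 + h, z.2 + h) * (φ z.1 - φ z.2) := by
    simpa only [Function.comp_def, add_neg_cancel_right] using
      (shift.integrable_comp_emb emb).2 hφ_h
  have hshift0 : ∫ z : E N × E N, k (z.1 + h, z.2 + h) * (φ z.1 - φ z.2) = 0 := by
    simpa only [add_neg_cancel_right, hφ_h0] using
      shift.integral_comp emb fun z => k z * (φ (z.1 + -h) - φ (z.2 + -h))
  simp only [sub_mul]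
  exact ⟨hshift.sub hφ, by rw [integral_sub hshift hφ, hshift0, hφ0, sub_zero]⟩

lemma lintegral_ofReal_add_le {X : Type*} [MeasurableSpace X] {μ : Measure X} {F D : X → ℝ}
    (hF : Integrable F μ) (hF0 : ∫ x, F x ∂μ = 0) (h : ∀ᵐ x ∂μ, 0 ≤ F x + D x) :
    ∫⁻ x, ENNReal.ofReal (F x + D x) ∂μ ≤ ∫⁻ x, ENNReal.ofReal (D x) ∂μ := by
  have pos_meas : AEMeasurable (fun x => ENNReal.ofReal (F x)) μ := hF.aemeasurable.ennreal_ofReal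
  have neg_meas : AEMeasurable (fun x => ENNReal.ofReal (-F x)) μ :=
    hF.aemeasurable.neg.ennreal_ofReal
  have pos_ne_top : ∫⁻ x, ENNReal.ofReal (F x) ∂μ ≠ ∞ := hF.lintegral_lt_top.ne
  have neg_ne_top : ∫⁻ x, ENNReal.ofReal (-F x) ∂μ ≠ ∞ := hF.neg.lintegral_lt_top.ne
  have pos_eq_neg : ∫⁻ x, ENNReal.ofReal (F x) ∂μ = ∫⁻ x, ENNReal.ofReal (-F x) ∂μ := by
    rw [integral_eq_lintegral_pos_part_sub_lintegral_neg_part hF, sub_eq_zero] at hF0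
    exact (ENNReal.toReal_eq_toReal_iff' pos_ne_top neg_ne_top).1 hF0
  have add_neg_le : ∫⁻ x, (ENNReal.ofReal (F x + D x) + ENNReal.ofReal (-F x)) ∂μ ≤
      ∫⁻ x, (ENNReal.ofReal (D x) + ENNReal.ofReal (F x)) ∂μ := by
    apply lintegral_mono_ae
    filter_upwards [h] with x hx
    rcases le_total 0 (F x) with hFx | hFx
    · rw [ENNReal.ofReal_of_nonpos (neg_nonpos.2 hFx), add_zero, add_comm]
      exact ENNReal.ofReal_add_le
    · rw [ENNReal.ofReal_of_nonpos hFx, add_zero, ← ENNReal.ofReal_add hx (neg_nonneg.2 hFx)]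
      simp
  rw [lintegral_add_right' _ neg_meas, lintegral_add_right' _ pos_meas, pos_eq_neg] at add_neg_le
  exact (ENNReal.add_le_add_iff_right neg_ne_top).1 add_neg_le

end Equation

section CutoffErrors

variable {N : ℕ} {s₁ s n m δ : ℝ} {u : E N → ℝ} {h : E N}

/-- A bound for `operatorIncrement`; see `abs_operatorIncrement_le`. -/
noncomputable def incrementWeight (s₁ s n : ℝ) (u : E N → ℝ) (h : E N) (z : E N × E N) : ℝ :=
  2 * kern s₁ (z.1 - z.2) +
    (|u (z.1 + h) - u (z.2 + h)| ^ n + |u z.1 - u z.2| ^ n) * kern s (z.1 - z.2)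

lemma incrementWeight_nonneg (s₁ s n : ℝ) (u : E N → ℝ) (h : E N) (z : E N × E N) :
    0 ≤ incrementWeight s₁ s n u h z := by
  have := kern_nonneg s₁ (z.1 - z.2)
  have := kern_nonneg s (z.1 - z.2)
  unfold incrementWeight
  positivity

lemma incrementWeight_swap (s₁ s n : ℝ) (u : E N → ℝ) (h : E N) (x y : E N) :
    incrementWeight s₁ s n u h (y, x) = incrementWeight s₁ s n u h (x, y) := by
  simp only [incrementWeight]
  rw [kern_sub_comm, kern_sub_comm s, abs_sub_comm, abs_sub_comm (u y)]

lemma abs_operatorIncrement_le (hn : 0 < n) {Z : E N × E N → ℝ} {z : E N × E N} (h1 : |Z z| ≤ 1)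
    (h2 : |Z (z.1 + h, z.2 + h)| ≤ 1) :
    |operatorIncrement s₁ s n Z u h z| ≤ incrementWeight s₁ s n u h z := by
  have hk₁ := kern_nonneg s₁ (z.1 - z.2)
  have hk := kern_nonneg s (z.1 - z.2)
  rw [operatorIncrement_eq, incrementWeight]
  refine (abs_add_le _ _).trans ?_
  rw [abs_mul, abs_mul, abs_of_nonneg hk₁, abs_of_nonneg hk]
  gcongr
  · linarith [abs_sub (Z (z.1 + h, z.2 + h)) (Z z)]
  · refine (abs_sub _ _).trans ?_
    rw [abs_signedPow hn, abs_signedPow hn]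

lemma aemeasurable_incrementWeight (s₁ s n : ℝ) (hu : AEStronglyMeasurable u) (h : E N) :
    AEMeasurable (incrementWeight s₁ s n u h) := by
  have diff : AEMeasurable fun z : E N × E N => |u z.1 - u z.2| :=
    measurable_norm.comp_aemeasurable (aestronglyMeasurable_diff hu).aemeasurable
  have diff_h : AEMeasurable fun z : E N × E N => |u (z.1 + h) - u (z.2 + h)| :=
    diff.comp_quasiMeasurePreserving (measurePreserving_prod_translate h).quasiMeasurePreserving
  unfold incrementWeight
  exact (by fun_prop : Measurable fun z : E N × E N => 2 * kern s₁ (z.1 - z.2)).aemeasurable.add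
    (((diff_h.pow_const n).add (diff.pow_const n)).mul (by fun_prop))

/-- The error caused by the variation of the cutoff on pairs of points of `B`. -/
noncomputable def nearError (s₁ s n m δ : ℝ) (u : E N → ℝ) (h : E N) (B : Set (E N)) :
    E N × E N → ℝ :=
  (B ×ˢ B).indicator fun z =>
    incrementWeight s₁ s n u h z * |u (z.1 + h) - u z.1| ^ m * (‖z.1 - z.2‖ / δ)

/-- The error caused by the interaction of points of `B` with points at distance at least `δ`. -/
noncomputable def farError (s₁ s n m δ : ℝ) (u : E N → ℝ) (h : E N) (B : Set (E N)) :
    E N × E N → ℝ :=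
  {z : E N × E N | δ ≤ ‖z.1 - z.2‖}.indicator fun z =>
    B.indicator (fun x => |u (x + h) - u x| ^ m) z.1 * incrementWeight s₁ s n u h z

lemma nearError_nonneg (hδ : 0 < δ) (B : Set (E N)) (z : E N × E N) :
    0 ≤ nearError s₁ s n m δ u h B z :=
  indicator_nonneg (fun z _ => by have := incrementWeight_nonneg s₁ s n u h z; positivity) z

lemma farError_nonneg (B : Set (E N)) (z : E N × E N) : 0 ≤ farError s₁ s n m δ u h B z :=
  indicator_nonneg (fun z _ => mul_nonneg (indicator_nonneg (fun _ _ => by positivity) _)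
    (incrementWeight_nonneg s₁ s n u h z)) z

lemma aemeasurable_increment {u : E N → ℝ} (hu : AEStronglyMeasurable u) (h : E N) :
    AEMeasurable fun x => u (x + h) - u x :=
  (hu.aemeasurable.comp_quasiMeasurePreserving
    (measurePreserving_add_right volume h).quasiMeasurePreserving).sub hu.aemeasurable

lemma aemeasurable_abs_increment_rpow {u : E N → ℝ} (hu : AEStronglyMeasurable u) (h : E N)
    (m : ℝ) :
    AEMeasurable fun x => |u (x + h) - u x| ^ m :=
  (measurable_norm.comp_aemeasurable (aemeasurable_increment hu h)).pow_const m

lemma aemeasurable_nearError (s₁ s n m δ : ℝ) {u : E N → ℝ} (hu : AEStronglyMeasurable u) (h : E N)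
    {B : Set (E N)} (hB : MeasurableSet B) : AEMeasurable (nearError s₁ s n m δ u h B) := by
  refine AEMeasurable.indicator ?_ (hB.prod hB)
  refine ((aemeasurable_incrementWeight s₁ s n hu h).mul ?_).mul (by fun_prop)
  exact (aemeasurable_abs_increment_rpow hu h m).comp_quasiMeasurePreserving
    Measure.quasiMeasurePreserving_fst

lemma aemeasurable_farError (s₁ s n m δ : ℝ) {u : E N → ℝ} (hu : AEStronglyMeasurable u) (h : E N)
    {B : Set (E N)} (hB : MeasurableSet B) : AEMeasurable (farError s₁ s n m δ u h B) := by
  refine AEMeasurable.indicator ?_ (measurableSet_far δ)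
  refine AEMeasurable.mul ?_ (aemeasurable_incrementWeight s₁ s n hu h)
  exact ((aemeasurable_abs_increment_rpow hu h m).indicator hB).comp_quasiMeasurePreserving
    Measure.quasiMeasurePreserving_fst

end CutoffErrors

section Coercivity

variable {N : ℕ} {s₁ s n m K δ ρ : ℝ} {Z : E N × E N → ℝ} {u φ : E N → ℝ} {h x₀ x y : E N}

lemma sgnSet_sub_mul_signedPow_sub_nonneg {a b A B z z' : ℝ} (hm : 1 ≤ m) (hab : a - b = A - B)
    (hz : z ∈ sgnSet b) (hz' : z' ∈ sgnSet a) :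
    0 ≤ (z' - z) * (signedPow m A - signedPow m B) := by
  rcases lt_trichotomy b a with hlt | heq | hlt
  · exact mul_nonneg (sub_nonneg.2 (sgnSet_mono hlt hz hz'))
      (sub_nonneg.2 (signedPow_mono hm (by linarith)))
  · simp [show A = B by linarith]
  · exact mul_nonneg_of_nonpos_of_nonpos (sub_nonpos.2 (sgnSet_mono hlt hz' hz))
      (sub_nonpos.2 (signedPow_mono hm (by linarith)))

lemma two_rpow_mul_abs_sub_rpow_mul_kern_le_operatorIncrement_mul (hn : 1 ≤ n) (hm : 1 ≤ m)
    (hZ : Z (x, y) ∈ sgnSet (u x - u y)) (hZ' : Z (x + h, y + h) ∈ sgnSet (u (x + h) - u (y + h))) :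
    2 ^ (2 - (n + m)) *
      (|(u (x + h) - u x) - (u (y + h) - u y)| ^ (n + m) * kern s (x - y)) ≤
      operatorIncrement s₁ s n Z u h (x, y) *
        (signedPow m (u (x + h) - u x) - signedPow m (u (y + h) - u y)) := by
  have hsub : (u (x + h) - u (y + h)) - (u x - u y) = (u (x + h) - u x) - (u (y + h) - u y) := by
    ring
  have sign_term := mul_nonneg (sgnSet_sub_mul_signedPow_sub_nonneg hm hsub hZ hZ')
    (kern_nonneg s₁ (x - y))
  have power_term := mul_le_mul_of_nonneg_right
    (two_rpow_mul_abs_sub_rpow_le_signedPow_sub_mul hn hm hsub) (kern_nonneg s (x - y))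
  rw [operatorIncrement_eq]
  linarith

/-- Truncation at height `K`. -/
noncomputable def clip (K t : ℝ) : ℝ := max (-K) (min K t)

lemma abs_clip_le {K : ℝ} (hK : 0 ≤ K) (t : ℝ) : |clip K t| ≤ K := by
  rw [abs_le]
  exact ⟨le_max_left _ _, max_le (by linarith) (min_le_left _ _)⟩

lemma clip_eq {K t : ℝ} (h : |t| ≤ K) : clip K t = t := by
  rw [abs_le] at h
  rw [clip, min_eq_right h.2, max_eq_right h.1]

lemma abs_clip_sub_le (K a b : ℝ) : |clip K a - clip K b| ≤ |a - b| := by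
  unfold clip
  refine (abs_max_sub_max_le_max _ _ _ _).trans (max_le (by simp) ?_)
  exact (abs_min_sub_min_le_max _ _ _ _).trans (max_le (by simp) le_rfl)

lemma measurable_clip (K : ℝ) : Measurable (clip K) := by
  unfold clip
  fun_prop

/-- The test function `η (Δ_h u)^m`, with the signed power, a cutoff `η` of `B_ρ(x₀)` and the
increment `Δ_h u = u (· + h) - u`. Clipping at height `K` makes it bounded everywhere and does not
change it in balls where `|Δ_h u| ≤ K`. -/
noncomputable def incrementBump (m K δ ρ : ℝ) (u : E N → ℝ) (h x₀ x : E N) : ℝ :=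
  cutoff x₀ ρ δ x * signedPow m (clip K (u (x + h) - u x))

lemma incrementBump_eq (hK : |u (x + h) - u x| ≤ K) :
    incrementBump m K δ ρ u h x₀ x = cutoff x₀ ρ δ x * signedPow m (u (x + h) - u x) := by
  rw [incrementBump, clip_eq hK]

lemma incrementBump_eq_zero (hδ : 0 < δ) (hx : x ∉ ball x₀ ρ) :
    incrementBump m K δ ρ u h x₀ x = 0 := by
  rw [incrementBump, cutoff_eq_zero hδ hx, zero_mul]

lemma incrementWeight_mul_incrementBump_sub_le_farError (hm : 0 < m) (hδ : 0 < δ)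
    (hx : x ∈ ball x₀ (ρ + δ) → |u (x + h) - u x| ≤ K) (hy : y ∉ ball x₀ (ρ + δ)) :
    incrementWeight s₁ s n u h (x, y) *
        |incrementBump m K δ ρ u h x₀ x - incrementBump m K δ ρ u h x₀ y| ≤
      farError s₁ s n m δ u h (ball x₀ ρ) (x, y) := by
  have hyρ : y ∉ ball x₀ ρ := fun hy' => hy (ball_subset_ball (by linarith) hy')
  rw [incrementBump_eq_zero hδ hyρ, sub_zero]
  by_cases hxρ : x ∈ ball x₀ ρ
  · have far : (x, y) ∈ {z : E N × E N | δ ≤ ‖z.1 - z.2‖} :=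
      ball_prod_compl_ball_subset le_rfl (mk_mem_prod hxρ hy)
    rw [farError, indicator_of_mem far, indicator_of_mem (show (x, y).1 ∈ _ from hxρ), mul_comm,
      incrementBump_eq (hx (ball_subset_ball (by linarith) hxρ)), abs_mul,
      abs_of_nonneg (cutoff_nonneg _ _ _ _), abs_signedPow hm]
    exact mul_le_mul_of_nonneg_right (mul_le_of_le_one_left (by positivity) (cutoff_le_one _ _ _ _))
      (incrementWeight_nonneg _ _ _ _ _ _)
  · rw [incrementBump_eq_zero hδ hxρ, abs_zero, mul_zero]
    exact farError_nonneg _ _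

lemma abs_mul_cutoff_sub_mul_le_nearError (hm : 0 < m) (hδ : 0 < δ) {B : Set (E N)} (hx : x ∈ B)
    (hy : y ∈ B) {W : ℝ} (hW : |W| ≤ incrementWeight s₁ s n u h (x, y)) :
    |W * (cutoff x₀ ρ δ x - cutoff x₀ ρ δ y) *
        ((signedPow m (u (x + h) - u x) + signedPow m (u (y + h) - u y)) / 2)| ≤
      nearError s₁ s n m δ u h B (x, y) + nearError s₁ s n m δ u h B (y, x) := by
  have half_add_le (a b : ℝ) : |(signedPow m a + signedPow m b) / 2| ≤ |a| ^ m + |b| ^ m := by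
    rw [abs_div, abs_two, ← abs_signedPow hm, ← abs_signedPow hm]
    linarith [abs_add_le (signedPow m a) (signedPow m b),
      abs_nonneg (signedPow m a + signedPow m b)]
  rw [nearError, indicator_of_mem (mk_mem_prod hx hy), indicator_of_mem (mk_mem_prod hy hx),
    incrementWeight_swap s₁ s n u h x y]
  simp only
  rw [norm_sub_rev y x, ← add_mul, ← mul_add, abs_mul, abs_mul, mul_right_comm]
  have := incrementWeight_nonneg s₁ s n u h (x, y)
  gcongr
  · exact half_add_le _ _
  · exact abs_cutoff_sub_le hδ x y

lemma two_rpow_mul_abs_sub_rpow_mul_kern_le_operatorIncrement_mul_incrementBump (hn : 1 ≤ n)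
    (hm : 1 ≤ m) (hδ : 0 < δ) (hZ : Z (x, y) ∈ sgnSet (u x - u y))
    (hZ' : Z (x + h, y + h) ∈ sgnSet (u (x + h) - u (y + h))) (hx : x ∈ ball x₀ (ρ - δ))
    (hy : y ∈ ball x₀ (ρ - δ)) (hxK : |u (x + h) - u x| ≤ K) (hyK : |u (y + h) - u y| ≤ K) :
    2 ^ (2 - (n + m)) *
      (|(u (x + h) - u x) - (u (y + h) - u y)| ^ (n + m) * kern s (x - y)) ≤
      operatorIncrement s₁ s n Z u h (x, y) *
        (incrementBump m K δ ρ u h x₀ x - incrementBump m K δ ρ u h x₀ y) := by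
  rw [incrementBump_eq hxK, incrementBump_eq hyK, cutoff_eq_one hδ hx, cutoff_eq_one hδ hy,
    one_mul, one_mul]
  exact two_rpow_mul_abs_sub_rpow_mul_kern_le_operatorIncrement_mul hn hm hZ hZ'

lemma operatorIncrement_mul_add_nearError_nonneg (hn : 1 ≤ n) (hm : 1 ≤ m) (hδ : 0 < δ)
    (hZ : Z (x, y) ∈ sgnSet (u x - u y)) (hZ' : Z (x + h, y + h) ∈ sgnSet (u (x + h) - u (y + h)))
    {B : Set (E N)} (hx : x ∈ B) (hy : y ∈ B) (hxK : |u (x + h) - u x| ≤ K)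
    (hyK : |u (y + h) - u y| ≤ K) :
    0 ≤ operatorIncrement s₁ s n Z u h (x, y) *
        (incrementBump m K δ ρ u h x₀ x - incrementBump m K δ ρ u h x₀ y) +
      (nearError s₁ s n m δ u h B (x, y) + nearError s₁ s n m δ u h B (y, x)) := by
  have abs_W_le := abs_operatorIncrement_le (s₁ := s₁) (s := s) (u := u) (by linarith : 0 < n)
    (abs_le_one_of_mem_sgnSet hZ) (abs_le_one_of_mem_sgnSet hZ')
  have coercive := two_rpow_mul_abs_sub_rpow_mul_kern_le_operatorIncrement_mul (s₁ := s₁) (s := s)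
    hn hm hZ hZ'
  have hk := kern_nonneg s (x - y)
  have error_le := abs_mul_cutoff_sub_mul_le_nearError (m := m) (x₀ := x₀) (ρ := ρ) (by linarith) hδ
    hx hy abs_W_le
  have average_nonneg : 0 ≤ (cutoff x₀ ρ δ x + cutoff x₀ ρ δ y) / 2 := by
    linarith [cutoff_nonneg x₀ ρ δ x, cutoff_nonneg x₀ ρ δ y]
  have main_nonneg := mul_nonneg (le_trans (by positivity) coercive) average_nonneg
  rw [incrementBump_eq hxK, incrementBump_eq hyK]
  linarith [(abs_le.1 error_le).1]

lemma operatorIncrement_mul_add_error_nonneg (hn : 1 ≤ n) (hm : 1 ≤ m) (hδ : 0 < δ)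
    (hZ : Z (x, y) ∈ sgnSet (u x - u y)) (hZ' : Z (x + h, y + h) ∈ sgnSet (u (x + h) - u (y + h)))
    (hx : x ∈ ball x₀ (ρ + δ) → |u (x + h) - u x| ≤ K)
    (hy : y ∈ ball x₀ (ρ + δ) → |u (y + h) - u y| ≤ K) :
    0 ≤ operatorIncrement s₁ s n Z u h (x, y) *
        (incrementBump m K δ ρ u h x₀ x - incrementBump m K δ ρ u h x₀ y) +
      ((nearError s₁ s n m δ u h (ball x₀ (ρ + δ)) (x, y) +
        farError s₁ s n m δ u h (ball x₀ ρ) (x, y)) +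
      (nearError s₁ s n m δ u h (ball x₀ (ρ + δ)) (y, x) +
        farError s₁ s n m δ u h (ball x₀ ρ) (y, x))) := by
  have hm0 : 0 < m := by linarith
  have near_nonneg (z : E N × E N) :=
    nearError_nonneg (s₁ := s₁) (s := s) (n := n) (m := m) (u := u) (h := h) hδ (ball x₀ (ρ + δ)) z
  have far_nonneg (z : E N × E N) :=
    farError_nonneg (s₁ := s₁) (s := s) (n := n) (m := m) (δ := δ) (u := u) (h := h) (ball x₀ ρ) z
  have neg_le : -(incrementWeight s₁ s n u h (x, y) *
      |incrementBump m K δ ρ u h x₀ x - incrementBump m K δ ρ u h x₀ y|) ≤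
      operatorIncrement s₁ s n Z u h (x, y) *
        (incrementBump m K δ ρ u h x₀ x - incrementBump m K δ ρ u h x₀ y) := by
    refine (neg_le_neg ?_).trans (neg_abs_le _)
    rw [abs_mul]
    gcongr
    exact abs_operatorIncrement_le (by linarith) (abs_le_one_of_mem_sgnSet hZ)
      (abs_le_one_of_mem_sgnSet hZ')
  by_cases hyB : y ∈ ball x₀ (ρ + δ)
  · by_cases hxB : x ∈ ball x₀ (ρ + δ)
    · linarith [operatorIncrement_mul_add_nearError_nonneg (s₁ := s₁) (s := s) (x₀ := x₀) (ρ := ρ)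
        hn hm hδ hZ hZ' hxB hyB (hx hxB) (hy hyB), far_nonneg (x, y), far_nonneg (y, x)]
    · have far_le := incrementWeight_mul_incrementBump_sub_le_farError (s₁ := s₁) (s := s) (n := n)
        hm0 hδ hy hxB
      rw [incrementWeight_swap, abs_sub_comm] at far_le
      linarith [near_nonneg (x, y), near_nonneg (y, x), far_nonneg (x, y)]
  · have far_le := incrementWeight_mul_incrementBump_sub_le_farError (s₁ := s₁) (s := s) (n := n)
      hm0 hδ hx hyB
    linarith [near_nonneg (x, y), near_nonneg (y, x), far_nonneg (y, x)]

end Coercivity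

section EnergyError

variable {N : ℕ} {s₁ sp n m K M δ ρ R : ℝ} {u : E N → ℝ} {h x₀ : E N}

lemma gagliardoPow_incrementBump_lt_top {γ t : ℝ} (hN : 1 ≤ N) (ht : 1 ≤ t) (hγ : 0 < γ)
    (hγ1 : γ < 1) (hm : 1 ≤ m) (hK : 0 ≤ K) (hδ : 0 < δ) (hρ : 0 ≤ ρ) (hρR : ρ + 2 * δ ≤ R)
    (hR : R ≤ 1) (hum : AEStronglyMeasurable u) (hug : gagliardoPow γ t (ball x₀ R) u < ∞)
    (hh : ‖h‖ ≤ δ) : gagliardoPow γ t univ (incrementBump m K δ ρ u h x₀) < ∞ := by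
  have ht0 : 0 ≤ t := by linarith
  have increment_lt_top : gagliardoPow γ t (ball x₀ (ρ + δ)) (fun x => u (x + h) - u x) < ∞ :=
    gagliardoPow_increment_lt_top ht hγ hum hh (by linarith) hug
  have lipschitz (a b : ℝ) :
      ‖signedPow m (clip K a) - signedPow m (clip K b)‖ ≤ m * K ^ (m - 1) * ‖a - b‖ :=
    (abs_signedPow_sub_le hm (abs_clip_le hK a) (abs_clip_le hK b)).trans
      (mul_le_mul_of_nonneg_left (abs_clip_sub_le K a b) (by positivity))
  refine gagliardoPow_cutoff_smul_lt_top hN ht hγ hγ1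
    (f := fun x => signedPow m (clip K (u (x + h) - u x))) (A := K ^ m)
    (((measurable_signedPow m).comp (measurable_clip K)).comp_aemeasurable
      (aemeasurable_increment hum h)).aestronglyMeasurable (fun x => ?_) hδ hρ le_rfl
    (by linarith) ?_
  · rw [Real.norm_eq_abs, abs_signedPow (by linarith)]
    exact Real.rpow_le_rpow (abs_nonneg _) (abs_clip_le hK _) (by linarith)
  · refine (gagliardoPow_le_of_norm_sub_le ht0 fun x y => lipschitz _ _).trans_lt
      (ENNReal.mul_lt_top ?_ increment_lt_top)
    exact (ENNReal.rpow_ne_top_of_nonneg ht0 ENNReal.ofReal_ne_top).lt_top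

lemma isBoundedBump_incrementBump (hN : 1 ≤ N) (hs₁ : 0 < s₁) (hs₁' : s₁ < 1) (hsp : 0 < sp)
    (hsp' : sp < 1) (hn : 0 ≤ n) (hm : 1 ≤ m) (hK : 0 ≤ K) (hδ : 0 < δ) (hρ : 0 ≤ ρ)
    (hρR : ρ + 2 * δ ≤ R) (hR : R ≤ 1) (hum : AEStronglyMeasurable u)
    (hu₁ : gagliardoPow s₁ 1 (ball x₀ R) u < ∞) (hup : gagliardoPow sp (n + 1) (ball x₀ R) u < ∞)
    (hh : ‖h‖ ≤ δ) : IsBoundedBump s₁ sp n x₀ ρ (incrementBump m K δ ρ u h x₀) where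
  aestronglyMeasurable := (measurable_cutoff x₀ ρ δ).aestronglyMeasurable.mul
    (((measurable_signedPow m).comp (measurable_clip K)).comp_aemeasurable
      (aemeasurable_increment hum h)).aestronglyMeasurable
  exists_abs_le := ⟨K ^ m, fun x => by
    rw [incrementBump, abs_mul, abs_of_nonneg (cutoff_nonneg _ _ _ _), abs_signedPow (by linarith)]
    exact (mul_le_of_le_one_left (by positivity) (cutoff_le_one _ _ _ _)).trans
      (Real.rpow_le_rpow (abs_nonneg _) (abs_clip_le hK _) (by linarith))⟩
  eq_zero _ hx := incrementBump_eq_zero hδ hx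
  gagliardoPow_one :=
    gagliardoPow_incrementBump_lt_top hN le_rfl hs₁ hs₁' hm hK hδ hρ hρR hR hum hu₁ hh
  gagliardoPow_p :=
    gagliardoPow_incrementBump_lt_top hN (by linarith) hsp hsp' hm hK hδ hρ hρR hR hum hup hh

lemma ae_abs_increment_le (hu : ∀ᵐ y, y ∈ ball x₀ R → |u y| ≤ M) (hh : ‖h‖ ≤ δ) (hδ : 0 ≤ δ)
    (hρR : ρ + δ ≤ R) : ∀ᵐ x, x ∈ ball x₀ ρ → |u (x + h) - u x| ≤ 2 * M := by
  filter_upwards [hu, (measurePreserving_add_right volume h).quasiMeasurePreserving.ae hu]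
    with x hx hxh hxρ
  linarith [abs_sub (u (x + h)) (u x), hx (ball_subset_ball (by linarith) hxρ),
    hxh (add_mem_ball_of_norm_le hxρ hh hρR)]

lemma IsWeakSolution.exists_integral_operatorIncrement_eq_zero (hN : 1 ≤ N) (hs₁ : 0 < s₁)
    (hs₁' : s₁ < 1) (hsp : 0 < sp) (hsp' : sp < 1) (hn : 1 ≤ n) (hm : 1 ≤ m) (hδ : 0 < δ)
    (hρ : 0 < ρ) (hρR : ρ + 2 * δ ≤ R) (hR : R ≤ 1) {Ω : Set (E N)} (hum : AEStronglyMeasurable u)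
    (hsol : IsWeakSolution s₁ sp (n + 1) Ω u) (hΩ : closedBall x₀ R ⊆ Ω) (hM : 0 ≤ M)
    (hu : ∀ᵐ y, y ∈ ball x₀ R → |u y| ≤ M) (hh : ‖h‖ ≤ δ) :
    ∃ Z : E N × E N → ℝ, (∀ᵐ z, Z z ∈ sgnSet (u z.1 - u z.2)) ∧
      Integrable (fun z => operatorIncrement s₁ (sp * (n + 1)) n Z u h z *
        (incrementBump m (2 * M) δ ρ u h x₀ z.1 - incrementBump m (2 * M) δ ρ u h x₀ z.2)) ∧
      ∫ z, operatorIncrement s₁ (sp * (n + 1)) n Z u h z *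
        (incrementBump m (2 * M) δ ρ u h x₀ z.1 - incrementBump m (2 * M) δ ρ u h x₀ z.2) = 0 := by
  have hR0 : 0 < R := by linarith
  have inside : CompactlyInside (ball x₀ R) Ω := compactlyInside_ball hΩ
  obtain ⟨Z, hZ, weak_eq⟩ := hsol.exists_operatorDensity hs₁ hsp hn hum hR0 hR hΩ hu
  have bump : IsBoundedBump s₁ sp n x₀ ρ (incrementBump m (2 * M) δ ρ u h x₀) :=
    isBoundedBump_incrementBump hN hs₁ hs₁' hsp hsp' (by linarith) hm (by positivity) hδ hρ.le hρR
      hR hum (hsol.mem_one _ inside).2 (hsol.mem_p _ inside).2 hh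
  have bump_h := bump.comp_add_right (h := -h) (δ := δ) (by rwa [norm_neg])
  obtain ⟨hφi, hφ0⟩ := weak_eq hδ hρ.le (by linarith) bump
  obtain ⟨hφ_hi, hφ_h0⟩ := weak_eq hδ (by linarith) (by linarith) bump_h
  exact ⟨Z, hZ, integral_increment_mul_sub_eq_zero hφi hφ0 hφ_hi hφ_h0⟩

/-- The total error in the energy estimate on `B_{ρ-δ}(x₀)`, for one ordering of the two points. -/
noncomputable def cutoffError (s₁ s n m δ ρ : ℝ) (u : E N → ℝ) (h x₀ : E N) (z : E N × E N) : ℝ :=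
  nearError s₁ s n m δ u h (ball x₀ (ρ + δ)) z + farError s₁ s n m δ u h (ball x₀ ρ) z

lemma cutoffError_nonneg {s : ℝ} (hδ : 0 < δ) (z : E N × E N) :
    0 ≤ cutoffError s₁ s n m δ ρ u h x₀ z :=
  add_nonneg (nearError_nonneg hδ _ z) (farError_nonneg _ z)

lemma IsWeakSolution.exists_increment_energy_le (hN : 1 ≤ N) (hs₁ : 0 < s₁) (hs₁' : s₁ < 1)
    (hsp : 0 < sp) (hsp' : sp < 1) (hn : 1 ≤ n) (hm : 1 ≤ m) (hδ : 0 < δ) (hρ : 0 < ρ)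
    (hρR : ρ + 2 * δ ≤ R) (hR : R ≤ 1) {Ω : Set (E N)} (hum : AEStronglyMeasurable u)
    (hsol : IsWeakSolution s₁ sp (n + 1) Ω u) (hΩ : closedBall x₀ R ⊆ Ω) (hM : 0 ≤ M)
    (hu : ∀ᵐ y, y ∈ ball x₀ R → |u y| ≤ M) (hh : ‖h‖ ≤ δ) :
    ∃ F : E N × E N → ℝ, Integrable F ∧ ∫ z, F z = 0 ∧
      (∀ᵐ z, z ∈ ball x₀ (ρ - δ) ×ˢ ball x₀ (ρ - δ) → 2 ^ (2 - (n + m)) *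
        (|(u (z.1 + h) - u z.1) - (u (z.2 + h) - u z.2)| ^ (n + m) *
          kern (sp * (n + 1)) (z.1 - z.2)) ≤ F z) ∧
      ∀ᵐ z, 0 ≤ F z + (cutoffError s₁ (sp * (n + 1)) n m δ ρ u h x₀ z +
        cutoffError s₁ (sp * (n + 1)) n m δ ρ u h x₀ z.swap) := by
  obtain ⟨Z, hZ, integrable, integral_eq_zero⟩ := hsol.exists_integral_operatorIncrement_eq_zero
    hN hs₁ hs₁' hsp hsp' hn hm hδ hρ hρR hR hum hΩ hM hu hh
  have hZ_h := (measurePreserving_prod_translate h).quasiMeasurePreserving.ae hZ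
  have increment_le : ∀ᵐ x, x ∈ ball x₀ (ρ + δ) → |u (x + h) - u x| ≤ 2 * M :=
    ae_abs_increment_le hu hh hδ.le (by linarith)
  have increment_le₁ : ∀ᵐ z : E N × E N, z.1 ∈ ball x₀ (ρ + δ) → |u (z.1 + h) - u z.1| ≤ 2 * M :=
    Measure.quasiMeasurePreserving_fst.ae increment_le
  have increment_le₂ : ∀ᵐ z : E N × E N, z.2 ∈ ball x₀ (ρ + δ) → |u (z.2 + h) - u z.2| ≤ 2 * M :=
    Measure.quasiMeasurePreserving_snd.ae increment_le
  have ball_le : ball x₀ (ρ - δ) ⊆ ball x₀ (ρ + δ) := ball_subset_ball (by linarith)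
  refine ⟨_, integrable, integral_eq_zero, ?_, ?_⟩
  · filter_upwards [hZ, hZ_h, increment_le₁, increment_le₂] with z hz hzh hz₁ hz₂ hzB
    exact two_rpow_mul_abs_sub_rpow_mul_kern_le_operatorIncrement_mul_incrementBump hn hm hδ hz
      hzh hzB.1 hzB.2 (hz₁ (ball_le hzB.1)) (hz₂ (ball_le hzB.2))
  · filter_upwards [hZ, hZ_h, increment_le₁, increment_le₂] with z hz hzh hz₁ hz₂
    exact operatorIncrement_mul_add_error_nonneg hn hm hδ hz hzh hz₁ hz₂

lemma lintegral_increment_energy_le_error (hN : 1 ≤ N) (hs₁ : 0 < s₁) (hs₁' : s₁ < 1)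
    (hsp : 0 < sp) (hsp' : sp < 1) (hn : 1 ≤ n) (hm : 1 ≤ m) (hδ : 0 < δ) (hρ : 0 < ρ)
    (hρR : ρ + 2 * δ ≤ R) (hR : R ≤ 1) {Ω : Set (E N)} (hum : AEStronglyMeasurable u)
    (hsol : IsWeakSolution s₁ sp (n + 1) Ω u) (hΩ : closedBall x₀ R ⊆ Ω) (hM : 0 ≤ M)
    (hu : ∀ᵐ y, y ∈ ball x₀ R → |u y| ≤ M) (hh : ‖h‖ ≤ δ) :
    (∫⁻ z in ball x₀ (ρ - δ) ×ˢ ball x₀ (ρ - δ), ENNReal.ofReal (2 ^ (2 - (n + m)) *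
      (|(u (z.1 + h) - u z.1) - (u (z.2 + h) - u z.2)| ^ (n + m) *
        kern (sp * (n + 1)) (z.1 - z.2)))) ≤
    2 * ((∫⁻ z, ENNReal.ofReal (nearError s₁ (sp * (n + 1)) n m δ u h (ball x₀ (ρ + δ)) z)) +
      ∫⁻ z, ENNReal.ofReal (farError s₁ (sp * (n + 1)) n m δ u h (ball x₀ ρ) z)) := by
  obtain ⟨F, integrable, integral_eq_zero, energy_le, error_nonneg⟩ :=
    hsol.exists_increment_energy_le hN hs₁ hs₁' hsp hsp' hn hm hδ hρ hρR hR hum hΩ hM hu hh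
  set err : E N × E N → ℝ := cutoffError s₁ (sp * (n + 1)) n m δ ρ u h x₀
  have near_meas := aemeasurable_nearError s₁ (sp * (n + 1)) n m δ hum h
    (measurableSet_ball (x := x₀) (ε := ρ + δ))
  have far_meas := aemeasurable_farError s₁ (sp * (n + 1)) n m δ hum h
    (measurableSet_ball (x := x₀) (ε := ρ))
  calc
    _ ≤ ∫⁻ z in ball x₀ (ρ - δ) ×ˢ ball x₀ (ρ - δ),
          ENNReal.ofReal (F z + (err z + err z.swap)) := by
      refine setLIntegral_mono_ae' (measurableSet_ball.prod measurableSet_ball) ?_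
      filter_upwards [energy_le] with z hz hzB
      exact ENNReal.ofReal_le_ofReal (le_add_of_le_of_nonneg (hz hzB)
        (add_nonneg (cutoffError_nonneg hδ z) (cutoffError_nonneg hδ z.swap)))
    _ ≤ ∫⁻ z, ENNReal.ofReal (F z + (err z + err z.swap)) := setLIntegral_le_lintegral _ _
    _ ≤ ∫⁻ z, ENNReal.ofReal (err z + err z.swap) :=
      lintegral_ofReal_add_le integrable integral_eq_zero error_nonneg
    _ ≤ 2 * ∫⁻ z, ENNReal.ofReal (err z) :=
      lintegral_le_two_mul_of_le_add_swap (near_meas.add far_meas).ennreal_ofReal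
        (ae_of_all _ fun z => ENNReal.ofReal_add_le)
    _ ≤ _ := by
      gcongr
      rw [← lintegral_add_left' near_meas.ennreal_ofReal]
      exact lintegral_mono fun z => ENNReal.ofReal_add_le

end EnergyError

section EnergyEstimate

variable {N : ℕ} {s₁ s sp n m q κ δ ρ R M : ℝ} {Ω : Set (E N)} {u : E N → ℝ} {G : E N → E N}
  {x₀ x y h : E N}

/-- The absolute slope of `u` between two points; by the convention `0 / 0 = 0` it vanishes on the
diagonal. -/
noncomputable def absSlope (u : E N → ℝ) (x y : E N) : ℝ := |u x - u y| / ‖x - y‖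

lemma absSlope_nonneg (u : E N → ℝ) (x y : E N) : 0 ≤ absSlope u x y := by
  unfold absSlope
  positivity

lemma absSlope_comm (u : E N → ℝ) (x y : E N) : absSlope u x y = absSlope u y x := by
  rw [absSlope, abs_sub_comm, norm_sub_rev, absSlope]

lemma abs_increment_eq_mul_absSlope (hh0 : h ≠ 0) :
    |u (x + h) - u x| = ‖h‖ * absSlope u (x + h) x := by
  rw [absSlope, add_sub_cancel_left, mul_div_cancel₀ _ (norm_ne_zero_iff.2 hh0)]

lemma ofReal_absSlope_rpow (hq : 0 ≤ q) (hxy : x ≠ y) :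
    ENNReal.ofReal (absSlope u x y ^ q) = ‖u x - u y‖ₑ ^ q / ‖x - y‖ₑ ^ q := by
  rw [← ENNReal.ofReal_rpow_of_nonneg (absSlope_nonneg u x y) hq, absSlope,
    ENNReal.ofReal_div_of_pos (norm_sub_pos_iff.2 hxy), ENNReal.div_rpow_of_nonneg _ _ hq,
    ← Real.norm_eq_abs, ofReal_norm, ofReal_norm]

lemma aemeasurable_absSlope (hu : AEStronglyMeasurable u) :
    AEMeasurable fun z : E N × E N => absSlope u z.1 z.2 :=
  (measurable_norm.comp_aemeasurable (aestronglyMeasurable_diff hu).aemeasurable).div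
    (by fun_prop)

lemma aemeasurable_absSlope_add_right (hu : AEStronglyMeasurable u) (h : E N) :
    AEMeasurable fun x => absSlope u (x + h) x := by
  simp only [absSlope, add_sub_cancel_left]
  exact (measurable_norm.comp_aemeasurable (aemeasurable_increment hu h)).div_const _

lemma setLIntegral_absSlope_add_right_rpow_le (hq : 1 ≤ q) (hρR : ρ < R) (hu : LocallyIntegrable u)
    (hG : IsWeakGradient Ω u G) (hΩ : closedBall x₀ R ⊆ Ω) (h : E N) :
    ∫⁻ x in ball x₀ ρ ∩ {x | x + h ∈ ball x₀ ρ}, ENNReal.ofReal (absSlope u (x + h) x ^ q) ≤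
      ∫⁻ x in ball x₀ R, ‖G x‖ₑ ^ q := by
  have hq0 : 0 < q := by linarith
  rcases eq_or_ne h 0 with rfl | hh0
  · simp [absSlope, Real.zero_rpow hq0.ne']
  have enorm_ne_zero : ‖h‖ₑ ^ q ≠ 0 := by simpa [hq0.le, hq0] using hh0
  have : ‖h‖ₑ ^ q ≠ ∞ := ENNReal.rpow_ne_top_of_nonneg hq0.le enorm_ne_top
  have slope_eq (x : E N) : ENNReal.ofReal (absSlope u (x + h) x ^ q) =
      ‖u (x + h) - u x‖ₑ ^ q * (‖h‖ₑ ^ q)⁻¹ := by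
    rw [ofReal_absSlope_rpow hq0.le (by simpa using hh0), add_sub_cancel_left, div_eq_mul_inv]
  simp only [slope_eq]
  rw [lintegral_mul_const' _ _ (ENNReal.inv_ne_top.2 enorm_ne_zero), ← div_eq_mul_inv]
  exact ENNReal.div_le_of_le_mul' (lintegral_translate_le_of_isWeakGradient hu hG hρR hΩ hq h)

lemma setLIntegral_ball_absSlope_rpow_le (hq : 1 ≤ q) (hδ : 0 ≤ δ) (hρR : ρ + δ < R)
    (hu : LocallyIntegrable u) (hG : IsWeakGradient Ω u G) (hΩ : closedBall x₀ R ⊆ Ω)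
    (hh : ‖h‖ ≤ δ) :
    ∫⁻ x in ball x₀ ρ, ENNReal.ofReal (absSlope u (x + h) x ^ q) ≤
      ∫⁻ x in ball x₀ R, ‖G x‖ₑ ^ q := by
  have subset : ball x₀ ρ ⊆ ball x₀ (ρ + δ) ∩ {x | x + h ∈ ball x₀ (ρ + δ)} := fun x hx =>
    ⟨ball_subset_ball (by linarith) hx, mem_ofPred.2 (add_mem_ball_of_norm_le hx hh le_rfl)⟩
  exact (lintegral_mono_set subset).trans
    (setLIntegral_absSlope_add_right_rpow_le hq hρR hu hG hΩ h)

lemma aemeasurable_absSlope_rpow_mul_kern (hu : AEStronglyMeasurable u) (q κ : ℝ) :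
    AEMeasurable fun z : E N × E N =>
      ENNReal.ofReal (absSlope u z.1 z.2 ^ q * kern κ (z.1 - z.2)) :=
  (((aemeasurable_absSlope hu).pow_const q).mul (by fun_prop)).ennreal_ofReal

lemma setLIntegral_absSlope_rpow_mul_kern_le (hq : 1 ≤ q) (hρR : ρ < R) (hR : R ≤ 1)
    (hu : LocallyIntegrable u) (hG : IsWeakGradient Ω u G) (hΩ : closedBall x₀ R ⊆ Ω) :
    ∫⁻ z in ball x₀ ρ ×ˢ ball x₀ ρ,
      ENNReal.ofReal (absSlope u z.1 z.2 ^ q * kern (-κ) (z.1 - z.2)) ≤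
      nearConst N κ * ∫⁻ x in ball x₀ R, ‖G x‖ₑ ^ q := by
  refine setLIntegral_prod_le_nearConst_mul (by linarith)
    (aemeasurable_absSlope_rpow_mul_kern hu.aestronglyMeasurable q (-κ)).restrict fun k _ => ?_
  have slope_eq (x : E N) :
      ENNReal.ofReal (absSlope u x (x + k) ^ q * kern (-κ) (x - (x + k))) =
        ENNReal.ofReal (kern (-κ) k) * ENNReal.ofReal (absSlope u (x + k) x ^ q) := by
    rw [sub_add_cancel_left, kern_neg, mul_comm, ENNReal.ofReal_mul (kern_nonneg _ _),
      absSlope_comm]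
  simp only [slope_eq]
  rw [lintegral_const_mul' _ _ ENNReal.ofReal_ne_top]
  exact mul_le_mul_right (setLIntegral_absSlope_add_right_rpow_le hq hρR hu hG hΩ k) _

lemma setLIntegral_absSlope_translate_rpow_mul_kern_le (hq : 1 ≤ q) (hρR : ρ + δ < R) (hR : R ≤ 1)
    (hu : LocallyIntegrable u) (hG : IsWeakGradient Ω u G) (hΩ : closedBall x₀ R ⊆ Ω)
    (hh : ‖h‖ ≤ δ) :
    ∫⁻ z in ball x₀ ρ ×ˢ ball x₀ ρ,
      ENNReal.ofReal (absSlope u (z.1 + h) (z.2 + h) ^ q * kern (-κ) (z.1 - z.2)) ≤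
      nearConst N κ * ∫⁻ x in ball x₀ R, ‖G x‖ₑ ^ q := by
  have translate_le := setLIntegral_prod_translate_le measurableSet_ball measurableSet_ball
    (fun x hx => add_mem_ball_of_norm_le (x₀ := x₀) (ρ := ρ) hx hh le_rfl)
    fun z => ENNReal.ofReal (absSlope u z.1 z.2 ^ q * kern (-κ) (z.1 - z.2))
  simp only [add_sub_add_right_eq_sub] at translate_le
  exact translate_le.trans (setLIntegral_absSlope_rpow_mul_kern_le hq hρR hR hu hG hΩ)

/-- The volume of the unit ball. -/
noncomputable def unitVol (N : ℕ) : ℝ≥0∞ := volume (ball (0 : E N) 1)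

lemma unitVol_ne_top : unitVol N ≠ ∞ := measure_ball_lt_top.ne

lemma volume_ball_le_unitVol (hρ : ρ ≤ 1) : volume (ball x₀ ρ) ≤ unitVol N := by
  rw [unitVol, ← Measure.addHaar_ball_center volume x₀ 1]
  exact measure_mono (ball_subset_ball hρ)

lemma setLIntegral_one_add_absSlope_rpow_mul_kern_le (hN : 1 ≤ N) (hκ : 0 < κ) (hq : 1 ≤ q)
    (hδ : 0 ≤ δ) (hρR : ρ + δ < R) (hR : R ≤ 1) (hu : LocallyIntegrable u)
    (hG : IsWeakGradient Ω u G) (hΩ : closedBall x₀ R ⊆ Ω) (hh : ‖h‖ ≤ δ) :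
    ∫⁻ z in ball x₀ ρ ×ˢ ball x₀ ρ,
      ENNReal.ofReal ((1 + absSlope u (z.1 + h) z.1 ^ q) * kern (-κ) (z.1 - z.2)) ≤
      nearConst N κ * (unitVol N + ∫⁻ x in ball x₀ R, ‖G x‖ₑ ^ q) := by
  have nonneg (x : E N) : 0 ≤ absSlope u (x + h) x ^ q :=
    Real.rpow_nonneg (absSlope_nonneg u _ _) q
  have integral_le : ∫⁻ x in ball x₀ ρ, ENNReal.ofReal (1 + absSlope u (x + h) x ^ q) ≤
      unitVol N + ∫⁻ x in ball x₀ R, ‖G x‖ₑ ^ q := by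
    simp only [ENNReal.ofReal_add zero_le_one (nonneg _), ENNReal.ofReal_one]
    rw [lintegral_add_left measurable_const, setLIntegral_const, one_mul]
    exact add_le_add (volume_ball_le_unitVol (by linarith))
      (setLIntegral_ball_absSlope_rpow_le hq hδ hρR hu hG hΩ hh)
  simp only [ENNReal.ofReal_mul (add_nonneg zero_le_one (nonneg _))]
  refine (setLIntegral_prod_mul_kern_near_le hN hκ (by linarith)
    fun x => ENNReal.ofReal (1 + absSlope u (x + h) x ^ q)).trans ?_
  gcongr

lemma abs_sub_rpow_mul_kern_mul_norm_eq (hxy : x ≠ y) (h : E N) :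
    |u (x + h) - u (y + h)| ^ n * kern s (x - y) * ‖x - y‖ =
      absSlope u (x + h) (y + h) ^ n * kern (-(n + 1 - s)) (x - y) := by
  have norm_pos : 0 < ‖x - y‖ := norm_sub_pos_iff.2 hxy
  rw [absSlope, add_sub_add_right_eq_sub, neg_sub, ← rpow_norm_mul_kern s (n + 1)
    (sub_ne_zero.2 hxy), Real.div_rpow (abs_nonneg _) norm_pos.le, Real.rpow_add norm_pos,
    Real.rpow_one]
  field_simp

lemma incrementWeight_mul_norm_eq (hxy : x ≠ y) :
    incrementWeight s₁ s n u h (x, y) * ‖x - y‖ = 2 * kern (-(1 - s₁)) (x - y) +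
      (absSlope u (x + h) (y + h) ^ n + absSlope u x y ^ n) * kern (-(n + 1 - s)) (x - y) := by
  have sign_term : ‖x - y‖ * kern s₁ (x - y) = kern (-(1 - s₁)) (x - y) := by
    simpa only [Real.rpow_one, neg_sub] using rpow_norm_mul_kern s₁ 1 (sub_ne_zero.2 hxy)
  have shifted_term := abs_sub_rpow_mul_kern_mul_norm_eq (u := u) (n := n) (s := s) hxy h
  have power_term := abs_sub_rpow_mul_kern_mul_norm_eq (u := u) (n := n) (s := s) hxy 0
  simp only [add_zero] at power_term
  rw [incrementWeight, ← sign_term, add_mul (absSlope u _ _ ^ n), ← shifted_term, ← power_term]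
  ring

lemma incrementWeight_mul_abs_increment_rpow_mul_norm_le (hn : 1 ≤ n) (hm : 1 ≤ m) (hh0 : h ≠ 0) :
    incrementWeight s₁ s n u h (x, y) * |u (x + h) - u x| ^ m * ‖x - y‖ ≤ ‖h‖ ^ m *
      (2 * ((1 + absSlope u (x + h) x ^ (n + m)) * kern (-(1 - s₁)) (x - y)) +
        (absSlope u (x + h) (y + h) ^ (n + m) * kern (-(n + 1 - s)) (x - y) +
        (absSlope u x y ^ (n + m) * kern (-(n + 1 - s)) (x - y) +
        2 * ((1 + absSlope u (x + h) x ^ (n + m)) * kern (-(n + 1 - s)) (x - y))))) := by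
  have hn0 : 0 ≤ n := by linarith
  have hm0 : 0 ≤ m := by linarith
  have k₁ := kern_nonneg (-(1 - s₁)) (x - y)
  have k := kern_nonneg (-(n + 1 - s)) (x - y)
  have hY := absSlope_nonneg u (x + h) x
  have hQ := absSlope_nonneg u x y
  have hQ' := absSlope_nonneg u (x + h) (y + h)
  rcases eq_or_ne x y with rfl | hxy
  · rw [sub_self, norm_zero, mul_zero]
    rw [sub_self] at k₁ k
    positivity
  have young_one := rpow_mul_rpow_le_add zero_le_one hY hn0 hm0
  rw [Real.one_rpow, Real.one_rpow, one_mul] at young_one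
  have young {Q : ℝ} (hQ : 0 ≤ Q) := rpow_mul_rpow_le_add hQ hY hn0 hm0
  set Y := absSlope u (x + h) x
  calc
    _ = ‖h‖ ^ m * ((incrementWeight s₁ s n u h (x, y) * ‖x - y‖) * Y ^ m) := by
      rw [abs_increment_eq_mul_absSlope hh0, Real.mul_rpow (norm_nonneg h) hY]
      ring
    _ = ‖h‖ ^ m * (2 * (Y ^ m * kern (-(1 - s₁)) (x - y)) +
        (absSlope u (x + h) (y + h) ^ n * Y ^ m + absSlope u x y ^ n * Y ^ m) *
          kern (-(n + 1 - s)) (x - y)) := by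
      rw [incrementWeight_mul_norm_eq hxy]
      ring
    _ ≤ ‖h‖ ^ m * (2 * ((1 + Y ^ (n + m)) * kern (-(1 - s₁)) (x - y)) +
        ((absSlope u (x + h) (y + h) ^ (n + m) + (1 + Y ^ (n + m))) +
          (absSlope u x y ^ (n + m) + (1 + Y ^ (n + m)))) * kern (-(n + 1 - s)) (x - y)) := by
      gcongr
      · linarith [young hQ']
      · linarith [young hQ]
    _ = _ := by ring

lemma ofReal_nearError_le (hn : 1 ≤ n) (hm : 1 ≤ m) (hδ : 0 < δ) (hh0 : h ≠ 0) {B : Set (E N)}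
    {z : E N × E N} (hz : z ∈ B ×ˢ B) :
    ENNReal.ofReal (nearError s₁ s n m δ u h B z) ≤ ENNReal.ofReal (‖h‖ ^ m * δ⁻¹) *
      (2 * ENNReal.ofReal ((1 + absSlope u (z.1 + h) z.1 ^ (n + m)) *
          kern (-(1 - s₁)) (z.1 - z.2)) +
        (ENNReal.ofReal (absSlope u (z.1 + h) (z.2 + h) ^ (n + m) *
          kern (-(n + 1 - s)) (z.1 - z.2)) +
        (ENNReal.ofReal (absSlope u z.1 z.2 ^ (n + m) * kern (-(n + 1 - s)) (z.1 - z.2)) +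
        2 * ENNReal.ofReal ((1 + absSlope u (z.1 + h) z.1 ^ (n + m)) *
          kern (-(n + 1 - s)) (z.1 - z.2))))) := by
  have pointwise := mul_le_mul_of_nonneg_right (incrementWeight_mul_abs_increment_rpow_mul_norm_le
    (s₁ := s₁) (s := s) (u := u) (x := z.1) (y := z.2) hn hm hh0) (inv_nonneg.2 hδ.le)
  rw [mul_right_comm (‖h‖ ^ m)] at pointwise
  rw [nearError, indicator_of_mem hz, div_eq_mul_inv, ← mul_assoc]
  refine (ENNReal.ofReal_le_ofReal pointwise).trans ?_
  rw [ENNReal.ofReal_mul (by positivity)]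
  simp only [← ENNReal.ofReal_ofNat 2, ← ENNReal.ofReal_mul zero_le_two]
  gcongr
  refine ENNReal.ofReal_add_le.trans (add_le_add_right ?_ _)
  exact ENNReal.ofReal_add_le.trans (add_le_add_right ENNReal.ofReal_add_le _)

lemma lintegral_ofReal_nearError (B : Set (E N)) :
    ∫⁻ z, ENNReal.ofReal (nearError s₁ s n m δ u h B z) =
      ∫⁻ z in B ×ˢ B, ENNReal.ofReal (nearError s₁ s n m δ u h B z) := by
  refine (setLIntegral_eq_of_support_subset fun z hz => ?_).symm
  by_contra hzB
  exact hz (by simp only [nearError, indicator_of_notMem hzB, ENNReal.ofReal_zero])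

lemma aemeasurable_one_add_absSlope_rpow_mul_kern (hu : AEStronglyMeasurable u) (q κ : ℝ)
    (h : E N) : AEMeasurable fun z : E N × E N =>
      ENNReal.ofReal ((1 + absSlope u (z.1 + h) z.1 ^ q) * kern κ (z.1 - z.2)) := by
  have fst_meas : AEMeasurable fun z : E N × E N => 1 + absSlope u (z.1 + h) z.1 ^ q :=
    (((aemeasurable_absSlope_add_right hu h).pow_const q).const_add 1).comp_quasiMeasurePreserving
      Measure.quasiMeasurePreserving_fst
  exact (fst_meas.mul (by fun_prop)).ennreal_ofReal

lemma lintegral_nearError_le (hN : 1 ≤ N) (hs₁ : s₁ < 1) (hs : s < n + 1) (hn : 1 ≤ n)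
    (hm : 1 ≤ m) (hδ : 0 < δ) (hρR : ρ + δ < R) (hR : R ≤ 1) (hu : LocallyIntegrable u)
    (hG : IsWeakGradient Ω u G) (hΩ : closedBall x₀ R ⊆ Ω) (hh : ‖h‖ ≤ δ) (hh0 : h ≠ 0) :
    ∫⁻ z, ENNReal.ofReal (nearError s₁ s n m δ u h (ball x₀ ρ) z) ≤
      ENNReal.ofReal (‖h‖ ^ m * δ⁻¹) *
      ((2 * nearConst N (1 - s₁) + 4 * nearConst N (n + 1 - s)) *
        (unitVol N + ∫⁻ x in ball x₀ R, ‖G x‖ₑ ^ (n + m))) := by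
  have hum := hu.aestronglyMeasurable
  have hq : 1 ≤ n + m := by linarith
  have prod_meas : MeasurableSet (ball x₀ ρ ×ˢ ball x₀ ρ) :=
    measurableSet_ball.prod measurableSet_ball
  have slope_meas := aemeasurable_absSlope_rpow_mul_kern hum (n + m) (-(n + 1 - s))
  have translate_meas := slope_meas.comp_quasiMeasurePreserving
    (measurePreserving_prod_translate h).quasiMeasurePreserving
  simp only [Function.comp_def, add_sub_add_right_eq_sub] at translate_meas
  rw [lintegral_ofReal_nearError]
  refine (setLIntegral_mono' prod_meas fun z hz => ofReal_nearError_le hn hm hδ hh0 hz).trans ?_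
  rw [lintegral_const_mul' _ _ ENNReal.ofReal_ne_top, lintegral_add_left'
    ((aemeasurable_one_add_absSlope_rpow_mul_kern hum _ _ h).const_mul 2).restrict,
    lintegral_add_left' translate_meas.restrict, lintegral_add_left' slope_meas.restrict,
    lintegral_const_mul' _ _ ENNReal.ofNat_ne_top, lintegral_const_mul' _ _ ENNReal.ofNat_ne_top]
  gcongr ENNReal.ofReal _ * ?_
  set Λ := ∫⁻ x in ball x₀ R, ‖G x‖ₑ ^ (n + m)
  calc
    _ ≤ 2 * (nearConst N (1 - s₁) * (unitVol N + Λ)) + (nearConst N (n + 1 - s) * Λ +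
        (nearConst N (n + 1 - s) * Λ + 2 * (nearConst N (n + 1 - s) * (unitVol N + Λ)))) := by
      gcongr
      · exact setLIntegral_one_add_absSlope_rpow_mul_kern_le hN (by linarith) hq hδ.le hρR hR hu hG
          hΩ hh
      · exact setLIntegral_absSlope_translate_rpow_mul_kern_le hq hρR hR hu hG hΩ hh
      · exact setLIntegral_absSlope_rpow_mul_kern_le hq (by linarith) hR hu hG hΩ
      · exact setLIntegral_one_add_absSlope_rpow_mul_kern_le hN (by linarith) hq hδ.le hρR hR hu hG
          hΩ hh
    _ ≤ 2 * (nearConst N (1 - s₁) * (unitVol N + Λ)) + (nearConst N (n + 1 - s) * (unitVol N + Λ) +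
        (nearConst N (n + 1 - s) * (unitVol N + Λ) +
          2 * (nearConst N (n + 1 - s) * (unitVol N + Λ)))) := by
      gcongr <;> exact le_add_self
    _ = _ := by ring

lemma ofReal_farError_le {B : Set (E N)} (z : E N × E N) :
    ENNReal.ofReal (farError s₁ s n m δ u h B z) ≤
      {z : E N × E N | δ ≤ ‖z.1 - z.2‖}.indicator (fun z =>
        2 * (B.indicator (fun x => ENNReal.ofReal (|u (x + h) - u x| ^ m)) z.1 *
          ENNReal.ofReal (kern s₁ (z.1 - z.2))) +
        (B.indicator (fun x => ENNReal.ofReal (|u (x + h) - u x| ^ m)) z.1 *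
          ENNReal.ofReal (|u (z.1 + h) - u (z.2 + h)| ^ n * kern s (z.1 - z.2)) +
        B.indicator (fun x => ENNReal.ofReal (|u (x + h) - u x| ^ m)) z.1 *
          ENNReal.ofReal (|u (z.1 + 0) - u (z.2 + 0)| ^ n * kern s (z.1 - z.2)))) z := by
  by_cases hz : z ∈ {z : E N × E N | δ ≤ ‖z.1 - z.2‖}
  · rw [farError, indicator_of_mem hz, indicator_of_mem hz]
    by_cases hx : z.1 ∈ B
    · simp only [indicator_of_mem hx, add_zero]
      rw [ENNReal.ofReal_mul (by positivity), mul_left_comm 2, ← mul_add, ← mul_add,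
        incrementWeight, add_mul]
      simp only [← ENNReal.ofReal_ofNat 2, ← ENNReal.ofReal_mul zero_le_two]
      refine mul_le_mul_right ?_ _
      exact ENNReal.ofReal_add_le.trans (add_le_add_right ENNReal.ofReal_add_le _)
    · simp [hx]
  · rw [farError, indicator_of_notMem hz, ENNReal.ofReal_zero]
    exact zero_le

lemma lintegral_farError_le_mul (hs₁ : 0 < s₁) (hs : 0 < s) (hn : 1 ≤ n) (hδ : 0 < δ) (hρ : 0 ≤ ρ)
    (hρR : ρ + 2 * δ ≤ R) (hR : R ≤ 1) (hum : AEStronglyMeasurable u)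
    (hu : ∀ᵐ y, y ∈ ball x₀ R → |u y| ≤ M) (hh : ‖h‖ ≤ δ) :
    ∫⁻ z, ENNReal.ofReal (farError s₁ s n m δ u h (ball x₀ ρ) z) ≤
      2 * (ENNReal.ofReal ((δ / 2) ^ (-((N : ℝ) + s₁))) * farConst N s₁ +
        tailBound s n δ M u x₀ R) * ∫⁻ x in ball x₀ ρ, ENNReal.ofReal (|u (x + h) - u x| ^ m) := by
  set F : E N → ℝ≥0∞ := (ball x₀ ρ).indicator fun x => ENNReal.ofReal (|u (x + h) - u x| ^ m)
  have F_meas : AEMeasurable F :=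
    (aemeasurable_abs_increment_rpow hum h m).ennreal_ofReal.indicator measurableSet_ball
  have F_fst_meas : AEMeasurable fun z : E N × E N => F z.1 :=
    F_meas.comp_quasiMeasurePreserving Measure.quasiMeasurePreserving_fst
  have sign_meas : AEMeasurable fun z : E N × E N => F z.1 * ENNReal.ofReal (kern s₁ (z.1 - z.2)) :=
    F_fst_meas.mul (by fun_prop)
  have power_meas (h : E N) : AEMeasurable fun z : E N × E N =>
      F z.1 * ENNReal.ofReal (|u (z.1 + h) - u (z.2 + h)| ^ n * kern s (z.1 - z.2)) := by
    have translate_meas : AEStronglyMeasurable fun x => u (x + h) :=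
      hum.comp_measurePreserving (measurePreserving_add_right volume h)
    exact F_fst_meas.mul (aemeasurable_gagliardoDensity translate_meas n s)
  have power_le {h : E N} (hh : ‖h‖ ≤ δ) := setLIntegral_mul_far_translate_le (ρ := ρ + δ) (h := h)
    hs hn hδ (by linarith) (by linarith) hR hum hu F_meas
    fun x hx => add_mem_ball_of_norm_le (mem_of_indicator_ne_zero hx) hh le_rfl
  calc
    _ ≤ ∫⁻ z in {z : E N × E N | δ ≤ ‖z.1 - z.2‖},
        (2 * (F z.1 * ENNReal.ofReal (kern s₁ (z.1 - z.2))) +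
        (F z.1 * ENNReal.ofReal (|u (z.1 + h) - u (z.2 + h)| ^ n * kern s (z.1 - z.2)) +
        F z.1 * ENNReal.ofReal (|u (z.1 + 0) - u (z.2 + 0)| ^ n * kern s (z.1 - z.2)))) := by
      rw [← lintegral_indicator (measurableSet_far δ)]
      exact lintegral_mono fun z => ofReal_farError_le z
    _ ≤ 2 * (ENNReal.ofReal ((δ / 2) ^ (-((N : ℝ) + s₁))) * farConst N s₁ * ∫⁻ x, F x) +
        (tailBound s n δ M u x₀ R * (∫⁻ x, F x) + tailBound s n δ M u x₀ R * ∫⁻ x, F x) := by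
      rw [lintegral_add_left' (sign_meas.const_mul 2).restrict,
        lintegral_add_left' (power_meas h).restrict, lintegral_const_mul' _ _ ENNReal.ofNat_ne_top]
      gcongr
      · exact setLIntegral_mul_kern_far_le hs₁ hδ (by linarith) F
      · exact power_le hh
      · exact power_le (by simpa only [norm_zero] using hδ.le)
    _ = _ := by
      rw [lintegral_indicator measurableSet_ball]
      ring

lemma rpow_mul_setLIntegral_abs_increment_rpow_le (hn : 1 ≤ n) (hm : 1 ≤ m) (hδ : 0 ≤ δ)
    (hρR : ρ + δ < R) (hR : R ≤ 1) (hu : LocallyIntegrable u) (hG : IsWeakGradient Ω u G)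
    (hΩ : closedBall x₀ R ⊆ Ω) (hh : ‖h‖ ≤ δ) (hh0 : h ≠ 0) (S : ℝ≥0∞) :
    S ^ n * ∫⁻ x in ball x₀ ρ, ENNReal.ofReal (|u (x + h) - u x| ^ m) ≤
      ENNReal.ofReal (‖h‖ ^ m) *
        (S ^ (n + m) * unitVol N + ∫⁻ x in ball x₀ R, ‖G x‖ₑ ^ (n + m)) := by
  have increment_eq (x : E N) : ENNReal.ofReal (|u (x + h) - u x| ^ m) =
      ENNReal.ofReal (‖h‖ ^ m) * ENNReal.ofReal (absSlope u (x + h) x) ^ m := by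
    rw [abs_increment_eq_mul_absSlope hh0, Real.mul_rpow (norm_nonneg h) (absSlope_nonneg u _ _),
      ENNReal.ofReal_mul (by positivity),
      ENNReal.ofReal_rpow_of_nonneg (absSlope_nonneg u _ _) (by linarith)]
  simp only [increment_eq]
  rw [lintegral_const_mul' _ _ ENNReal.ofReal_ne_top, mul_left_comm]
  refine mul_le_mul_right ?_ _
  calc
    _ ≤ ∫⁻ x in ball x₀ ρ, S ^ n * ENNReal.ofReal (absSlope u (x + h) x) ^ m :=
      lintegral_const_mul_le _ _
    _ ≤ ∫⁻ x in ball x₀ ρ, (S ^ (n + m) + ENNReal.ofReal (absSlope u (x + h) x) ^ (n + m)) :=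
      lintegral_mono fun x => ennreal_rpow_mul_rpow_le_add _ _ (by linarith) (by linarith)
    _ ≤ _ := by
      rw [lintegral_add_left measurable_const, setLIntegral_const]
      simp only [ENNReal.ofReal_rpow_of_nonneg (absSlope_nonneg u _ _) (by linarith : 0 ≤ n + m)]
      exact add_le_add (mul_le_mul_right (volume_ball_le_unitVol (by linarith)) _)
        (setLIntegral_ball_absSlope_rpow_le (by linarith) hδ hρR hu hG hΩ hh)

lemma tailBound_le (hδ : 0 < δ) {T : ℝ≥0∞} (hT : ENNReal.ofReal (M ^ n) + tailInt s n u x₀ R ≤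
      2 * ENNReal.ofReal (δ ^ (-s)) * T ^ n) :
    tailBound s n δ M u x₀ R ≤
      2 * tailConst N s n * ENNReal.ofReal (δ ^ (-((N : ℝ) + 2 * s))) * T ^ n := by
  have exponent : δ ^ (-((N : ℝ) + 2 * s)) = δ ^ (-((N : ℝ) + s)) * δ ^ (-s) := by
    rw [← Real.rpow_add hδ]
    ring_nf
  rw [tailBound, exponent, ENNReal.ofReal_mul (by positivity)]
  refine (mul_le_mul_right hT _).trans_eq ?_
  ring

lemma lintegral_farError_le (hs₁ : 0 < s₁) (hs : 0 < s) (hn : 1 ≤ n) (hm : 1 ≤ m) (hδ : 0 < δ)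
    (hρ : 0 ≤ ρ) (hρR : ρ + 2 * δ ≤ R) (hR : R ≤ 1) (hu : LocallyIntegrable u)
    (hG : IsWeakGradient Ω u G) (hΩ : closedBall x₀ R ⊆ Ω)
    (huM : ∀ᵐ y, y ∈ ball x₀ R → |u y| ≤ M) {T : ℝ≥0∞}
    (hT : ENNReal.ofReal (M ^ n) + tailInt s n u x₀ R ≤ 2 * ENNReal.ofReal (δ ^ (-s)) * T ^ n)
    (hh : ‖h‖ ≤ δ) (hh0 : h ≠ 0) :
    ∫⁻ z, ENNReal.ofReal (farError s₁ s n m δ u h (ball x₀ ρ) z) ≤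
      ENNReal.ofReal (‖h‖ ^ m) *
      (2 * ENNReal.ofReal (2 ^ ((N : ℝ) + s₁)) * farConst N s₁ *
        ENNReal.ofReal (δ ^ (-((N : ℝ) + s₁))) *
        (unitVol N + ∫⁻ x in ball x₀ R, ‖G x‖ₑ ^ (n + m)) +
      4 * tailConst N s n * ENNReal.ofReal (δ ^ (-((N : ℝ) + 2 * s))) *
        (T ^ (n + m) * unitVol N + ∫⁻ x in ball x₀ R, ‖G x‖ₑ ^ (n + m))) := by
  have young := rpow_mul_setLIntegral_abs_increment_rpow_le hn hm hδ.le (by linarith : ρ + δ < R) hR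
    hu hG hΩ hh hh0
  have young_one := young 1
  rw [ENNReal.one_rpow, ENNReal.one_rpow, one_mul, one_mul] at young_one
  refine (lintegral_farError_le_mul hs₁ hs hn hδ hρ hρR hR hu.aestronglyMeasurable huM hh).trans ?_
  rw [Real.div_rpow hδ.le zero_le_two, Real.rpow_neg zero_le_two, div_inv_eq_mul,
    ENNReal.ofReal_mul (by positivity)]
  set I := ∫⁻ x in ball x₀ ρ, ENNReal.ofReal (|u (x + h) - u x| ^ m)
  set d₁ := ENNReal.ofReal (δ ^ (-((N : ℝ) + s₁)))
  set d := ENNReal.ofReal (δ ^ (-((N : ℝ) + 2 * s)))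
  calc
    _ ≤ 2 * (d₁ * ENNReal.ofReal (2 ^ ((N : ℝ) + s₁)) * farConst N s₁ +
        2 * tailConst N s n * d * T ^ n) * I := by
      gcongr
      exact tailBound_le hδ hT
    _ = 2 * ENNReal.ofReal (2 ^ ((N : ℝ) + s₁)) * farConst N s₁ * d₁ * I +
        4 * tailConst N s n * d * (T ^ n * I) := by ring
    _ ≤ 2 * ENNReal.ofReal (2 ^ ((N : ℝ) + s₁)) * farConst N s₁ * d₁ * _ +
        4 * tailConst N s n * d * _ := add_le_add (mul_le_mul_right young_one _)
      (mul_le_mul_right (young T) _)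
    _ = _ := by ring

/-- The constant in the bound for the sum of the near and the far error. -/
noncomputable def errorConst (N : ℕ) (s₁ s n : ℝ) : ℝ≥0∞ :=
  (2 * nearConst N (1 - s₁) + 4 * nearConst N (n + 1 - s) +
    2 * ENNReal.ofReal (2 ^ ((N : ℝ) + s₁)) * farConst N s₁ + 4 * tailConst N s n) *
    (unitVol N + 1)

lemma errorConst_ne_top (hN : 1 ≤ N) (hs₁ : 0 < s₁) (hs₁' : s₁ < 1) (hs : 0 < s)
    (hs' : s < n + 1) : errorConst N s₁ s n ≠ ∞ := by
  have := nearConst_ne_top hN (show 0 < 1 - s₁ by linarith)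
  have := nearConst_ne_top hN (show 0 < n + 1 - s by linarith)
  have := farConst_ne_top (N := N) hs₁
  have := tailConst_ne_top (N := N) n hs
  have := unitVol_ne_top (N := N)
  unfold errorConst
  finiteness

lemma lintegral_nearError_add_lintegral_farError_le (hN : 1 ≤ N) (hs₁ : 0 < s₁) (hs₁' : s₁ < 1)
    (hs : 0 < s) (hs' : s < n + 1) (hn : 1 ≤ n) (hm : 1 ≤ m) (hδ : 0 < δ) (hρ : 0 ≤ ρ)
    (hρR : ρ + 3 * δ ≤ R) (hR : R ≤ 1) (hu : LocallyIntegrable u) (hG : IsWeakGradient Ω u G)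
    (hΩ : closedBall x₀ R ⊆ Ω) (huM : ∀ᵐ y, y ∈ ball x₀ R → |u y| ≤ M) {T : ℝ≥0∞}
    (hT : ENNReal.ofReal (M ^ n) + tailInt s n u x₀ R ≤ 2 * ENNReal.ofReal (δ ^ (-s)) * T ^ n)
    (hh : ‖h‖ ≤ δ) (hh0 : h ≠ 0) :
    (∫⁻ z, ENNReal.ofReal (nearError s₁ s n m δ u h (ball x₀ (ρ + δ)) z)) +
      ∫⁻ z, ENNReal.ofReal (farError s₁ s n m δ u h (ball x₀ ρ) z) ≤
    errorConst N s₁ s n * ENNReal.ofReal (‖h‖ ^ m) *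
      ENNReal.ofReal (δ ^ (-((N : ℝ) + 2 * (n + m)))) *
      (1 + T ^ (n + m) + ∫⁻ x in ball x₀ R, ‖G x‖ₑ ^ (n + m)) := by
  have near_le := lintegral_nearError_le hN hs₁' hs' hn hm hδ (by linarith : ρ + δ + δ < R) hR hu
    hG hΩ hh hh0
  have far_le := lintegral_farError_le hs₁ hs hn hm hδ hρ (by linarith) hR hu hG hΩ huM hT hh hh0
  set Λ := ∫⁻ x in ball x₀ R, ‖G x‖ₑ ^ (n + m)
  set d := ENNReal.ofReal (δ ^ (-((N : ℝ) + 2 * (n + m))))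
  set c := ENNReal.ofReal (‖h‖ ^ m)
  set Θ := (unitVol N + 1) * (1 + T ^ (n + m) + Λ) with hΘ
  have le_d {a : ℝ} (ha : -((N : ℝ) + 2 * (n + m)) ≤ a) : ENNReal.ofReal (δ ^ a) ≤ d :=
    ENNReal.ofReal_le_ofReal (Real.rpow_le_rpow_of_exponent_ge hδ (by linarith) ha)
  have vol_le : unitVol N + Λ ≤ Θ := calc
    _ ≤ unitVol N + Λ + (unitVol N * T ^ (n + m) + unitVol N * Λ + 1 + T ^ (n + m)) := le_self_add
    _ = Θ := by ring
  have tail_le : T ^ (n + m) * unitVol N + Λ ≤ Θ := calc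
    _ ≤ T ^ (n + m) * unitVol N + Λ + (unitVol N + unitVol N * Λ + 1 + T ^ (n + m)) := le_self_add
    _ = Θ := by ring
  rw [ENNReal.ofReal_mul (by positivity), ← Real.rpow_neg_one] at near_le
  calc
    _ ≤ c * d * ((2 * nearConst N (1 - s₁) + 4 * nearConst N (n + 1 - s)) * Θ) +
        c * (2 * ENNReal.ofReal (2 ^ ((N : ℝ) + s₁)) * farConst N s₁ * d * Θ +
          4 * tailConst N s n * d * Θ) := by
      have : (0 : ℝ) ≤ N := N.cast_nonneg
      refine add_le_add (near_le.trans ?_) (far_le.trans ?_)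
      · gcongr
        exact le_d (by linarith)
      · gcongr <;> exact le_d (by linarith)
    _ = _ := by
      rw [errorConst, hΘ]
      ring

/-- The constant in the energy estimate. -/
noncomputable def energyConst (N : ℕ) (s₁ s n m : ℝ) : ℝ≥0∞ :=
  ENNReal.ofReal (2 ^ ((n + m) - 2)) * 2 * errorConst N s₁ s n

lemma energyConst_ne_top (hN : 1 ≤ N) (hs₁ : 0 < s₁) (hs₁' : s₁ < 1) (hs : 0 < s)
    (hs' : s < n + 1) : energyConst N s₁ s n m ≠ ∞ := by
  have := errorConst_ne_top hN hs₁ hs₁' hs hs'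
  unfold energyConst
  finiteness

lemma lintegral_increment_energy_le (hN : 1 ≤ N) (hs₁ : 0 < s₁) (hs₁' : s₁ < 1) (hsp : 0 < sp)
    (hsp' : sp < 1) (hn : 1 ≤ n) (hm : 1 ≤ m) (hδ : 0 < δ) (hρ : 0 < ρ) (hρR : ρ + 3 * δ ≤ R)
    (hR : R ≤ 1) (hu : LocallyIntegrable u) (hG : IsWeakGradient Ω u G)
    (hsol : IsWeakSolution s₁ sp (n + 1) Ω u) (hΩ : closedBall x₀ R ⊆ Ω) (hM : 0 ≤ M)
    (huM : ∀ᵐ y, y ∈ ball x₀ R → |u y| ≤ M) {T : ℝ≥0∞}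
    (hT : ENNReal.ofReal (M ^ n) + tailInt (sp * (n + 1)) n u x₀ R ≤
      2 * ENNReal.ofReal (δ ^ (-(sp * (n + 1)))) * T ^ n) (hh : ‖h‖ ≤ δ) :
    ∫⁻ z in ball x₀ (ρ - δ) ×ˢ ball x₀ (ρ - δ),
      gagliardoDensity (n + m) (sp * (n + 1)) (fun x => u (x + h) - u x) z.1 z.2 ≤
    energyConst N s₁ (sp * (n + 1)) n m * ENNReal.ofReal (‖h‖ ^ m) *
      (ENNReal.ofReal (δ ^ (-((N : ℝ) + 2 * (n + m)))) *
      (1 + T ^ (n + m) + ∫⁻ x in ball x₀ R, ‖G x‖ₑ ^ (n + m))) := by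
  rcases eq_or_ne h 0 with rfl | hh0
  · simp [gagliardoDensity, Real.zero_rpow (by linarith : n + m ≠ 0)]
  have hs : 0 < sp * (n + 1) := by positivity
  have hs' : sp * (n + 1) < n + 1 := mul_lt_of_lt_one_left (by linarith) hsp'
  have energy_le := lintegral_increment_energy_le_error hN hs₁ hs₁' hsp hsp' hn hm hδ hρ
    (by linarith) hR hu.aestronglyMeasurable hsol hΩ hM huM hh
  have error_le := lintegral_nearError_add_lintegral_farError_le hN hs₁ hs₁' hs hs' hn hm hδ hρ.le
    hρR hR hu hG hΩ huM hT hh hh0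
  have two_rpow_mul :
      ENNReal.ofReal (2 ^ ((n + m) - 2)) * ENNReal.ofReal (2 ^ (2 - (n + m))) = 1 := by
    rw [← ENNReal.ofReal_mul (by positivity), ← Real.rpow_add two_pos]
    simp
  simp only [ENNReal.ofReal_mul (by positivity : (0 : ℝ) ≤ 2 ^ (2 - (n + m)))] at energy_le
  rw [lintegral_const_mul' _ _ ENNReal.ofReal_ne_top] at energy_le
  calc
    _ = ENNReal.ofReal (2 ^ ((n + m) - 2)) * (ENNReal.ofReal (2 ^ (2 - (n + m))) * _) := by
      simp only [gagliardoDensity, Real.norm_eq_abs]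
      rw [← mul_assoc, two_rpow_mul, one_mul]
    _ ≤ ENNReal.ofReal (2 ^ ((n + m) - 2)) * (2 * _) :=
      mul_le_mul_right (energy_le.trans (mul_le_mul_right error_le 2)) _
    _ = _ := by
      rw [energyConst]
      ring

end EnergyEstimate

/-! ### Second differences -/

section GagliardoIncrements

variable {N : ℕ} {F : Type*} [NormedAddCommGroup F] {q s r δ ρ : ℝ} {w : E N → F}
  {x₀ x y k : E N}

lemma unitVol_ne_zero : unitVol N ≠ 0 := (measure_ball_pos volume (0 : E N) one_pos).ne'

lemma volume_ball_eq_rpow_mul_unitVol (x : E N) (hr : 0 < r) :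
    volume (ball x r) = ENNReal.ofReal (r ^ (N : ℝ)) * unitVol N := by
  rw [Measure.addHaar_ball_of_pos volume x hr, unitVol, finrank_euclideanSpace, Fintype.card_fin,
    Real.rpow_natCast]

lemma aemeasurable_gagliardoDensity_right (hw : AEStronglyMeasurable w) (q s : ℝ) (x : E N) :
    AEMeasurable (gagliardoDensity q s w x) := by
  have diff_meas : AEStronglyMeasurable fun y => w x - w y := aestronglyMeasurable_const.sub hw
  exact ((diff_meas.norm.aemeasurable.pow_const q).mul (by fun_prop)).ennreal_ofReal

lemma norm_sub_rpow_le_rpow_mul_kern (hq : 0 < q) (hs : 0 ≤ s) (hxy : ‖x - y‖ ≤ r) :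
    ‖w x - w y‖ ^ q ≤ r ^ ((N : ℝ) + s) * (‖w x - w y‖ ^ q * kern s (x - y)) := by
  rcases eq_or_ne x y with rfl | hne
  · simp [hq.ne']
  have norm_pos : 0 < ‖x - y‖ := norm_sub_pos_iff.2 hne
  have one_le : 1 ≤ r ^ ((N : ℝ) + s) * kern s (x - y) := by
    rw [kern, Real.rpow_neg norm_pos.le, ← div_eq_mul_inv, one_le_div (by positivity)]
    gcongr
  rw [mul_left_comm]
  exact le_mul_of_one_le_right (by positivity) one_le

lemma enorm_increment_rpow_le (hq : 1 ≤ q) (hs : 0 ≤ s) (hk : ‖k‖ ≤ r) (hxy : ‖x - y‖ ≤ r) :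
    ‖w (x + k) - w x‖ₑ ^ q ≤ ENNReal.ofReal (2 ^ (q - 1) * (2 * r) ^ ((N : ℝ) + s)) *
      (gagliardoDensity q s w (x + k) y + gagliardoDensity q s w x y) := by
  have hr : 0 ≤ r := (norm_nonneg k).trans hk
  have norm_add_le : ‖x + k - y‖ ≤ 2 * r := by
    rw [add_sub_right_comm]
    linarith [norm_add_le (x - y) k]
  have nonneg (x y : E N) : 0 ≤ ‖w x - w y‖ ^ q * kern s (x - y) :=
    mul_nonneg (by positivity) (kern_nonneg _ _)
  rw [gagliardoDensity, gagliardoDensity, ← ENNReal.ofReal_add (nonneg _ _) (nonneg _ _),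
    ← ENNReal.ofReal_mul (by positivity), ← ofReal_norm,
    ENNReal.ofReal_rpow_of_nonneg (norm_nonneg _) (by linarith)]
  apply ENNReal.ofReal_le_ofReal
  calc
    _ ≤ (‖w (x + k) - w y‖ + ‖w x - w y‖) ^ q := by
      gcongr
      simpa only [sub_sub_sub_cancel_right] using norm_sub_le (w (x + k) - w y) (w x - w y)
    _ ≤ 2 ^ (q - 1) * (‖w (x + k) - w y‖ ^ q + ‖w x - w y‖ ^ q) :=
      rpow_add_le_two_rpow_mul hq (norm_nonneg _) (norm_nonneg _)
    _ ≤ 2 ^ (q - 1) * ((2 * r) ^ ((N : ℝ) + s) * _ + (2 * r) ^ ((N : ℝ) + s) * _) := by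
      gcongr
      · exact norm_sub_rpow_le_rpow_mul_kern (by linarith) hs norm_add_le
      · exact norm_sub_rpow_le_rpow_mul_kern (by linarith) hs (by linarith)
    _ = _ := by ring

lemma rpow_mul_unitVol_mul_enorm_increment_rpow_le (hq : 1 ≤ q) (hs : 0 ≤ s) (hr : 0 < r)
    (hk : ‖k‖ ≤ r) (hw : AEStronglyMeasurable w) (hx : ball x r ⊆ ball x₀ ρ) :
    ENNReal.ofReal (r ^ (N : ℝ)) * unitVol N * ‖w (x + k) - w x‖ₑ ^ q ≤
      ENNReal.ofReal (2 ^ (q - 1) * (2 * r) ^ ((N : ℝ) + s)) *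
        ((∫⁻ y in ball x₀ ρ, gagliardoDensity q s w (x + k) y) +
          ∫⁻ y in ball x₀ ρ, gagliardoDensity q s w x y) := by
  calc
    _ = ∫⁻ _ in ball x r, ‖w (x + k) - w x‖ₑ ^ q := by
      rw [setLIntegral_const, volume_ball_eq_rpow_mul_unitVol x hr, mul_comm]
    _ ≤ ∫⁻ y in ball x r, ENNReal.ofReal (2 ^ (q - 1) * (2 * r) ^ ((N : ℝ) + s)) *
        (gagliardoDensity q s w (x + k) y + gagliardoDensity q s w x y) :=
      setLIntegral_mono' measurableSet_ball fun y hy =>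
        enorm_increment_rpow_le hq hs hk (by rw [← dist_eq_norm, dist_comm]; exact hy.le)
    _ ≤ ∫⁻ y in ball x₀ ρ, _ := lintegral_mono_set hx
    _ = _ := by
      rw [lintegral_const_mul' _ _ ENNReal.ofReal_ne_top,
        lintegral_add_right' _ (aemeasurable_gagliardoDensity_right hw q s x).restrict]

lemma rpow_mul_unitVol_mul_lintegral_increment_le (hq : 1 ≤ q) (hs : 0 ≤ s) (hk0 : k ≠ 0)
    (hk : ‖k‖ ≤ δ) (hw : AEStronglyMeasurable w) :
    ENNReal.ofReal (‖k‖ ^ (N : ℝ)) * unitVol N *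
        ∫⁻ x in ball x₀ (ρ - δ), ‖w (x + k) - w x‖ₑ ^ q ≤
      ENNReal.ofReal (2 ^ (q - 1) * (2 * ‖k‖) ^ ((N : ℝ) + s)) *
        (2 * ∫⁻ z in ball x₀ ρ ×ˢ ball x₀ ρ, gagliardoDensity q s w z.1 z.2) := by
  have density_meas : AEMeasurable (fun z : E N × E N => gagliardoDensity q s w z.1 z.2)
      ((volume.restrict (ball x₀ ρ)).prod (volume.restrict (ball x₀ ρ))) := by
    rw [Measure.prod_restrict]
    exact (aemeasurable_gagliardoDensity hw q s).restrict
  have subset : ball x₀ (ρ - δ) ⊆ ball x₀ ρ :=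
    ball_subset_ball (by linarith [norm_nonneg k])
  set P : E N → ℝ≥0∞ := fun x => ∫⁻ y in ball x₀ ρ, gagliardoDensity q s w x y
  have P_meas : AEMeasurable P (volume.restrict (ball x₀ ρ)) := density_meas.lintegral_prod_right'
  have lintegral_P : ∫⁻ x in ball x₀ ρ, P x =
      ∫⁻ z in ball x₀ ρ ×ˢ ball x₀ ρ, gagliardoDensity q s w z.1 z.2 := by
    rw [Measure.volume_eq_prod, ← Measure.prod_restrict, lintegral_prod _ density_meas]
  have pointwise : ∀ x ∈ ball x₀ (ρ - δ), _ := fun x hx =>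
    rpow_mul_unitVol_mul_enorm_increment_rpow_le hq hs (norm_pos_iff.2 hk0) le_rfl hw
      (ball_subset_ball' (by linarith [mem_ball.1 hx]) : ball x ‖k‖ ⊆ ball x₀ ρ)
  rw [← lintegral_const_mul' _ _ (by have := unitVol_ne_top (N := N); finiteness)]
  refine (setLIntegral_mono' measurableSet_ball pointwise).trans ?_
  rw [lintegral_const_mul' _ _ ENNReal.ofReal_ne_top, lintegral_add_right' _
    (P_meas.mono_measure (Measure.restrict_mono subset le_rfl)), ← lintegral_P,
    two_mul (∫⁻ x in _, P x)]
  refine mul_le_mul_right (add_le_add ?_ (lintegral_mono_set subset)) _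
  exact setLIntegral_comp_add_right_le measurableSet_ball measurableSet_ball
    (fun x hx => add_mem_ball_of_norm_le hx hk (by linarith)) P

/-- The constant in the estimate of increments by the Gagliardo seminorm. -/
noncomputable def incrConst (N : ℕ) (q s : ℝ) : ℝ≥0∞ :=
  (unitVol N)⁻¹ * ENNReal.ofReal (2 ^ (q + N + s))

lemma incrConst_ne_top (q s : ℝ) : incrConst N q s ≠ ∞ := by
  have := unitVol_ne_zero (N := N)
  unfold incrConst
  finiteness

lemma lintegral_increment_le_gagliardo (hq : 1 ≤ q) (hs : 0 ≤ s) (hw : AEStronglyMeasurable w)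
    (hk : ‖k‖ ≤ δ) :
    ∫⁻ x in ball x₀ (ρ - δ), ‖w (x + k) - w x‖ₑ ^ q ≤ incrConst N q s * ENNReal.ofReal (‖k‖ ^ s) *
      ∫⁻ z in ball x₀ ρ ×ˢ ball x₀ ρ, gagliardoDensity q s w z.1 z.2 := by
  rcases eq_or_ne k 0 with rfl | hk0
  · simp [show 0 < q by linarith]
  have norm_pos : 0 < ‖k‖ := norm_pos_iff.2 hk0
  have vol_ne_zero : ENNReal.ofReal (‖k‖ ^ (N : ℝ)) * unitVol N ≠ 0 :=
    mul_ne_zero (ENNReal.ofReal_pos.2 (by positivity)).ne' unitVol_ne_zero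
  have vol_ne_top : ENNReal.ofReal (‖k‖ ^ (N : ℝ)) * unitVol N ≠ ∞ :=
    ENNReal.mul_ne_top ENNReal.ofReal_ne_top unitVol_ne_top
  have const_eq : ENNReal.ofReal (2 ^ (q - 1) * (2 * ‖k‖) ^ ((N : ℝ) + s)) * 2 =
      ENNReal.ofReal (2 ^ (q + N + s)) * ENNReal.ofReal (‖k‖ ^ s) *
        ENNReal.ofReal (‖k‖ ^ (N : ℝ)) := by
    have two_eq : (2 : ℝ≥0∞) = ENNReal.ofReal 2 := (ENNReal.ofReal_ofNat 2).symm
    refine (congrArg _ two_eq).trans ?_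
    rw [← ENNReal.ofReal_mul (by positivity), ← ENNReal.ofReal_mul (by positivity),
      ← ENNReal.ofReal_mul (by positivity),
      Real.mul_rpow zero_le_two norm_pos.le, Real.rpow_add norm_pos,
      Real.rpow_sub_one two_ne_zero, add_assoc q, Real.rpow_add two_pos q]
    congr 1
    ring
  rw [← ENNReal.mul_le_mul_iff_right vol_ne_zero vol_ne_top]
  refine (rpow_mul_unitVol_mul_lintegral_increment_le hq hs hk0 hk hw).trans_eq ?_
  rw [← mul_assoc, const_eq, incrConst]
  calc
    _ = (unitVol N * (unitVol N)⁻¹) * _ := by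
      rw [ENNReal.mul_inv_cancel unitVol_ne_zero unitVol_ne_top, one_mul]
    _ = _ := by ring

end GagliardoIncrements

/-- The mixed second difference `Δ_h Δ_k u`. -/
def secondDiff {V : Type*} [AddCommGroup V] (u : V → ℝ) (h k x : V) : ℝ :=
  (u (x + k + h) - u (x + k)) - (u (x + h) - u x)

section Mollification

variable {V : Type*} [NormedAddCommGroup V] [InnerProductSpace ℝ V] [FiniteDimensional ℝ V]
  [MeasurableSpace V] [BorelSpace V] {u f g : V → ℝ}

lemma moll_comp_add (φ : ContDiffBump (0 : V)) (u : V → ℝ) (a x : V) :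
    moll φ (fun y => u (y + a)) x = moll φ u (x + a) := by
  simp only [moll, sub_add_eq_add_sub]

lemma moll_sub (φ : ContDiffBump (0 : V)) (hf : LocallyIntegrable f) (hg : LocallyIntegrable g)
    (x : V) : moll φ (fun y => f y - g y) x = moll φ f x - moll φ g x := by
  simp only [moll, smul_sub]
  exact integral_sub (integrable_normed_smul φ hf x) (integrable_normed_smul φ hg x)

lemma locallyIntegrable_comp_add_right (hu : LocallyIntegrable u) (a : V) :
    LocallyIntegrable fun x => u (x + a) := by
  intro x
  obtain ⟨s, hs, hus⟩ := hu (x + a)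
  exact ⟨(· + a) ⁻¹' s, (continuous_add_const a).continuousAt.preimage_mem_nhds hs,
    ((measurePreserving_add_right volume a).integrableOn_comp_preimage
      (MeasurableEquiv.addRight a).measurableEmbedding).2 hus⟩

lemma secondDiff_moll (φ : ContDiffBump (0 : V)) (hu : LocallyIntegrable u) (h k : V) :
    secondDiff (moll φ u) h k = moll φ (secondDiff u h k) := by
  ext x
  have shift (a : V) := locallyIntegrable_comp_add_right hu a
  unfold secondDiff
  simp only [add_assoc]
  rw [moll_sub φ (f := fun y => u (y + (k + h)) - u (y + k)) (g := fun y => u (y + h) - u y)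
      ((shift (k + h)).sub (shift k)) ((shift h).sub hu),
    moll_sub φ (shift _) (shift k), moll_sub φ (shift h) hu]
  simp only [moll_comp_add]

lemma aestronglyMeasurable_secondDiff (hu : AEStronglyMeasurable u) (h k : V) :
    AEStronglyMeasurable (secondDiff u h k) := by
  have shift_meas (a : V) := measurePreserving_add_right volume a
  have increment_meas : AEStronglyMeasurable fun x => u (x + h) - u x :=
    (hu.comp_measurePreserving (shift_meas h)).sub hu
  exact (increment_meas.comp_measurePreserving (shift_meas k)).sub increment_meas

end Mollification

section Taylor

variable {V : Type*} [NormedAddCommGroup V] [NormedSpace ℝ V] {U : V → ℝ} {β δ : ℝ} {h : V}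

/-- The constant in the first order Taylor expansion: the sum of the geometric series with ratio
`2 ^ (-β)`. -/
noncomputable def taylorConst (β : ℝ) : ℝ≥0∞ := (1 - ENNReal.ofReal (2 ^ (-β)))⁻¹

lemma taylorConst_ne_top (hβ : 0 < β) : taylorConst β ≠ ∞ := by
  have ratio_lt_one : ENNReal.ofReal (2 ^ (-β)) < 1 :=
    ENNReal.ofReal_lt_one.2 (Real.rpow_lt_one_of_one_lt_of_neg one_lt_two (by linarith))
  exact ENNReal.inv_ne_top.2 (tsub_pos_of_lt ratio_lt_one).ne'

/-- The difference quotient of `U` in direction `h` with step `2⁻ⁿ`. -/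
noncomputable def dyadicDiff (U : V → ℝ) (h : V) (n : ℕ) (x : V) : ℝ :=
  2 ^ n * (U (x + ((2 : ℝ) ^ n)⁻¹ • h) - U x)

lemma continuous_dyadicDiff (hU : Continuous U) (h : V) (n : ℕ) :
    Continuous (dyadicDiff U h n) := by
  unfold dyadicDiff
  fun_prop

lemma dyadicDiff_zero (x : V) : dyadicDiff U h 0 x = U (x + h) - U x := by simp [dyadicDiff]

lemma dyadicDiff_sub_succ (U : V → ℝ) (h : V) (n : ℕ) :
    dyadicDiff U h n - dyadicDiff U h (n + 1) = (2 : ℝ) ^ n •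
      secondDiff U (((2 : ℝ) ^ (n + 1))⁻¹ • h) (((2 : ℝ) ^ (n + 1))⁻¹ • h) := by
  ext x
  have halves : ((2 : ℝ) ^ n)⁻¹ • h =
      ((2 : ℝ) ^ (n + 1))⁻¹ • h + ((2 : ℝ) ^ (n + 1))⁻¹ • h := by
    rw [← add_smul]
    ring_nf
  simp only [dyadicDiff, secondDiff, Pi.sub_apply, Pi.smul_apply, smul_eq_mul, halves, add_assoc]
  ring

lemma tendsto_dyadicDiff {L : V →L[ℝ] ℝ} {x : V} (hL : HasFDerivAt U L x) (h : V) :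
    Tendsto (fun n => dyadicDiff U h n x) atTop (𝓝 (L h)) :=
  hL.lim h (by simpa using tendsto_pow_atTop_atTop_of_one_lt (one_lt_two : (1 : ℝ) < 2))

lemma two_pow_mul_inv_two_pow_succ_rpow_le (hβ : 0 ≤ β) (n : ℕ) :
    (2 : ℝ) ^ n * ((2 : ℝ) ^ (n + 1))⁻¹ ^ (1 + β) ≤ (2 ^ (-β)) ^ n := by
  have pow_eq : (2 : ℝ) ^ n = 2 ^ (n : ℝ) := (Real.rpow_natCast 2 n).symm
  have inv_eq : ((2 : ℝ) ^ (n + 1))⁻¹ = 2 ^ (-((n : ℝ) + 1)) := by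
    rw [Real.rpow_neg zero_le_two, ← Nat.cast_succ, Real.rpow_natCast]
  rw [pow_eq, inv_eq, ← Real.rpow_natCast, ← Real.rpow_mul zero_le_two,
    ← Real.rpow_mul zero_le_two, ← Real.rpow_add two_pos]
  exact Real.rpow_le_rpow_of_exponent_le one_le_two (by linarith)

variable [MeasurableSpace V] {μ : Measure V} {p κ : ℝ≥0∞}

lemma eLpNorm_dyadicDiff_sub_succ_le (hβ : 0 ≤ β)
    (hκ : ∀ h : V, ‖h‖ ≤ δ → eLpNorm (secondDiff U h h) p μ ≤ κ * ENNReal.ofReal (‖h‖ ^ (1 + β)))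
    (hh : ‖h‖ ≤ δ) (n : ℕ) :
    eLpNorm (dyadicDiff U h n - dyadicDiff U h (n + 1)) p μ ≤
      κ * ENNReal.ofReal (‖h‖ ^ (1 + β)) * ENNReal.ofReal (2 ^ (-β)) ^ n := by
  have norm_eq : ‖((2 : ℝ) ^ (n + 1))⁻¹ • h‖ = ((2 : ℝ) ^ (n + 1))⁻¹ * ‖h‖ := by
    rw [norm_smul, Real.norm_of_nonneg (by positivity)]
  have norm_le : ‖((2 : ℝ) ^ (n + 1))⁻¹ • h‖ ≤ δ := by
    rw [norm_eq]
    exact (mul_le_of_le_one_left (norm_nonneg _)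
      (inv_le_one_of_one_le₀ (one_le_pow₀ one_le_two))).trans hh
  rw [dyadicDiff_sub_succ, eLpNorm_const_smul]
  refine (mul_le_mul_right (hκ _ norm_le) _).trans ?_
  rw [norm_eq, Real.enorm_of_nonneg (by positivity), ← ENNReal.ofReal_pow (by positivity),
    mul_left_comm, mul_assoc, ← ENNReal.ofReal_mul (by positivity),
    ← ENNReal.ofReal_mul (by positivity), Real.mul_rpow (by positivity) (norm_nonneg _),
    ← mul_assoc ((2 : ℝ) ^ n), mul_comm _ (‖h‖ ^ (1 + β))]
  exact mul_le_mul_right (ENNReal.ofReal_le_ofReal (mul_le_mul_of_nonneg_left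
    (two_pow_mul_inv_two_pow_succ_rpow_le hβ n) (by positivity))) κ

variable [OpensMeasurableSpace V]

lemma eLpNorm_dyadicDiff_zero_sub_le (hp : 1 ≤ p) (hβ : 0 ≤ β) (hU : Continuous U)
    (hκ : ∀ h : V, ‖h‖ ≤ δ → eLpNorm (secondDiff U h h) p μ ≤ κ * ENNReal.ofReal (‖h‖ ^ (1 + β)))
    (hh : ‖h‖ ≤ δ) (n : ℕ) :
    eLpNorm (dyadicDiff U h 0 - dyadicDiff U h n) p μ ≤
      κ * ENNReal.ofReal (‖h‖ ^ (1 + β)) * taylorConst β := by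
  have meas (j : ℕ) : AEStronglyMeasurable (dyadicDiff U h j - dyadicDiff U h (j + 1)) μ :=
    ((continuous_dyadicDiff hU h j).sub (continuous_dyadicDiff hU h (j + 1))).aestronglyMeasurable
  rw [← Finset.sum_range_sub']
  calc
    _ ≤ ∑ j ∈ Finset.range n, eLpNorm (dyadicDiff U h j - dyadicDiff U h (j + 1)) p μ :=
      eLpNorm_sum_le (fun j _ => meas j) hp
    _ ≤ ∑ j ∈ Finset.range n,
        κ * ENNReal.ofReal (‖h‖ ^ (1 + β)) * ENNReal.ofReal (2 ^ (-β)) ^ j :=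
      Finset.sum_le_sum fun j _ => eLpNorm_dyadicDiff_sub_succ_le hβ hκ hh j
    _ ≤ _ := by
      rw [← Finset.mul_sum, taylorConst, ← ENNReal.tsum_geometric]
      exact mul_le_mul_right (ENNReal.sum_le_tsum _) _

lemma eLpNorm_taylor_le (hp : 1 ≤ p) (hβ : 0 ≤ β) (hU : Continuous U) {L : V → V →L[ℝ] ℝ}
    (hL : ∀ᵐ x ∂μ, HasFDerivAt U (L x) x)
    (hκ : ∀ h : V, ‖h‖ ≤ δ → eLpNorm (secondDiff U h h) p μ ≤ κ * ENNReal.ofReal (‖h‖ ^ (1 + β)))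
    (hh : ‖h‖ ≤ δ) :
    eLpNorm (fun x => U (x + h) - U x - L x h) p μ ≤
      κ * ENNReal.ofReal (‖h‖ ^ (1 + β)) * taylorConst β := by
  have tendsto : ∀ᵐ x ∂μ, Tendsto (fun n => (dyadicDiff U h 0 - dyadicDiff U h n) x) atTop
      (𝓝 (U (x + h) - U x - L x h)) := by
    filter_upwards [hL] with x hx
    simp only [Pi.sub_apply, dyadicDiff_zero]
    exact (tendsto_dyadicDiff hx h).const_sub _
  refine (Lp.eLpNorm_lim_le_liminf_eLpNorm (fun n => ((continuous_dyadicDiff hU h 0).sub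
    (continuous_dyadicDiff hU h n)).aestronglyMeasurable) _ tendsto).trans ?_
  exact (liminf_le_liminf (Eventually.of_forall
    (eLpNorm_dyadicDiff_zero_sub_le hp hβ hU hκ hh))).trans_eq (liminf_const _)

end Taylor

/-! ### Increments of the gradient -/

section LpNorm

variable {X F : Type*} [MeasurableSpace X] [NormedAddCommGroup F] {μ : Measure X} {q : ℝ}

lemma eLpNorm_ofReal_eq (hq : 0 < q) (f : X → F) :
    eLpNorm f (ENNReal.ofReal q) μ = (∫⁻ x, ‖f x‖ₑ ^ q ∂μ) ^ (1 / q) := by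
  rw [eLpNorm_eq_lintegral_rpow_enorm_toReal (ENNReal.ofReal_pos.2 hq).ne' ENNReal.ofReal_ne_top,
    ENNReal.toReal_ofReal hq.le]

lemma eLpNorm_ofReal_rpow (hq : 0 < q) (f : X → F) :
    eLpNorm f (ENNReal.ofReal q) μ ^ q = ∫⁻ x, ‖f x‖ₑ ^ q ∂μ := by
  rw [eLpNorm_ofReal_eq hq, ← ENNReal.rpow_mul, one_div_mul_cancel hq.ne', ENNReal.rpow_one]

lemma eLpNorm_comp_add_right_le {V : Type*} [AddGroup V] [MeasurableSpace V] [MeasurableAdd V]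
    {ν : Measure V} [ν.IsAddRightInvariant] {S S' : Set V} {k : V} (h : ∀ x ∈ S, x + k ∈ S')
    (f : V → F) (p : ℝ≥0∞) :
    eLpNorm (fun x => f (x + k)) p (ν.restrict S) ≤ eLpNorm f p (ν.restrict S') := by
  have emb : MeasurableEmbedding (· + k) := measurableEmbedding_addRight k
  rw [← ((measurePreserving_add_right ν k).restrict_preimage_emb emb S').map_eq,
    emb.eLpNorm_map_measure]
  exact eLpNorm_mono_measure _ (Measure.restrict_mono h le_rfl)

lemma eLpNorm_le_sum_eLpNorm_apply {ι : Type*} [Fintype ι] {f : X → EuclideanSpace ℝ ι}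
    (hf : AEStronglyMeasurable f μ) {p : ℝ≥0∞} (hp : 1 ≤ p) :
    eLpNorm f p μ ≤ ∑ i, eLpNorm (fun x => f x i) p μ := by
  classical
  have sum_eq : f = ∑ i, fun x => f x i • EuclideanSpace.single i (1 : ℝ) := by
    ext x j
    simp [Finset.sum_apply, Pi.single_apply]
  have meas (i : ι) : AEStronglyMeasurable (fun x => f x i • EuclideanSpace.single i (1 : ℝ)) μ :=
    ((EuclideanSpace.proj i).continuous.comp_aestronglyMeasurable hf).smul_const _
  conv_lhs => rw [sum_eq]
  refine (eLpNorm_sum_le (fun i _ => meas i) hp).trans (Finset.sum_le_sum fun i _ => ?_)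
  exact eLpNorm_mono fun x => by simp [norm_smul]

end LpNorm

section Classical

variable {V : Type*} [NormedAddCommGroup V] [NormedSpace ℝ V] [MeasurableSpace V] [BorelSpace V]
  {μ : Measure V} [μ.IsAddRightInvariant] {U : V → ℝ} {S S' : Set V} {p κ : ℝ≥0∞} {β δ : ℝ}
  {h k : V}

lemma eLpNorm_fderiv_increment_apply_le (hp : 1 ≤ p) (hβ : 0 ≤ β)
    (hU : Continuous U) {L : V → V →L[ℝ] ℝ} (hL : Continuous L)
    (hUL : ∀ᵐ x ∂μ.restrict S', HasFDerivAt U (L x) x)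
    (hκ : ∀ h k : V, ‖h‖ ≤ δ → ‖k‖ = ‖h‖ →
      eLpNorm (secondDiff U h k) p (μ.restrict S') ≤ κ * ENNReal.ofReal (‖h‖ ^ (1 + β)))
    (hS : S ⊆ S') (hSk : ∀ x ∈ S, x + k ∈ S') (hh : ‖h‖ ≤ δ) (hkh : ‖k‖ = ‖h‖) :
    eLpNorm (fun x => L (x + k) h - L x h) p (μ.restrict S) ≤
      (1 + 2 * taylorConst β) * κ * ENNReal.ofReal (‖h‖ ^ (1 + β)) := by
  set P : V → ℝ := fun x => U (x + h) - U x - L x h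
  have P_cont : Continuous P := by fun_prop
  have P_comp_cont : Continuous fun x => P (x + k) := by fun_prop
  have secondDiff_cont : Continuous (secondDiff U h k) := by
    unfold secondDiff
    fun_prop
  have taylor : eLpNorm P p (μ.restrict S') ≤ _ :=
    eLpNorm_taylor_le hp hβ hU hUL (fun h hh => hκ h h hh rfl) hh
  have mono (f : V → ℝ) : eLpNorm f p (μ.restrict S) ≤ eLpNorm f p (μ.restrict S') :=
    eLpNorm_mono_measure f (Measure.restrict_mono hS le_rfl)
  calc
    _ = eLpNorm (secondDiff U h k - (fun x => P (x + k)) + P) p (μ.restrict S) := by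
      congr 1
      ext x
      simp only [P, secondDiff, Pi.add_apply, Pi.sub_apply]
      ring
    _ ≤ eLpNorm (secondDiff U h k) p (μ.restrict S) +
          eLpNorm (fun x => P (x + k)) p (μ.restrict S) + eLpNorm P p (μ.restrict S) :=
      (eLpNorm_add_le (secondDiff_cont.sub P_comp_cont).aestronglyMeasurable
        P_cont.aestronglyMeasurable hp).trans
        (add_le_add_left (eLpNorm_sub_le secondDiff_cont.aestronglyMeasurable
          P_comp_cont.aestronglyMeasurable hp) _)
    _ ≤ κ * ENNReal.ofReal (‖h‖ ^ (1 + β)) +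
          κ * ENNReal.ofReal (‖h‖ ^ (1 + β)) * taylorConst β +
          κ * ENNReal.ofReal (‖h‖ ^ (1 + β)) * taylorConst β :=
      add_le_add (add_le_add ((mono _).trans (hκ h k hh hkh))
        ((eLpNorm_comp_add_right_le hSk P p).trans taylor)) ((mono P).trans taylor)
    _ = _ := by ring

end Classical

section Euclidean

variable {N : ℕ} {μ : Measure (E N)} [μ.IsAddRightInvariant] {U : E N → ℝ} {H : E N → E N}
  {S S' : Set (E N)} {p κ : ℝ≥0∞} {β δ : ℝ} {k : E N}

lemma eLpNorm_gradient_increment_apply_le (hp : 1 ≤ p) (hβ : 0 ≤ β) (hU : Continuous U)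
    (hH : Continuous H) (hUH : ∀ᵐ x ∂μ.restrict S', HasFDerivAt U (innerSL ℝ (H x)) x)
    (hκ : ∀ h k : E N, ‖h‖ ≤ δ → ‖k‖ = ‖h‖ →
      eLpNorm (secondDiff U h k) p (μ.restrict S') ≤ κ * ENNReal.ofReal (‖h‖ ^ (1 + β)))
    (hS : S ⊆ S') (hSk : ∀ x ∈ S, x + k ∈ S') (hk : ‖k‖ ≤ δ) (hk0 : k ≠ 0) (i : Fin N) :
    eLpNorm (fun x => (H (x + k) - H x) i) p (μ.restrict S) ≤
      (1 + 2 * taylorConst β) * κ * ENNReal.ofReal (‖k‖ ^ β) := by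
  have norm_pos : 0 < ‖k‖ := norm_pos_iff.2 hk0
  set h : E N := ‖k‖ • EuclideanSpace.single i (1 : ℝ)
  have norm_h : ‖h‖ = ‖k‖ := by simp [h, norm_smul]
  have inner_h (v : E N) : innerSL ℝ v h = ‖k‖ * v i := by
    simp [h, EuclideanSpace.inner_single_right]
  have increment_eq : (fun x => (H (x + k) - H x) i) =
      ‖k‖⁻¹ • fun x => innerSL ℝ (H (x + k)) h - innerSL ℝ (H x) h := by
    ext x
    simp only [inner_h, Pi.smul_apply, smul_eq_mul, PiLp.sub_apply]
    field_simp
  have rpow_eq : ‖‖k‖⁻¹‖ₑ * ENNReal.ofReal (‖k‖ ^ (1 + β)) = ENNReal.ofReal (‖k‖ ^ β) := by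
    rw [Real.enorm_of_nonneg (by positivity), ← ENNReal.ofReal_mul (by positivity),
      Real.rpow_add norm_pos, Real.rpow_one, inv_mul_cancel_left₀ norm_pos.ne']
  rw [increment_eq, eLpNorm_const_smul, ← rpow_eq, mul_left_comm, ← norm_h]
  exact mul_le_mul_right (eLpNorm_fderiv_increment_apply_le hp hβ hU
    ((innerSL ℝ).continuous.comp hH) hUH hκ hS hSk (norm_h ▸ hk) norm_h.symm) _

lemma eLpNorm_gradient_increment_le (hp : 1 ≤ p) (hβ : 0 ≤ β) (hU : Continuous U)
    (hH : Continuous H) (hUH : ∀ᵐ x ∂μ.restrict S', HasFDerivAt U (innerSL ℝ (H x)) x)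
    (hκ : ∀ h k : E N, ‖h‖ ≤ δ → ‖k‖ = ‖h‖ →
      eLpNorm (secondDiff U h k) p (μ.restrict S') ≤ κ * ENNReal.ofReal (‖h‖ ^ (1 + β)))
    (hS : S ⊆ S') (hSk : ∀ x ∈ S, x + k ∈ S') (hk : ‖k‖ ≤ δ) :
    eLpNorm (fun x => H (x + k) - H x) p (μ.restrict S) ≤
      N * (1 + 2 * taylorConst β) * κ * ENNReal.ofReal (‖k‖ ^ β) := by
  rcases eq_or_ne k 0 with rfl | hk0
  · simp
  have increment_cont : Continuous fun x => H (x + k) - H x := by fun_prop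
  calc
    _ ≤ ∑ i, eLpNorm (fun x => (H (x + k) - H x) i) p (μ.restrict S) :=
      eLpNorm_le_sum_eLpNorm_apply increment_cont.aestronglyMeasurable hp
    _ ≤ ∑ _ : Fin N, (1 + 2 * taylorConst β) * κ * ENNReal.ofReal (‖k‖ ^ β) :=
      Finset.sum_le_sum fun i _ =>
        eLpNorm_gradient_increment_apply_le hp hβ hU hH hUH hκ hS hSk hk hk0 i
    _ = _ := by simp [mul_assoc]

end Euclidean

section WeakGradient

variable {N : ℕ} {q s m σ δ ρ : ℝ} {Ω : Set (E N)} {u : E N → ℝ} {G : E N → E N} {x₀ h k : E N}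
  {K : ℝ≥0∞}

lemma lintegral_secondDiff_le (hq : 1 ≤ q) (hs : 0 ≤ s) (hm : 0 ≤ m)
    (hu : AEStronglyMeasurable u)
    (hK : ∀ h : E N, ‖h‖ ≤ δ → ∫⁻ z in ball x₀ ρ ×ˢ ball x₀ ρ,
      gagliardoDensity q s (fun x => u (x + h) - u x) z.1 z.2 ≤ K * ENNReal.ofReal (‖h‖ ^ m))
    (hh : ‖h‖ ≤ δ) (hkh : ‖k‖ = ‖h‖) :
    ∫⁻ x in ball x₀ (ρ - δ), ‖secondDiff u h k x‖ₑ ^ q ≤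
      incrConst N q s * K * ENNReal.ofReal (‖h‖ ^ (s + m)) :=
  calc
    _ ≤ incrConst N q s * ENNReal.ofReal (‖k‖ ^ s) * _ :=
      lintegral_increment_le_gagliardo hq hs (aemeasurable_increment hu h).aestronglyMeasurable
        (hkh ▸ hh)
    _ ≤ incrConst N q s * ENNReal.ofReal (‖k‖ ^ s) * (K * ENNReal.ofReal (‖h‖ ^ m)) :=
      mul_le_mul_right (hK h hh) _
    _ = _ := by
      rw [hkh, Real.rpow_add_of_nonneg (norm_nonneg h) hs hm, ENNReal.ofReal_mul (by positivity)]
      ring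

lemma lintegral_secondDiff_moll_le (hq : 1 ≤ q) (hs : 0 ≤ s) (hm : 0 ≤ m)
    (hu : LocallyIntegrable u)
    (hK : ∀ h : E N, ‖h‖ ≤ δ → ∫⁻ z in ball x₀ ρ ×ˢ ball x₀ ρ,
      gagliardoDensity q s (fun x => u (x + h) - u x) z.1 z.2 ≤ K * ENNReal.ofReal (‖h‖ ^ m))
    (hh : ‖h‖ ≤ δ) (hkh : ‖k‖ = ‖h‖) {φ : ContDiffBump (0 : E N)} (hφ : φ.rOut ≤ δ) :
    ∫⁻ x in ball x₀ (ρ - 2 * δ), ‖secondDiff (moll φ u) h k x‖ₑ ^ q ≤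
      incrConst N q s * K * ENNReal.ofReal (‖h‖ ^ (s + m)) := by
  have sub_mem_ball (x : E N) (hx : x ∈ ball x₀ (ρ - 2 * δ)) (t : E N) (ht : ‖t‖ < φ.rOut) :
      x - t ∈ ball x₀ (ρ - δ) := by
    rw [sub_eq_add_neg x t]
    exact add_mem_ball_of_norm_le hx ((norm_neg t).trans_le (ht.le.trans hφ)) (by linarith)
  rw [secondDiff_moll φ hu]
  exact (lintegral_moll_rpow_le φ (aestronglyMeasurable_secondDiff hu.aestronglyMeasurable h k) hq
    measurableSet_ball measurableSet_ball sub_mem_ball).trans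
      (lintegral_secondDiff_le hq hs hm hu.aestronglyMeasurable hK hh hkh)

/-- The constant in the estimate of the increments of the gradient. -/
noncomputable def gradConst (N : ℕ) (q s σ : ℝ) : ℝ≥0∞ :=
  (N * (1 + 2 * taylorConst (σ / q))) ^ q * incrConst N q s

lemma gradConst_ne_top (hq : 0 < q) (hσ : 0 < σ) : gradConst N q s σ ≠ ∞ := by
  have := taylorConst_ne_top (div_pos hσ hq)
  have := incrConst_ne_top (N := N) q s
  unfold gradConst
  exact ENNReal.mul_ne_top (ENNReal.rpow_ne_top_of_nonneg hq.le (by finiteness)) this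

lemma lintegral_moll_gradient_increment_le (hq : 1 ≤ q) (hs : 0 ≤ s) (hm : 0 ≤ m) (hσ : 0 ≤ σ)
    (hsm : s + m = q + σ) (hu : LocallyIntegrable u) (hG : IsWeakGradient Ω u G)
    (hΩ : closedBall x₀ ρ ⊆ Ω)
    (hK : ∀ h : E N, ‖h‖ ≤ δ → ∫⁻ z in ball x₀ ρ ×ˢ ball x₀ ρ,
      gagliardoDensity q s (fun x => u (x + h) - u x) z.1 z.2 ≤ K * ENNReal.ofReal (‖h‖ ^ m))
    (hk : ‖k‖ ≤ δ) {φ : ContDiffBump (0 : E N)} (hφ : φ.rOut ≤ δ) :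
    ∫⁻ x in ball x₀ (ρ - 3 * δ), ‖moll φ ((closedBall x₀ ρ).indicator G) (x + k) -
        moll φ ((closedBall x₀ ρ).indicator G) x‖ₑ ^ q ≤
      gradConst N q s σ * K * ENNReal.ofReal (‖k‖ ^ σ) := by
  have hq0 : 0 < q := by linarith
  have hδ : 0 ≤ δ := φ.rOut_pos.le.trans hφ
  have G_int :=
    (integrable_indicator_of_isCompact hG.2.1 (isCompact_closedBall x₀ ρ) hΩ).locallyIntegrable
  have hasFDerivAt : ∀ x ∈ ball x₀ (ρ - 2 * δ), HasFDerivAt (moll φ u) (innerSL ℝ _) x :=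
    fun x hx => hasFDerivAt_moll_of_isWeakGradient hu hG (isCompact_closedBall x₀ ρ) hΩ φ
      (closedBall_subset_closedBall' (by linarith [mem_ball.1 hx]))
  have increment_le := eLpNorm_gradient_increment_le (μ := volume) (S := ball x₀ (ρ - 3 * δ))
    (κ := (incrConst N q s * K) ^ (1 / q)) (ENNReal.one_le_ofReal.2 hq) (div_nonneg hσ hq0.le)
    (continuous_moll φ hu) (continuous_moll φ G_int)
    (ae_restrict_of_forall_mem measurableSet_ball hasFDerivAt)
    (fun h k hh hkh => ?_) (ball_subset_ball (by linarith))
    (fun x hx => add_mem_ball_of_norm_le hx hk (by linarith)) hk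
  · rw [← eLpNorm_ofReal_rpow hq0]
    refine (ENNReal.rpow_le_rpow increment_le hq0.le).trans_eq ?_
    rw [ENNReal.mul_rpow_of_nonneg _ _ hq0.le, ENNReal.mul_rpow_of_nonneg _ _ hq0.le,
      ← ENNReal.rpow_mul, one_div_mul_cancel hq0.ne', ENNReal.rpow_one,
      ENNReal.ofReal_rpow_of_nonneg (by positivity) hq0.le, ← Real.rpow_mul (norm_nonneg _),
      div_mul_cancel₀ _ hq0.ne', gradConst, mul_assoc _ (incrConst N q s)]
  · rw [eLpNorm_ofReal_eq hq0]
    refine (ENNReal.rpow_le_rpow (lintegral_secondDiff_moll_le hq hs hm hu hK hh hkh hφ)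
      (by positivity)).trans_eq ?_
    rw [ENNReal.mul_rpow_of_nonneg _ _ (by positivity),
      ENNReal.ofReal_rpow_of_nonneg (by positivity) (by positivity),
      ← Real.rpow_mul (norm_nonneg _), hsm, mul_one_div, add_div, div_self hq0.ne']

lemma lintegral_weakGradient_increment_le (hq : 1 ≤ q) (hs : 0 ≤ s) (hm : 0 ≤ m) (hσ : 0 ≤ σ)
    (hsm : s + m = q + σ) (hδ : 0 < δ) (hu : LocallyIntegrable u) (hG : IsWeakGradient Ω u G)
    (hΩ : closedBall x₀ ρ ⊆ Ω)
    (hK : ∀ h : E N, ‖h‖ ≤ δ → ∫⁻ z in ball x₀ ρ ×ˢ ball x₀ ρ,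
      gagliardoDensity q s (fun x => u (x + h) - u x) z.1 z.2 ≤ K * ENNReal.ofReal (‖h‖ ^ m))
    (hk : ‖k‖ ≤ δ) :
    ∫⁻ x in ball x₀ (ρ - 3 * δ), ‖G (x + k) - G x‖ₑ ^ q ≤
      gradConst N q s σ * K * ENNReal.ofReal (‖k‖ ^ σ) := by
  set G' := (closedBall x₀ ρ).indicator G
  have G'_int : LocallyIntegrable G' :=
    (integrable_indicator_of_isCompact hG.2.1 (isCompact_closedBall x₀ ρ) hΩ).locallyIntegrable
  have tendsto := tendsto_moll_bumpSeq hδ G'_int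
  have tendsto_comp_add : ∀ᵐ x, Tendsto (fun n => moll (bumpSeq (E N) hδ n) G' (x + k)) atTop
      (𝓝 (G' (x + k))) :=
    (measurePreserving_add_right volume k).quasiMeasurePreserving.ae tendsto
  refine lintegral_enorm_rpow_le_of_tendsto
    (f := fun n x => moll (bumpSeq (E N) hδ n) G' (x + k) - moll (bumpSeq (E N) hδ n) G' x)
    (fun n => ?_) ?_ fun n =>
      lintegral_moll_gradient_increment_le hq hs hm hσ hsm hu hG hΩ hK hk (bumpSeq_rOut_le hδ n)
  · have := continuous_moll (bumpSeq (E N) hδ n) G'_int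
    exact (show Continuous _ by fun_prop).aestronglyMeasurable
  · filter_upwards [ae_restrict_of_ae tendsto, ae_restrict_of_ae tendsto_comp_add,
      ae_restrict_mem measurableSet_ball] with x hx hxk mem_ball
    have mem : x ∈ closedBall x₀ ρ :=
      ball_subset_closedBall (ball_subset_ball (by linarith) mem_ball)
    have add_mem : x + k ∈ closedBall x₀ ρ :=
      ball_subset_closedBall (add_mem_ball_of_norm_le mem_ball hk (by linarith))
    rw [← indicator_of_mem mem G, ← indicator_of_mem add_mem G]
    exact hxk.sub hx

end WeakGradient

/-! ### Gagliardo seminorms from increments -/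

section Gagliardo

variable {N : ℕ} {F : Type*} [NormedAddCommGroup F] {q a α σ δ r : ℝ} {V : Set (E N)} {x₀ : E N}
  {f g : E N → F}

lemma gagliardoPow_congr (hV : MeasurableSet V) (h : EqOn f g V) :
    gagliardoPow α q V f = gagliardoPow α q V g := by
  refine setLIntegral_congr_fun hV fun x hx => setLIntegral_congr_fun hV fun y hy => ?_
  rw [h hx, h hy]

lemma gagliardoDensity_le_of_le_norm_sub (hq : 1 ≤ q) (ha : 0 ≤ a) (hδ : 0 < δ) (f : E N → F)
    {x y : E N} (hxy : δ ≤ ‖x - y‖) :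
    gagliardoDensity q a f x y ≤
      ENNReal.ofReal (δ ^ (-((N : ℝ) + a)) * 2 ^ (q - 1)) * (‖f x‖ₑ ^ q + ‖f y‖ₑ ^ q) := by
  have hq0 : 0 ≤ q := by linarith
  have kern_le : kern a (x - y) ≤ δ ^ (-((N : ℝ) + a)) :=
    Real.rpow_le_rpow_of_nonpos hδ hxy (by linarith [N.cast_nonneg (α := ℝ)])
  have diff_le : ‖f x - f y‖ ^ q ≤ 2 ^ (q - 1) * (‖f x‖ ^ q + ‖f y‖ ^ q) :=
    (Real.rpow_le_rpow (norm_nonneg _) (norm_sub_le _ _) hq0).trans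
      (rpow_add_le_two_rpow_mul hq (norm_nonneg _) (norm_nonneg _))
  rw [gagliardoDensity, ← ofReal_norm, ← ofReal_norm,
    ENNReal.ofReal_rpow_of_nonneg (norm_nonneg _) hq0,
    ENNReal.ofReal_rpow_of_nonneg (norm_nonneg _) hq0,
    ← ENNReal.ofReal_add (by positivity) (by positivity), ← ENNReal.ofReal_mul (by positivity)]
  refine ENNReal.ofReal_le_ofReal ?_
  calc ‖f x - f y‖ ^ q * kern a (x - y)
      ≤ 2 ^ (q - 1) * (‖f x‖ ^ q + ‖f y‖ ^ q) * δ ^ (-((N : ℝ) + a)) :=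
        mul_le_mul diff_le kern_le (kern_nonneg _ _) (by positivity)
    _ = δ ^ (-((N : ℝ) + a)) * 2 ^ (q - 1) * (‖f x‖ ^ q + ‖f y‖ ^ q) := by ring

lemma setLIntegral_prod_fst_le {w : E N → ℝ≥0∞} (hw : AEMeasurable w) (V : Set (E N)) :
    ∫⁻ z in V ×ˢ V, w z.1 ≤ volume V * ∫⁻ x in V, w x := by
  rw [Measure.volume_eq_prod, ← Measure.prod_restrict]
  refine (lintegral_prod_le _).trans_eq ?_
  simp only [lintegral_const, Measure.restrict_apply_univ]
  rw [lintegral_mul_const'' _ hw.restrict, mul_comm]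

lemma setLIntegral_far_gagliardoDensity_le (hq : 1 ≤ q) (ha : 0 ≤ a) (hδ : 0 < δ)
    (hV : MeasurableSet V) (hf : AEStronglyMeasurable f) :
    ∫⁻ z in (V ×ˢ V) ∩ {z | δ ≤ ‖z.1 - z.2‖}, gagliardoDensity q a f z.1 z.2 ≤
      ENNReal.ofReal (δ ^ (-((N : ℝ) + a))) * ENNReal.ofReal (2 ^ q) *
        (volume V * ∫⁻ x in V, ‖f x‖ₑ ^ q) := by
  have pow_meas : AEMeasurable fun x => ‖f x‖ₑ ^ q := hf.enorm.pow_const q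
  have fst_meas : AEMeasurable fun z : E N × E N => ‖f z.1‖ₑ ^ q :=
    pow_meas.comp_quasiMeasurePreserving Measure.quasiMeasurePreserving_fst
  have fst_le := setLIntegral_prod_fst_le pow_meas V
  have snd_le : ∫⁻ z in V ×ˢ V, ‖f z.2‖ₑ ^ q ≤ volume V * ∫⁻ x in V, ‖f x‖ₑ ^ q :=
    (setLIntegral_prod_swap fun z => ‖f z.1‖ₑ ^ q).trans_le fst_le
  have const_eq : 2 ^ (q - 1) * 2 = (2 : ℝ) ^ q := by
    rw [Real.rpow_sub_one two_ne_zero, div_mul_cancel₀ _ two_ne_zero]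
  set c := ENNReal.ofReal (δ ^ (-((N : ℝ) + a)) * 2 ^ (q - 1))
  calc ∫⁻ z in (V ×ˢ V) ∩ {z | δ ≤ ‖z.1 - z.2‖}, gagliardoDensity q a f z.1 z.2
      ≤ ∫⁻ z in (V ×ˢ V) ∩ {z | δ ≤ ‖z.1 - z.2‖}, c * (‖f z.1‖ₑ ^ q + ‖f z.2‖ₑ ^ q) :=
        setLIntegral_mono' ((hV.prod hV).inter (measurableSet_far δ))
          fun z hz => gagliardoDensity_le_of_le_norm_sub hq ha hδ f hz.2
    _ ≤ ∫⁻ z in V ×ˢ V, c * (‖f z.1‖ₑ ^ q + ‖f z.2‖ₑ ^ q) := lintegral_mono_set inter_subset_left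
    _ = c * ((∫⁻ z in V ×ˢ V, ‖f z.1‖ₑ ^ q) + ∫⁻ z in V ×ˢ V, ‖f z.2‖ₑ ^ q) := by
        rw [lintegral_const_mul' _ _ ENNReal.ofReal_ne_top, lintegral_add_left' fst_meas.restrict]
    _ ≤ c * (volume V * (∫⁻ x in V, ‖f x‖ₑ ^ q) + volume V * ∫⁻ x in V, ‖f x‖ₑ ^ q) :=
        mul_le_mul_right (add_le_add fst_le snd_le) c
    _ = c * ENNReal.ofReal 2 * (volume V * ∫⁻ x in V, ‖f x‖ₑ ^ q) := by
        rw [ENNReal.ofReal_ofNat]; ring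
    _ = _ := by
        rw [← ENNReal.ofReal_mul (by positivity), mul_assoc, const_eq,
          ENNReal.ofReal_mul (by positivity)]

lemma setLIntegral_near_gagliardoDensity_le (hq : 0 < q) (hr : r ≤ 1)
    (hf : AEStronglyMeasurable f) {D : ℝ≥0∞}
    (h : ∀ k : E N, ‖k‖ ≤ δ → ∫⁻ x in ball x₀ r, ‖f (x + k) - f x‖ₑ ^ q ≤
      D * ENNReal.ofReal (‖k‖ ^ σ)) :
    ∫⁻ z in (ball x₀ r ×ˢ ball x₀ r) \ {z | δ ≤ ‖z.1 - z.2‖}, gagliardoDensity q a f z.1 z.2 ≤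
      nearConst N (σ - a) * D := by
  set S := {z : E N × E N | δ ≤ ‖z.1 - z.2‖}
  have S_meas : MeasurableSet Sᶜ := (measurableSet_far δ).compl
  rw [sdiff_eq, inter_comm, ← Measure.restrict_restrict S_meas, ← lintegral_indicator S_meas]
  refine setLIntegral_prod_le_nearConst_mul hr
    ((aemeasurable_gagliardoDensity hf q a).indicator S_meas).restrict fun k _ => ?_
  rcases le_or_gt δ ‖k‖ with hk | hk
  · have far_mem (x : E N) : (x, x + k) ∉ Sᶜ := by simpa [S] using hk
    simp only [indicator_of_notMem (far_mem _), lintegral_zero, zero_le]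
  rcases eq_or_ne k 0 with rfl | hk0
  · have zero (x : E N) :
        Sᶜ.indicator (fun z => gagliardoDensity q a f z.1 z.2) (x, x + 0) = 0 := by
      rw [indicator_apply_eq_zero]
      simp [gagliardoDensity, Real.zero_rpow hq.ne']
    simp only [zero, lintegral_zero, zero_le]
  have near_eq (x : E N) : Sᶜ.indicator (fun z => gagliardoDensity q a f z.1 z.2) (x, x + k) =
      ENNReal.ofReal (kern a k) * ‖f (x + k) - f x‖ₑ ^ q := by
    have near_mem : (x, x + k) ∈ Sᶜ := by simpa [S] using hk
    rw [indicator_of_mem near_mem, gagliardoDensity_comm, gagliardoDensity, add_sub_cancel_left,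
      mul_comm, ENNReal.ofReal_mul (kern_nonneg _ _),
      ← ENNReal.ofReal_rpow_of_nonneg (norm_nonneg _) hq.le, ofReal_norm]
  simp_rw [near_eq]
  rw [lintegral_const_mul' _ _ ENNReal.ofReal_ne_top]
  calc ENNReal.ofReal (kern a k) *
        ∫⁻ x in ball x₀ r ∩ {x | x + k ∈ ball x₀ r}, ‖f (x + k) - f x‖ₑ ^ q
      ≤ ENNReal.ofReal (kern a k) * (D * ENNReal.ofReal (‖k‖ ^ σ)) :=
        mul_le_mul_right ((lintegral_mono_set inter_subset_left).trans (h k hk.le)) _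
    _ = ENNReal.ofReal (‖k‖ ^ σ * kern a k) * D := by
        rw [ENNReal.ofReal_mul (by positivity)]; ring
    _ = ENNReal.ofReal (kern (-(σ - a)) k) * D := by rw [rpow_norm_mul_kern _ _ hk0, neg_sub]

lemma gagliardoPow_le_of_increment (hq : 1 ≤ q) (hα : 0 < α) (hδ : 0 < δ) (hr : r ≤ 1)
    (hf : AEStronglyMeasurable f) {D : ℝ≥0∞}
    (h : ∀ k : E N, ‖k‖ ≤ δ → ∫⁻ x in ball x₀ r, ‖f (x + k) - f x‖ₑ ^ q ≤
      D * ENNReal.ofReal (‖k‖ ^ σ)) :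
    gagliardoPow α q (ball x₀ r) f ≤ nearConst N (σ - α * q) * D +
      ENNReal.ofReal (δ ^ (-((N : ℝ) + α * q))) * ENNReal.ofReal (2 ^ q) *
        (unitVol N * ∫⁻ x in ball x₀ r, ‖f x‖ₑ ^ q) := by
  have hq0 : 0 < q := by linarith
  rw [gagliardoPow_eq_setLIntegral hq0 hα hf,
    ← lintegral_inter_add_sdiff _ (ball x₀ r ×ˢ ball x₀ r) (measurableSet_far δ), add_comm]
  refine add_le_add (setLIntegral_near_gagliardoDensity_le hq0 hr hf h)
    ((setLIntegral_far_gagliardoDensity_le hq (by positivity) hδ measurableSet_ball hf).trans ?_)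
  gcongr
  exact volume_ball_le_unitVol hr

lemma exists_prod_self_sdiff_far_subset {K : Set (E N)} (hK : IsCompact K) {ρ : E N → ℝ}
    (hρ : ∀ x ∈ K, 0 < ρ x) :
    ∃ t : Finset (E N), (∀ x ∈ t, x ∈ K) ∧ ∃ δ > 0,
      (K ×ˢ K) \ {z | δ ≤ ‖z.1 - z.2‖} ⊆ ⋃ x : t, ball x.1 (ρ x) ×ˢ ball x.1 (ρ x) := by
  obtain ⟨t, ht, hcover⟩ := hK.elim_nhds_subcover (fun x => ball x (ρ x))
    fun x hx => ball_mem_nhds x (hρ x hx)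
  obtain ⟨δ, hδ, lebesgue⟩ := lebesgue_number_lemma_of_metric (ι := t)
    (c := fun x => ball x.1 (ρ x)) hK (fun x => isOpen_ball)
    (by simpa only [iUnion_subtype] using hcover)
  refine ⟨t, ht, δ, hδ, fun ⟨y, z⟩ ⟨hyz, near⟩ => ?_⟩
  obtain ⟨x, hx⟩ := lebesgue y hyz.1
  refine mem_iUnion.2 ⟨x, hx (mem_ball_self hδ), hx ?_⟩
  rw [mem_ball, dist_comm, dist_eq_norm]
  exact not_le.1 near

lemma gagliardoPow_lt_top_of_locally (hq : 1 ≤ q) (hα : 0 < α) (hV : MeasurableSet V)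
    (hVc : IsCompact (closure V)) (hf : AEStronglyMeasurable f)
    (hfV : ∫⁻ x in V, ‖f x‖ₑ ^ q < ∞)
    (h : ∀ x ∈ closure V, ∃ ρ > 0, gagliardoPow α q (ball x ρ) f < ∞) :
    gagliardoPow α q V f < ∞ := by
  have hq0 : 0 < q := by linarith
  choose! ρ hρ0 hρ using h
  obtain ⟨t, ht, δ, hδ, cover⟩ := exists_prod_self_sdiff_far_subset hVc hρ0
  rw [gagliardoPow_eq_setLIntegral hq0 hα hf,
    ← lintegral_inter_add_sdiff _ (V ×ˢ V) (measurableSet_far δ)]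
  refine ENNReal.add_lt_top.2 ⟨?_, ?_⟩
  · have : volume V < ∞ := (measure_mono subset_closure).trans_lt hVc.measure_lt_top
    refine (setLIntegral_far_gagliardoDensity_le hq (by positivity) hδ hV hf).trans_lt ?_
    finiteness
  · have near_subset :=
      (sdiff_subset_sdiff_left (Set.prod_mono subset_closure subset_closure)).trans cover
    refine (lintegral_mono_set near_subset).trans_lt ((lintegral_iUnion_le _ _).trans_lt ?_)
    rw [tsum_fintype, ENNReal.sum_lt_top]
    intro x _
    rw [← gagliardoPow_eq_setLIntegral hq0 hα hf]
    exact hρ x (ht x x.2)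

end Gagliardo

/-! ### The regularity estimate -/

section Tail

variable {N : ℕ} {s p n δ R : ℝ} {Ω : Set (E N)} {u : E N → ℝ} {x₀ : E N}

lemma MemTailSpace.locallyIntegrable (hn : 1 ≤ n) (hu : MemTailSpace n s u) :
    LocallyIntegrable u := by
  refine locallyIntegrable_iff.2 fun K hK => ?_
  have : IsFiniteMeasure (volume.restrict K) := isFiniteMeasure_restrict.2 hK.measure_lt_top.ne
  exact MemLp.integrable (q := ENNReal.ofReal n) (by simpa using hn) (hu.1 K hK)

lemma tail_rpow (hp : 1 < p) (s : ℝ) (u : E N → ℝ) (x₀ : E N) (R : ℝ) :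
    tail s p u x₀ R ^ (p - 1) =
      ENNReal.ofReal (R ^ (s * p)) * tailInt (s * p) (p - 1) u x₀ R := by
  rw [tail, ← ENNReal.rpow_mul, one_div_mul_cancel (by linarith), ENNReal.rpow_one, tailInt]

lemma bigT_ne_top (hs : 0 < s) (hp : 1 < p) (hR : 0 < R) (hu : MemTailSpace (p - 1) (s * p) u)
    (hb : LocallyBounded Ω u) (hΩ : closedBall x₀ R ⊆ Ω) : bigT s p u x₀ R ≠ ∞ := by
  have tailInt_ne_top := tailInt_ne_top (x₀ := x₀) (show 0 < s * p by positivity) hR hu.2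
  refine ENNReal.add_ne_top.2 ⟨(hb _ (compactlyInside_ball hΩ)).ne, ?_⟩
  rw [← lt_top_iff_ne_top, ← ENNReal.rpow_lt_top_iff_of_pos (show 0 < p - 1 by linarith),
    tail_rpow hp]
  finiteness

lemma tailInt_le_bigT_rpow (hs : 0 < s) (hp : 1 < p) (hδ : 0 < δ) (hδR : δ ≤ R) (u : E N → ℝ)
    (x₀ : E N) : tailInt (s * p) (p - 1) u x₀ R ≤
      ENNReal.ofReal (δ ^ (-(s * p))) * bigT s p u x₀ R ^ (p - 1) := by
  have hR : 0 < R := hδ.trans_le hδR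
  have hsp : -(s * p) ≤ 0 := by simp only [Left.neg_nonpos_iff]; positivity
  calc tailInt (s * p) (p - 1) u x₀ R
      = ENNReal.ofReal (R ^ (-(s * p))) * tail s p u x₀ R ^ (p - 1) := by
        rw [tail_rpow hp, ← mul_assoc, ← ENNReal.ofReal_mul (by positivity), ← Real.rpow_add hR,
          neg_add_cancel, Real.rpow_zero, ENNReal.ofReal_one, one_mul]
    _ ≤ ENNReal.ofReal (δ ^ (-(s * p))) * bigT s p u x₀ R ^ (p - 1) :=
        mul_le_mul' (ENNReal.ofReal_le_ofReal (Real.rpow_le_rpow_of_nonpos hδ hδR hsp))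
          (ENNReal.rpow_le_rpow le_add_self (by linarith))

lemma ae_abs_le_toReal_eLpNorm_top (hu : eLpNorm u ∞ (volume.restrict (ball x₀ R)) ≠ ∞) :
    ∀ᵐ y, y ∈ ball x₀ R → |u y| ≤ (eLpNorm u ∞ (volume.restrict (ball x₀ R))).toReal := by
  rw [← ae_restrict_iff' measurableSet_ball]
  filter_upwards [ae_le_eLpNormEssSup (f := u) (μ := volume.restrict (ball x₀ R))] with y hy
  rw [← eLpNorm_exponent_top] at hy
  simpa only [toReal_enorm, Real.norm_eq_abs] using ENNReal.toReal_mono hu hy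

lemma ofReal_rpow_add_tailInt_le (hs : 0 < s) (hp : 1 < p) (hδ : 0 < δ) (hδ1 : δ ≤ 1)
    (hδR : δ ≤ R) (hu : eLpNorm u ∞ (volume.restrict (ball x₀ R)) ≠ ∞) :
    ENNReal.ofReal ((eLpNorm u ∞ (volume.restrict (ball x₀ R))).toReal ^ (p - 1)) +
        tailInt (s * p) (p - 1) u x₀ R ≤
      2 * ENNReal.ofReal (δ ^ (-(s * p))) * bigT s p u x₀ R ^ (p - 1) := by
  have hp0 : 0 ≤ p - 1 := by linarith
  have sup_le : ENNReal.ofReal ((eLpNorm u ∞ (volume.restrict (ball x₀ R))).toReal ^ (p - 1)) ≤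
      bigT s p u x₀ R ^ (p - 1) := by
    rw [← ENNReal.ofReal_rpow_of_nonneg ENNReal.toReal_nonneg hp0, ENNReal.ofReal_toReal hu]
    exact ENNReal.rpow_le_rpow le_self_add hp0
  have one_le : 1 ≤ ENNReal.ofReal (δ ^ (-(s * p))) := by
    rw [ENNReal.one_le_ofReal]
    refine Real.one_le_rpow_of_pos_of_le_one_of_nonpos hδ hδ1 ?_
    simp only [Left.neg_nonpos_iff]
    positivity
  rw [mul_assoc, two_mul]
  exact add_le_add (sup_le.trans (le_mul_of_one_le_left' one_le))
    (tailInt_le_bigT_rpow hs hp hδ hδR u x₀)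

end Tail

section Regularity

variable {N : ℕ} {s₁ sp s n m α r δ ρ R : ℝ} {Ω : Set (E N)} {u : E N → ℝ} {G : E N → E N}
  {x₀ : E N}

/-- The right-hand side of the local estimates at the scale `δ`, up to constants that depend on the
exponents only. -/
noncomputable def localBound (sp p q δ : ℝ) (u : E N → ℝ) (G : E N → E N) (x₀ : E N) (R : ℝ) :
    ℝ≥0∞ :=
  ENNReal.ofReal (δ ^ (-((N : ℝ) + 2 * q))) *
    (1 + bigT sp p u x₀ R ^ q + ∫⁻ x in ball x₀ R, ‖G x‖ₑ ^ q)

lemma setLIntegral_gagliardoDensity_increment_le (hN : 1 ≤ N) (hs₁ : 0 < s₁) (hs₁' : s₁ < 1)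
    (hn : 1 ≤ n) (hm : 1 ≤ m) (hsp : 0 < sp) (hsp' : sp < 1)
    (hsol : IsWeakSolution s₁ sp (n + 1) Ω u) (hb : LocallyBounded Ω u)
    (hu : LocallyIntegrable u) (hG : IsWeakGradient Ω u G) (hδ : 0 < δ) (hδ1 : δ ≤ 1)
    (hρ : 0 ≤ ρ) (hρR : ρ + 4 * δ ≤ R) (hR : R ≤ 1) (hΩ : closedBall x₀ R ⊆ Ω) {h : E N}
    (hh : ‖h‖ ≤ δ) :
    ∫⁻ z in ball x₀ ρ ×ˢ ball x₀ ρ,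
        gagliardoDensity (n + m) (sp * (n + 1)) (fun x => u (x + h) - u x) z.1 z.2 ≤
      energyConst N s₁ (sp * (n + 1)) n m * localBound sp (n + 1) (n + m) δ u G x₀ R *
        ENNReal.ofReal (‖h‖ ^ m) := by
  have hfin := (hb _ (compactlyInside_ball hΩ)).ne
  have hT := ofReal_rpow_add_tailInt_le hsp (show 1 < n + 1 by linarith) hδ hδ1
    (by linarith) hfin
  rw [add_sub_cancel_right] at hT
  have energy_le := lintegral_increment_energy_le hN hs₁ hs₁' hsp hsp' hn hm hδ
    (show 0 < ρ + δ by linarith) (by linarith) hR hu hG hsol hΩ ENNReal.toReal_nonneg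
    (ae_abs_le_toReal_eLpNorm_top hfin) hT hh
  rw [add_sub_cancel_right, mul_right_comm] at energy_le
  exact energy_le

lemma lintegral_weakGradient_increment_le_localBound (hN : 1 ≤ N) (hs₁ : 0 < s₁) (hs₁' : s₁ < 1)
    (hn : 1 ≤ n) (hm : 1 ≤ m) (hsp : n < sp * (n + 1)) (hsp' : sp < 1)
    (hsol : IsWeakSolution s₁ sp (n + 1) Ω u) (hb : LocallyBounded Ω u)
    (hG : IsWeakGradient Ω u G) (hδ : 0 < δ) (hδ1 : δ ≤ 1) (hr : 0 ≤ r) (hrR : r + 7 * δ ≤ R)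
    (hR : R ≤ 1) (hΩ : closedBall x₀ R ⊆ Ω) {k : E N} (hk : ‖k‖ ≤ δ) :
    ∫⁻ x in ball x₀ r, ‖G (x + k) - G x‖ₑ ^ (n + m) ≤
      gradConst N (n + m) (sp * (n + 1)) (sp * (n + 1) - n) *
        (energyConst N s₁ (sp * (n + 1)) n m * localBound sp (n + 1) (n + m) δ u G x₀ R) *
        ENNReal.ofReal (‖k‖ ^ (sp * (n + 1) - n)) := by
  have hsp0 : 0 < sp := pos_of_mul_pos_left (by linarith : 0 < sp * (n + 1)) (by linarith)
  have hu : LocallyIntegrable u := hsol.mem_tail.locallyIntegrable (by linarith)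
  have increment_le := lintegral_weakGradient_increment_le (ρ := r + 3 * δ) (m := m)
    (show 1 ≤ n + m by linarith) (by linarith) (by linarith) (sub_pos.2 hsp).le (by ring) hδ hu hG
    ((closedBall_subset_closedBall (by linarith)).trans hΩ)
    (fun h hh => setLIntegral_gagliardoDensity_increment_le hN hs₁ hs₁' hn hm hsp0 hsp' hsol hb hu
      hG hδ hδ1 (by linarith) (by linarith) hR hΩ hh) hk
  rwa [add_sub_cancel_right] at increment_le

/-- The constant in the estimate of the fractional seminorm of the gradient, with `s = s_p p`,
`n = p - 1` and `m = q - n`. -/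
noncomputable def regularityConst (N : ℕ) (s₁ s n m α : ℝ) : ℝ≥0∞ :=
  (nearConst N (s - n - α * (n + m)) * gradConst N (n + m) s (s - n) * energyConst N s₁ s n m +
    ENNReal.ofReal (2 ^ (n + m)) * unitVol N) * ENNReal.ofReal (8 ^ ((N : ℝ) + 2 * (n + m))) * 3

lemma regularityConst_ne_top (hN : 1 ≤ N) (hs₁ : 0 < s₁) (hs₁' : s₁ < 1) (hs : 0 < s)
    (hsn : n < s) (hs' : s < n + 1) (hnm : 0 < n + m) (hα : α * (n + m) < s - n) :
    regularityConst N s₁ s n m α ≠ ∞ := by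
  have := nearConst_ne_top hN (sub_pos.2 hα)
  have := gradConst_ne_top (N := N) (s := s) hnm (sub_pos.2 hsn)
  have := energyConst_ne_top hN (m := m) hs₁ hs₁' hs hs'
  have := unitVol_ne_top (N := N)
  unfold regularityConst
  finiteness

lemma gagliardoPow_weakGradient_le_localBound (hN : 1 ≤ N) (hs₁ : 0 < s₁) (hs₁' : s₁ < 1)
    (hn : 1 ≤ n) (hm : 1 ≤ m) (hsp : n < sp * (n + 1)) (hsp' : sp < 1) (hα : 0 < α)
    (hα' : α * (n + m) < sp * (n + 1) - n)
    (hsol : IsWeakSolution s₁ sp (n + 1) Ω u) (hb : LocallyBounded Ω u)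
    (hG : IsWeakGradient Ω u G) (hδ : 0 < δ) (hδ1 : δ ≤ 1) (hr : 0 ≤ r) (hrR : r + 7 * δ ≤ R)
    (hR : R ≤ 1) (hΩ : closedBall x₀ R ⊆ Ω) :
    gagliardoPow α (n + m) (ball x₀ r) G ≤
      (nearConst N (sp * (n + 1) - n - α * (n + m)) *
          gradConst N (n + m) (sp * (n + 1)) (sp * (n + 1) - n) *
          energyConst N s₁ (sp * (n + 1)) n m + ENNReal.ofReal (2 ^ (n + m)) * unitVol N) *
        localBound sp (n + 1) (n + m) δ u G x₀ R := by
  set G' := (closedBall x₀ R).indicator G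
  set s := sp * (n + 1)
  set q := n + m
  set L := localBound sp (n + 1) q δ u G x₀ R
  have G'_meas : AEStronglyMeasurable G' :=
    (integrable_indicator_of_isCompact hG.2.1 (isCompact_closedBall x₀ R) hΩ).aestronglyMeasurable
  have G'_eq : ∀ x ∈ ball x₀ R, G' x = G x := fun x hx =>
    indicator_of_mem (ball_subset_closedBall hx) G
  have r_le : ball x₀ r ⊆ ball x₀ R := ball_subset_ball (by linarith)
  have increment_le : ∀ k : E N, ‖k‖ ≤ δ → ∫⁻ x in ball x₀ r, ‖G' (x + k) - G' x‖ₑ ^ q ≤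
      gradConst N q s (s - n) * (energyConst N s₁ s n m * L) * ENNReal.ofReal (‖k‖ ^ (s - n)) := by
    intro k hk
    refine le_of_eq_of_le (setLIntegral_congr_fun measurableSet_ball fun x hx => ?_)
      (lintegral_weakGradient_increment_le_localBound hN hs₁ hs₁' hn hm hsp hsp' hsol hb hG hδ hδ1
        hr hrR hR hΩ hk)
    rw [G'_eq x (r_le hx), G'_eq (x + k) (add_mem_ball_of_norm_le hx hk (by linarith))]
  have far_le : ENNReal.ofReal (δ ^ (-((N : ℝ) + α * q))) * ∫⁻ x in ball x₀ r, ‖G' x‖ₑ ^ q ≤ L := by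
    refine mul_le_mul' (ENNReal.ofReal_le_ofReal ?_) ?_
    · refine Real.rpow_le_rpow_of_exponent_ge hδ hδ1 ?_
      have : s < n + 1 := mul_lt_of_lt_one_left (by linarith) hsp'
      linarith
    · rw [setLIntegral_congr_fun measurableSet_ball fun x hx => by rw [G'_eq x (r_le hx)]]
      exact (lintegral_mono_set r_le).trans le_add_self
  rw [← gagliardoPow_congr measurableSet_ball fun x hx => G'_eq x (r_le hx)]
  calc gagliardoPow α q (ball x₀ r) G'
      ≤ nearConst N (s - n - α * q) * (gradConst N q s (s - n) * (energyConst N s₁ s n m * L)) +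
          ENNReal.ofReal (δ ^ (-((N : ℝ) + α * q))) * ENNReal.ofReal (2 ^ q) *
            (unitVol N * ∫⁻ x in ball x₀ r, ‖G' x‖ₑ ^ q) :=
        gagliardoPow_le_of_increment (by linarith) hα hδ (by linarith) G'_meas increment_le
    _ = nearConst N (s - n - α * q) * gradConst N q s (s - n) * energyConst N s₁ s n m * L +
          ENNReal.ofReal (2 ^ q) * unitVol N *
            (ENNReal.ofReal (δ ^ (-((N : ℝ) + α * q))) * ∫⁻ x in ball x₀ r, ‖G' x‖ₑ ^ q) := by
        ring
    _ ≤ _ := by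
        rw [add_mul]
        exact add_le_add le_rfl (mul_le_mul_right far_le _)

lemma one_add_rpow_add_rpow_le {q : ℝ} (hq : 0 ≤ q) (S T : ℝ≥0∞) :
    1 + S ^ q + T ^ q ≤ 3 * (S + T + 1) ^ q := by
  have one_le : 1 ≤ (S + T + 1) ^ q := by
    simpa only [ENNReal.one_rpow] using ENNReal.rpow_le_rpow (le_add_self : 1 ≤ S + T + 1) hq
  have S_le : S ^ q ≤ (S + T + 1) ^ q := ENNReal.rpow_le_rpow (le_add_right le_self_add) hq
  have T_le : T ^ q ≤ (S + T + 1) ^ q := ENNReal.rpow_le_rpow (le_add_right le_add_self) hq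
  calc 1 + S ^ q + T ^ q ≤ (S + T + 1) ^ q + (S + T + 1) ^ q + (S + T + 1) ^ q := by gcongr
    _ = 3 * (S + T + 1) ^ q := by ring

lemma div_eight_rpow_neg_le {a b d : ℝ} (hd : 0 < d) (hd1 : d ≤ 1) (hab : a ≤ b) :
    (d / 8) ^ (-a) ≤ 8 ^ a * (d ^ b)⁻¹ := by
  rw [Real.div_rpow hd.le (by norm_num), Real.rpow_neg (by norm_num : (0 : ℝ) ≤ 8),
    div_inv_eq_mul, mul_comm, ← Real.rpow_neg hd.le]
  gcongr 8 ^ a * ?_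
  exact Real.rpow_le_rpow_of_exponent_ge hd hd1 (by linarith)

lemma localBound_le {p q : ℝ} (hq : 0 < q) (hrR : r < R) (hR : R - r ≤ 1) :
    localBound sp p q ((R - r) / 8) u G x₀ R ≤
      ENNReal.ofReal (8 ^ ((N : ℝ) + 2 * q)) * 3 *
        ENNReal.ofReal ((R - r) ^ ((N : ℝ) + 2 * q + 2))⁻¹ *
        (bigT sp p u x₀ R + eLpNorm G (ENNReal.ofReal q) (volume.restrict (ball x₀ R)) +
          1) ^ q := by
  rw [localBound, ← eLpNorm_ofReal_rpow hq G]
  refine (mul_le_mul' (ENNReal.ofReal_le_ofReal (div_eight_rpow_neg_le (sub_pos.2 hrR) hR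
    (le_add_of_nonneg_right zero_le_two))) (one_add_rpow_add_rpow_le hq.le _ _)).trans_eq ?_
  rw [ENNReal.ofReal_mul (by positivity)]
  ring

lemma gagliardoPow_weakGradient_le (hN : 1 ≤ N) (hs₁ : 0 < s₁) (hs₁' : s₁ < 1)
    (hn : 1 ≤ n) (hm : 1 ≤ m) (hsp : n < sp * (n + 1)) (hsp' : sp < 1) (hα : 0 < α)
    (hα' : α * (n + m) < sp * (n + 1) - n)
    (hsol : IsWeakSolution s₁ sp (n + 1) Ω u) (hb : LocallyBounded Ω u)
    (hG : IsWeakGradient Ω u G) (hr : 0 ≤ r) (hrR : r < R) (hR : R ≤ 1)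
    (hΩ : closedBall x₀ R ⊆ Ω) :
    gagliardoPow α (n + m) (ball x₀ r) G ≤
      regularityConst N s₁ (sp * (n + 1)) n m α *
        ENNReal.ofReal ((R - r) ^ ((N : ℝ) + 2 * (n + m) + 2))⁻¹ *
        (bigT sp (n + 1) u x₀ R + eLpNorm G (ENNReal.ofReal (n + m)) (volume.restrict (ball x₀ R)) +
          1) ^ (n + m) := by
  refine (gagliardoPow_weakGradient_le_localBound (δ := (R - r) / 8) hN hs₁ hs₁' hn hm hsp hsp' hα
    hα' hsol hb hG (by linarith) (by linarith) hr (by linarith) hR hΩ).trans ?_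
  refine (mul_le_mul_right (localBound_le (by linarith) hrR (by linarith)) _).trans_eq ?_
  rw [regularityConst]
  ring

lemma memSobolevOneAddLoc_of_locally {q : ℝ} (hq : 1 ≤ q) (hα : 0 < α) (hΩ : IsOpen Ω)
    (hG : IsWeakGradient Ω u G)
    (huG : ∀ V : Set (E N), CompactlyInside V Ω → MemLq q V u ∧ MemLq q V G)
    (h : ∀ x ∈ Ω, ∃ ρ > 0, ball x ρ ⊆ Ω ∧ gagliardoPow α q (ball x ρ) G < ∞) :
    MemSobolevOneAddLoc α q Ω u := by
  have indicator_meas : AEStronglyMeasurable (Ω.indicator G) :=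
    (aestronglyMeasurable_indicator_iff hΩ.measurableSet).2 hG.2.1.aestronglyMeasurable
  refine ⟨G, hG, fun V hV => (huG V hV).1, fun V hV => ⟨(huG V hV).2, ?_⟩⟩
  have indicator_eqOn {W : Set (E N)} (hW : W ⊆ Ω) : EqOn (Ω.indicator G) G W := fun x hx =>
    indicator_of_mem (hW hx) G
  have hVΩ : V ⊆ Ω := subset_closure.trans hV.2.2
  have V_meas : MeasurableSet V := hV.1.measurableSet
  rw [← gagliardoPow_congr V_meas (indicator_eqOn hVΩ)]
  refine gagliardoPow_lt_top_of_locally hq hα V_meas hV.2.1 indicator_meas ?_ fun x hx => ?_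
  · rw [setLIntegral_congr_fun V_meas fun x hx => by rw [indicator_eqOn hVΩ hx],
      ← eLpNorm_ofReal_rpow (by linarith)]
    exact ENNReal.rpow_lt_top_of_nonneg (by linarith) (huG V hV).2.2.ne
  · obtain ⟨ρ, hρ, hρΩ, lt_top⟩ := h x (hV.2.2 hx)
    refine ⟨ρ, hρ, ?_⟩
    rwa [gagliardoPow_congr measurableSet_ball (indicator_eqOn hρΩ)]

end Regularity

lemma exists_gagliardoPow_weakGradient_le (N : ℕ) (hN : 1 ≤ N) (p q s₁ sp α : ℝ) (hp : 2 ≤ p)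
    (hq : p ≤ q) (hs₁ : 0 < s₁) (hs₁' : s₁ < 1) (hsp : (p - 1) / p < sp) (hsp' : sp < 1)
    (hα : 0 < α) (hα' : α < (sp * p - (p - 1)) / q) :
    ∃ C : ℝ, 0 < C ∧ ∀ (Ω : Set (E N)) (u : E N → ℝ), IsWeakSolution s₁ sp p Ω u →
      LocallyBounded Ω u → ∀ G : E N → E N, IsWeakGradient Ω u G →
        ∀ (x₀ : E N) (R r : ℝ), 0 < r → r < R → R ≤ 1 → closedBall x₀ R ⊆ Ω →
          gagliardoPow α q (ball x₀ r) G ≤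
            ENNReal.ofReal (C / (R - r) ^ ((N : ℝ) + 2 * q + 2)) *
              (bigT sp p u x₀ R + eLpNorm G (ENNReal.ofReal q) (volume.restrict (ball x₀ R)) +
                1) ^ q := by
  obtain ⟨n, rfl⟩ : ∃ n, p = n + 1 := ⟨p - 1, by ring⟩
  obtain ⟨m, rfl⟩ : ∃ m, q = n + m := ⟨q - n, by ring⟩
  rw [add_sub_cancel_right, div_lt_iff₀ (by linarith)] at hsp
  rw [add_sub_cancel_right, lt_div_iff₀ (by linarith)] at hα'
  have hs' : sp * (n + 1) < n + 1 := mul_lt_of_lt_one_left (by linarith) hsp'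
  have c_ne_top : regularityConst N s₁ (sp * (n + 1)) n m α ≠ ∞ :=
    regularityConst_ne_top hN hs₁ hs₁' (by linarith) hsp hs' (by linarith) hα'
  set c := regularityConst N s₁ (sp * (n + 1)) n m α
  refine ⟨c.toReal + 1, by positivity, fun Ω u hsol hb G hG x₀ R r hr hrR hR hΩ => ?_⟩
  refine (gagliardoPow_weakGradient_le hN hs₁ hs₁' (by linarith) (by linarith) hsp hsp' hα hα' hsol
    hb hG hr.le hrR hR hΩ).trans (mul_le_mul' ?_ le_rfl)
  rw [div_eq_mul_inv, ENNReal.ofReal_mul (by positivity)]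
  refine mul_le_mul' ?_ le_rfl
  exact (ENNReal.le_ofReal_iff_toReal_le c_ne_top (by positivity)).2 (by linarith)

end NonlocalOneP

theorem lemma5p6_general (N : ℕ) (hN : 1 ≤ N) (p q s₁ sp α : ℝ)
    (hp : 2 ≤ p) (hq : p ≤ q)
    (hs₁ : 0 < s₁) (hs₁' : s₁ < 1) (hsp : (p - 1) / p < sp) (hsp' : sp < 1)
    (hα : 0 < α) (hα' : α < (sp * p - (p - 1)) / q) :
    ∃ C : ℝ, 0 < C ∧
      ∀ (Ω : Set (E N)), IsOpen Ω →
      ∀ u : E N → ℝ, IsWeakSolution s₁ sp p Ω u → LocallyBounded Ω u →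
        MemSobolevOneLoc q Ω u →
        MemSobolevOneAddLoc α q Ω u ∧
        ∀ G : E N → E N, IsWeakGradient Ω u G →
          ∀ (x₀ : E N) (R r : ℝ), 0 < r → r < R → R ≤ 1 → closedBall x₀ R ⊆ Ω →
            gagliardoPow α q (ball x₀ r) G ≤
              ENNReal.ofReal (C / (R - r) ^ ((N : ℝ) + 2 * q + 2)) *
                (bigT sp p u x₀ R +
                  eLpNorm G (ENNReal.ofReal q) (volume.restrict (ball x₀ R)) + 1) ^ q := by
  obtain ⟨C, hC, estimate⟩ :=
    exists_gagliardoPow_weakGradient_le N hN p q s₁ sp α hp hq hs₁ hs₁' hsp hsp' hα hα'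
  refine ⟨C, hC, fun Ω hΩo u hsol hb ⟨G, hG, huG⟩ => ⟨?_, estimate Ω u hsol hb⟩⟩
  refine memSobolevOneAddLoc_of_locally (by linarith) hα hΩo hG huG fun x hx => ?_
  obtain ⟨ε, hε, hball⟩ := nhds_basis_closedBall.mem_iff.1 (hΩo.mem_nhds hx)
  have hR : 0 < min ε 1 := by positivity
  have hΩ : closedBall x (min ε 1) ⊆ Ω :=
    (closedBall_subset_closedBall (min_le_left _ _)).trans hball
  have hsp0 : 0 < sp := (div_pos (by linarith) (by linarith)).trans hsp
  have bigT_ne_top := bigT_ne_top hsp0 (by linarith) hR hsol.mem_tail hb hΩ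
  have eLpNorm_ne_top := (huG _ (compactlyInside_ball hΩ)).2.2.ne
  refine ⟨min ε 1 / 2, by positivity,
    (ball_subset_closedBall.trans (closedBall_subset_closedBall (by linarith))).trans hΩ,
    (estimate Ω u hsol hb G hG x (min ε 1) (min ε 1 / 2) (by positivity) (by linarith)
      (min_le_right _ _) hΩ).trans_lt ?_⟩
  exact ENNReal.mul_lt_top ENNReal.ofReal_lt_top
    (ENNReal.rpow_lt_top_of_nonneg (by linarith) (by finiteness))

theorem lemma5p6 (N : ℕ) (hN : 2 ≤ N) (p q s₁ sp α : ℝ)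
    (hp : 2 ≤ p) (hq : p ≤ q)
    (hs₁ : 0 < s₁) (hs₁' : s₁ < 1) (hsp : (p - 1) / p < sp) (hsp' : sp < 1)
    (hα : 0 < α) (hα' : α < (sp * p - (p - 1)) / q) :
    ∃ C : ℝ, 0 < C ∧
      ∀ (Ω : Set (E N)), IsOpen Ω → IsConnected Ω → Bornology.IsBounded Ω →
      ∀ u : E N → ℝ, IsWeakSolution s₁ sp p Ω u → LocallyBounded Ω u →
        MemSobolevOneLoc q Ω u →
        MemSobolevOneAddLoc α q Ω u ∧
        ∀ G : E N → E N, IsWeakGradient Ω u G →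
          ∀ (x₀ : E N) (R r : ℝ), 0 < r → r < R → R < 1 → Metric.closedBall x₀ R ⊆ Ω →
            gagliardoPow α q (Metric.ball x₀ r) G ≤
              ENNReal.ofReal (C / (R - r) ^ ((N : ℝ) + 2 * q + 2)) *
                (bigT sp p u x₀ R +
                  MeasureTheory.eLpNorm G (ENNReal.ofReal q)
                    (MeasureTheory.volume.restrict (Metric.ball x₀ R)) + 1) ^ q := by
  obtain ⟨C, hC, h⟩ := lemma5p6_general N (by omega) p q s₁ sp α hp hq hs₁ hs₁' hsp hsp' hα hα'
  exact ⟨C, hC, fun Ω hΩ _ _ u hsol hb hu => ⟨(h Ω hΩ u hsol hb hu).1, fun G hG x₀ R r hr hrR hR =>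
    (h Ω hΩ u hsol hb hu).2 G hG x₀ R r hr hrR hR.le⟩⟩
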